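/- A temporal graph $\mathcal G=(G,\lambda)$ consists of a finite static graph $G$ without loops (its footprint; directed or undirected, without parallel edges, antiparallel arcs being allowed in the directed case) and a time label $\lambda(e)\in\mathbb N$ for every edge $e$. A temporal path is a path of $G$ whose edge labels strictly increase; its arrival time is the label of its last edge (a path with a single vertex meets every deadline). A delaying of $\lambda$ is an assignment $\lambda'$ with $\lambda'(e)\ge\lambda(e)$ for every edge $e$. In the problem DelayBetter one is given $(G,\lambda)$ and a finite set of demands $D\subseteq V(G)\times V(G)\times\mathbb N$, and asks whether there is a delaying $\lambda'$ of $\lambda$ such that for every $(u,v,t)\in D$ there is a temporal path from $u$ to $v$ in $(G,\lambda')$ with arrival time at most $t$. A feedback edge set of $G$ is a set of edges whose removal leaves no cycle; if $G$ is directed, this means a set of arcs whose removal leaves a digraph whose underlying undirected simple graph has no cycle. Let $\rho$ be the minimum size of a feedback edge set of $G$, and let $n$ be the length of the input, with times written in binary. Running time is the number of elementary steps of a fixed program whose data are binary trees (the language WHILE: building or projecting a pair, assigning, and testing for nil cost one step each). **Theorem.** DelayBetter can be solved in time $O(\rho!\cdot 2^{\rho|D|}\cdot\mathrm{poly}(n))$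 on directed temporal graphs and in time $O(\rho!\cdot 3^{\rho|D|}\cdot\mathrm{poly}(n))$ on undirected temporal graphs. Consequently, on directed and on undirected temporal graphs, DelayBetter is fixed-parameter tractable in $\rho+|D|$: there is a computable function $f$ such that it can be solved in time $f(\rho+|D|)\cdot\mathrm{poly}(n)$. -/

import Mathlib

namespace DelayBetter

/-! ### Machine model: the language `WHILE` over binary trees, with its step count

A program is a fixed finite command. The values are binary trees built from `nil` by pairing (the
S-expressions of LISP), held in finitely many variables. Building a pair, projecting a pair, copying
a reference, assigning, and testing for `nil` are constant-time pointer operations, and each is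
charged one step. There is no built-in arithmetic and no comparison of whole trees. -/

/-- Binary trees. -/
inductive Data : Type
  | nil : Data
  | cons : Data → Data → Data

namespace Data

/-- Left component (of `nil`: `nil`). -/
def hd : Data → Data
  | nil => nil
  | cons a _ => a

/-- Right component (of `nil`: `nil`). -/
def tl : Data → Data
  | nil => nil
  | cons _ b => b

/-- Number of nodes of a tree: the length of an input. -/
def size : Data → ℕ
  | nil => 1
  | cons a b => a.size + b.size + 1

end Data

/-- Expressions; variables are numbered. -/
inductive Expr : Type
  | var : ℕ → Expr
  | nil : Expr
  | cons : Expr → Expr → Expr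
  | hd : Expr → Expr
  | tl : Expr → Expr

/-- A store assigns a value to every variable. -/
abbrev Store : Type := ℕ → Data

namespace Expr

/-- Value of an expression. -/
def eval (s : Store) : Expr → Data
  | var x => s x
  | nil => Data.nil
  | cons e f => Data.cons (e.eval s) (f.eval s)
  | hd e => (e.eval s).hd
  | tl e => (e.eval s).tl

/-- Number of steps that evaluating an expression takes: one for each of its operations. -/
def cost : Expr → ℕ
  | var _ => 1
  | nil => 1
  | cons e f => e.cost + f.cost + 1
  | hd e => e.cost + 1
  | tl e => e.cost + 1

end Expr

/-- Commands, that is, programs. -/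
inductive Cmd : Type
  | skip : Cmd
  | assign : ℕ → Expr → Cmd
  | seq : Cmd → Cmd → Cmd
  | ite : Expr → Cmd → Cmd → Cmd
  | loop : Expr → Cmd → Cmd

/-- `Exec c s s' t`: the command `c`, started in the store `s`, halts in the store `s'` after
exactly `t` steps. In tests, `nil` means false and every other tree means true; `loop e c` is
"while `e` do `c`". -/
inductive Exec : Cmd → Store → Store → ℕ → Prop
  | skip (s : Store) : Exec Cmd.skip s s 1
  | assign (x : ℕ) (e : Expr) (s : Store) :
      Exec (Cmd.assign x e) s (Function.update s x (e.eval s)) (e.cost + 1)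
  | seq {c d : Cmd} {s s' s'' : Store} {t t' : ℕ} :
      Exec c s s' t → Exec d s' s'' t' → Exec (Cmd.seq c d) s s'' (t + t')
  | iteTrue {e : Expr} {c d : Cmd} {s s' : Store} {t : ℕ} :
      e.eval s ≠ Data.nil → Exec c s s' t → Exec (Cmd.ite e c d) s s' (e.cost + 1 + t)
  | iteFalse {e : Expr} {c d : Cmd} {s s' : Store} {t : ℕ} :
      e.eval s = Data.nil → Exec d s s' t → Exec (Cmd.ite e c d) s s' (e.cost + 1 + t)
  | loopTrue {e : Expr} {c : Cmd} {s s' s'' : Store} {t t' : ℕ} :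
      e.eval s ≠ Data.nil → Exec c s s' t → Exec (Cmd.loop e c) s' s'' t' →
        Exec (Cmd.loop e c) s s'' (e.cost + 1 + t + t')
  | loopFalse {e : Expr} {c : Cmd} {s : Store} :
      e.eval s = Data.nil → Exec (Cmd.loop e c) s s (e.cost + 1)

/-- Initial store: the input is in variable `0`, all other variables are `nil`. -/
def inputStore (w : Data) : Store := fun x => if x = 0 then w else Data.nil

/-- The decision problem with instances `ι`, admissible encodings `Enc` and question `Q` is solvable
in time `O(B(I) · poly(n))`, where `n` is the length of the encoded instance: one program halts on
every encoding of every instance `I` within `B(I) · p(n)` steps, for a fixed polynomial `p`, and its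
answer (in variable `0`, where `nil` means "no") is correct. -/
def SolvableInTimePoly {ι : Type} (Enc : ι → Data → Prop) (Q : ι → Prop) (B : ι → ℕ) : Prop :=
  ∃ (c : Cmd) (p : Polynomial ℕ), ∀ (I : ι) (w : Data), Enc I w →
    ∃ (s : Store) (t : ℕ), Exec c (inputStore w) s t ∧
      t ≤ B I * p.eval w.size ∧ (s 0 ≠ Data.nil ↔ Q I)

/-- The problem is fixed-parameter tractable in the parameter `κ`: solvable in time
`f(κ(I)) · poly(n)` for a computable function `f`. -/
def FixedParameterTractable {ι : Type} (Enc : ι → Data → Prop) (Q : ι → Prop) (κ : ι → ℕ) : Prop :=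
  ∃ f : ℕ → ℕ, Computable f ∧ SolvableInTimePoly Enc Q (fun I => f (κ I))

/-! ### Encodings -/

/-- A list of trees as a tree. -/
def encList : List Data → Data
  | [] => Data.nil
  | a :: l => Data.cons a (encList l)

/-- A natural number in binary, as the list of its bits (least significant bit first). -/
def encNat (k : ℕ) : Data :=
  encList (k.bits.map fun b => if b then Data.cons Data.nil Data.nil else Data.nil)

/-- Three numbers as a tree. -/
def encTriple (a b c : ℕ) : Data := Data.cons (encNat a) (Data.cons (encNat b) (encNat c))

/-- The list of the vertices `0, …, n - 1`, a list of triples (endpoint, endpoint, time label) for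
the edges, and a list of triples (source, target, latest arrival time) for the demands. -/
def encInstance {n : ℕ} (edges : List (Fin n × Fin n × ℕ)) (demands : List (Fin n × Fin n × ℕ)) :
    Data :=
  Data.cons (encList ((List.finRange n).map fun v => encNat v))
    (Data.cons (encList (edges.map fun e => encTriple e.1 e.2.1 e.2.2))
      (encList (demands.map fun d => encTriple d.1 d.2.1 d.2.2)))

/-! ### Temporal paths -/

/-- Time labels, in order of traversal, of the edges of the path with vertex sequence `P`, where
`τ x y` is the label of the edge used to go from `x` to `y`. -/
def timesAlong {V : Type} (τ : V → V → ℕ) (P : List V) : List ℕ :=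
  (P.zip P.tail).map fun e => τ e.1 e.2

/-- `P` is the vertex sequence of a (strict) temporal path from `u` to `v`: a path all of whose
steps follow `Adj`, with strictly increasing time labels. -/
structure IsTemporalPath {V : Type} (Adj : V → V → Prop) (τ : V → V → ℕ) (u v : V) (P : List V) :
    Prop where
  starts : P.head? = some u
  ends : P.getLast? = some v
  nodup : P.Nodup
  chain : P.IsChain Adj
  increasing : (timesAlong τ P).Pairwise (· < ·)

/-- The arrival time, that is, the label of the last edge, is at most `t`. (A path with a single
vertex has no last edge and meets every deadline.) -/
def ArrivesBy {V : Type} (τ : V → V → ℕ) (P : List V) (t : ℕ) : Prop :=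
  ∀ a ∈ (timesAlong τ P).getLast?, a ≤ t

/-- Every demand `(u, v, t)` in `D` is met by a temporal path from `u` to `v` with arrival time at
most `t`. -/
def MeetsDemands {V : Type} (Adj : V → V → Prop) (τ : V → V → ℕ) (D : Finset (V × V × ℕ)) : Prop :=
  ∀ d ∈ D, ∃ P : List V, IsTemporalPath Adj τ d.1 d.2.1 P ∧ ArrivesBy τ P d.2.2

/-! ### Directed instances -/

/-- A directed temporal graph with vertices `0, …, n - 1` and a set of demands. Only the values of
`label` on arcs of the footprint matter. -/
structure DirectedInstance : Type where
  n : ℕ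
  footprint : Digraph (Fin n)
  loopless : ∀ v, ¬ footprint.Adj v v
  label : Fin n → Fin n → ℕ
  demands : Finset (Fin n × Fin n × ℕ)

namespace DirectedInstance

/-- `τ` is a delaying of the time labels of `I`. -/
def IsDelaying (I : DirectedInstance) (τ : Fin I.n → Fin I.n → ℕ) : Prop :=
  ∀ u v, I.footprint.Adj u v → I.label u v ≤ τ u v

/-- The question of the problem. -/
def IsYes (I : DirectedInstance) : Prop :=
  ∃ τ : Fin I.n → Fin I.n → ℕ, I.IsDelaying τ ∧ MeetsDemands I.footprint.Adj τ I.demands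

/-- A set `F` of arcs whose removal leaves a digraph whose underlying undirected simple graph has no
cycles. -/
def IsFeedbackEdgeSet (I : DirectedInstance) (F : Finset (Fin I.n × Fin I.n)) : Prop :=
  (∀ e ∈ F, I.footprint.Adj e.1 e.2) ∧
    (SimpleGraph.fromRel fun u v => I.footprint.Adj u v ∧ (u, v) ∉ F).IsAcyclic

/-- The smallest size of a feedback edge set of the footprint. -/
noncomputable def fes (I : DirectedInstance) : ℕ :=
  sInf {k | ∃ F, I.IsFeedbackEdgeSet F ∧ F.card = k}

/-- `w` encodes `I`: arcs and demands are listed without repetition, in any order. -/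
def IsEncoding (I : DirectedInstance) (w : Data) : Prop :=
  ∃ (arcs : List (Fin I.n × Fin I.n)) (ds : List (Fin I.n × Fin I.n × ℕ)),
    arcs.Nodup ∧ (∀ e, e ∈ arcs ↔ I.footprint.Adj e.1 e.2) ∧
    ds.Nodup ∧ (∀ d, d ∈ ds ↔ d ∈ I.demands) ∧
    w = encInstance (arcs.map fun e => (e.1, e.2, I.label e.1 e.2)) ds

end DirectedInstance

/-! ### Undirected instances -/

/-- An undirected temporal graph with vertices `0, …, n - 1` and a set of demands. Only the values
of `label` on edges of the footprint matter. -/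
structure UndirectedInstance : Type where
  n : ℕ
  footprint : SimpleGraph (Fin n)
  label : Sym2 (Fin n) → ℕ
  demands : Finset (Fin n × Fin n × ℕ)

namespace UndirectedInstance

/-- `τ` is a delaying of the time labels of `I`. -/
def IsDelaying (I : UndirectedInstance) (τ : Sym2 (Fin I.n) → ℕ) : Prop :=
  ∀ e ∈ I.footprint.edgeSet, I.label e ≤ τ e

/-- The question of the problem. -/
def IsYes (I : UndirectedInstance) : Prop :=
  ∃ τ : Sym2 (Fin I.n) → ℕ, I.IsDelaying τ ∧
    MeetsDemands I.footprint.Adj (fun u v => τ s(u, v)) I.demands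

/-- A set `F` of edges whose removal leaves a graph without cycles. -/
def IsFeedbackEdgeSet (I : UndirectedInstance) (F : Finset (Sym2 (Fin I.n))) : Prop :=
  (∀ e ∈ F, e ∈ I.footprint.edgeSet) ∧ (I.footprint.deleteEdges (F : Set _)).IsAcyclic

/-- The smallest size of a feedback edge set of the footprint. -/
noncomputable def fes (I : UndirectedInstance) : ℕ :=
  sInf {k | ∃ F, I.IsFeedbackEdgeSet F ∧ F.card = k}

/-- `w` encodes `I`: every edge is listed once, in one of its two orientations, and every demand is
listed once; the order is arbitrary. -/
def IsEncoding (I : UndirectedInstance) (w : Data) : Prop :=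
  ∃ (edges : List (Fin I.n × Fin I.n)) (ds : List (Fin I.n × Fin I.n × ℕ)),
    (edges.map fun e => s(e.1, e.2)).Nodup ∧
    (∀ u v, s(u, v) ∈ (edges.map fun e => s(e.1, e.2)) ↔ I.footprint.Adj u v) ∧
    ds.Nodup ∧ (∀ d, d ∈ ds ↔ d ∈ I.demands) ∧
    w = encInstance (edges.map fun e => (e.1, e.2, I.label s(e.1, e.2))) ds

end UndirectedInstance

end DelayBetter

namespace DelayBetter
open Polynomial

/-! Fix a spanning forest `T` of the footprint and let `F` be the set of edges outside it. A simple
path is determined by the moves it makes along `F`, in their order: between two of them it runs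
inside `T`, where simple walks are unique (`connect_eq`). Suppose a delaying `μ` solves the instance
and sort `F` by `μ`. Times increase along every demand path, so every demand path meets its edges of
`F` in this one order. It therefore suffices to guess an ordering of `F`, in `|F|!` ways, and for
each demand and each edge of `F` whether the edge is used and, if the graph is undirected, in which
direction. This gives 2 or 3 options per pair of a demand and an edge of `F`.

A guess fixes one walk per demand, and it remains to find times. Each pair of consecutive edges on a
walk demands that the second be later than the first. Starting from the given labels, simultaneous
relaxation of these constraints stays below every solution (`iterate_relaxFun_le`) and is stable
after `|E|` rounds if there is a solution (`relaxFun_stable`), so it suffices to test the relaxed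
times. Accepted walks need not be simple, since shortening a walk keeps its times increasing
(`HasSolution.of_walks`). Soundness and completeness are `verify_sound` and `verify_complete`.

The bound in terms of `ρ` needs `|F| ≤ ρ`. For directed graphs an antiparallel pair counts as one
edge of the underlying simple graph, so both of its arcs can be kept, and an optimal forest contains
as many such pairs as possible. The forest is built greedily with the arcs of pairs first. Its
optimality (`WellFormed.length_le_forest`) follows from two rank comparisons in the space spanned by
the vertices.

For the machine model, `PolyTime` is closed under enough operations that the polynomial parts of the
algorithm can be written as ordinary functions. The only exponential part is one loop, a depth first
search through all guesses with a stack of polynomial size (`exists_search`). Its number of steps is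
the number of guesses times a polynomial. -/

theorem eval_mono (p : ℕ[X]) : Monotone fun n => p.eval n := by
  intro m n h
  induction p using Polynomial.induction_on' with
  | add p q hp hq => simpa using Nat.add_le_add hp hq
  | monomial k a => simpa using Nat.mul_le_mul_left a (Nat.pow_le_pow_left h k)

/-! ### Encoded types -/

/-- A type whose elements are represented by trees. -/
class Enc (α : Type) where
  enc : α → Data

open Enc (enc)

/-- Length of the representation. -/
def sz {α : Type} [Enc α] (a : α) : ℕ := (enc a).size

instance : Enc ℕ := ⟨encNat⟩

instance : Enc Bool := ⟨fun b => if b then Data.cons Data.nil Data.nil else Data.nil⟩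

instance {α β : Type} [Enc α] [Enc β] : Enc (α × β) := ⟨fun p => Data.cons (enc p.1) (enc p.2)⟩

instance {α : Type} [Enc α] : Enc (List α) := ⟨fun l => encList (l.map enc)⟩

/-- `f` is computed, on representations, by a program that runs in polynomial time in every store
and touches only finitely many variables. -/
@[fun_prop]
def PolyTime {α β : Type} [Enc α] [Enc β] (f : α → β) : Prop :=
  ∃ (c : Cmd) (K : ℕ) (p : ℕ[X]), 0 < K ∧ ∀ a : α, sz (f a) ≤ p.eval (sz a) ∧
    ∀ s : Store, s 0 = enc a → ∃ (s' : Store) (t : ℕ), Exec c s s' t ∧ s' 0 = enc (f a) ∧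
      (∀ x, K ≤ x → s' x = s x) ∧ t ≤ p.eval (sz a)

section
variable {α β γ δ : Type} [Enc α] [Enc β] [Enc γ] [Enc δ]

theorem sz_pos (a : α) : 0 < sz a := by
  unfold sz; cases enc a <;> simp [Data.size]

@[simp] theorem sz_pair (a : α) (b : β) : sz (a, b) = sz a + sz b + 1 := rfl

@[simp] theorem sz_nil : sz ([] : List α) = 1 := rfl

@[simp] theorem sz_cons (a : α) (l : List α) : sz (a :: l) = sz a + sz l + 1 := rfl

theorem enc_pair (a : α) (b : β) : enc (a, b) = Data.cons (enc a) (enc b) := rfl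

theorem enc_nil : enc ([] : List α) = Data.nil := rfl

theorem enc_cons (a : α) (l : List α) : enc (a :: l) = Data.cons (enc a) (enc l) := rfl

theorem sz_append (l m : List α) : sz (l ++ m) + 1 = sz l + sz m := by
  induction l with
  | nil => simp; omega
  | cons a l ih => simp; omega

theorem length_lt_sz (l : List α) : l.length < sz l := by
  induction l with
  | nil => simp
  | cons a l ih => simp; omega

theorem sz_le_of_mem {a : α} {l : List α} (h : a ∈ l) : sz a ≤ sz l := by
  induction l with
  | nil => simp at h
  | cons b l ih =>
    rcases List.mem_cons.1 h with rfl | h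
    · simp; omega
    · have := ih h; simp; omega

theorem sz_le_mul {l : List α} {m : ℕ} (h : ∀ a ∈ l, sz a ≤ m) : sz l ≤ l.length * (m + 1) + 1 := by
  induction l with
  | nil => simp
  | cons b l ih =>
    have h1 := ih fun a ha => h a (by simp [ha])
    have h2 := h b (by simp)
    simp only [sz_cons, List.length_cons, Nat.add_mul]
    omega

theorem sz_reverse (l : List α) : sz l.reverse = sz l := by
  induction l with
  | nil => rfl
  | cons a l ih => have := sz_append l.reverse [a]; simp at *; omega

theorem sz_sublist {l m : List α} (h : l.Sublist m) : sz l ≤ sz m := by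
  induction h with
  | slnil => simp
  | cons a _ ih => simp; omega
  | cons_cons a _ ih => simp; omega

/-! ### Closure properties of `PolyTime` -/

@[fun_prop]
theorem PolyTime.id : PolyTime (fun a : α => a) :=
  ⟨Cmd.skip, 1, X + 1, one_pos, fun a => ⟨by simp, fun s hs =>
    ⟨s, 1, Exec.skip s, hs, fun _ _ => rfl, by simp⟩⟩⟩

/-- An expression that evaluates to the given tree. -/
def Expr.ofData : Data → Expr
  | Data.nil => Expr.nil
  | Data.cons a b => Expr.cons (ofData a) (ofData b)

theorem Expr.eval_ofData (s : Store) (d : Data) : (Expr.ofData d).eval s = d := by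
  induction d with
  | nil => rfl
  | cons a b iha ihb => simp [Expr.ofData, Expr.eval, iha, ihb]

/-- A function that is given by an expression in variable `0`. -/
theorem PolyTime.of_expr {f : α → β} (e : Expr) (p : ℕ[X])
    (he : ∀ (a : α) (s : Store), s 0 = enc a → e.eval s = enc (f a))
    (hp : ∀ a, sz (f a) ≤ p.eval (sz a)) : PolyTime f :=
  ⟨Cmd.assign 0 e, 1, p + C (e.cost + 1), one_pos, fun a => ⟨by simpa using (hp a).trans (by omega),
    fun s hs => ⟨_, _, Exec.assign 0 e s, by simp [he a s hs],
      fun x hx => by rw [Function.update_of_ne (by omega)], by simp⟩⟩⟩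

@[fun_prop]
theorem PolyTime.const (b : β) : PolyTime (fun _ : α => b) :=
  .of_expr (Expr.ofData (enc b)) (C (sz b)) (fun _ _ _ => Expr.eval_ofData _ _) (by simp)

-- The second program runs on an input of size at most `p`, whence `q.comp p`. The size clause of
-- `PolyTime` cannot be dropped: pairing a variable with itself doubles a tree in constantly many
-- steps, so running time alone does not bound output size.
@[fun_prop]
theorem PolyTime.comp {g : β → γ} {f : α → β} (hg : PolyTime g) (hf : PolyTime f) :
    PolyTime (fun a => g (f a)) := by
  obtain ⟨c, K, p, hK, hf⟩ := hf
  obtain ⟨d, L, q, hL, hg⟩ := hg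
  refine ⟨Cmd.seq c d, max K L, p + q.comp p, by omega, fun a => ?_⟩
  have hm := eval_mono q (hf a).1
  simp only at hm
  refine ⟨by have := (hg (f a)).1; simp; omega, fun s hs => ?_⟩
  obtain ⟨s1, t1, e1, r1, k1, b1⟩ := (hf a).2 s hs
  obtain ⟨s2, t2, e2, r2, k2, b2⟩ := (hg (f a)).2 s1 r1
  refine ⟨s2, _, Exec.seq e1 e2, r2, fun x hx => ?_, by simp; omega⟩
  rw [k2 x (by omega), k1 x (by omega)]

@[fun_prop]
theorem PolyTime.mk {f : α → β} {g : α → γ} (hf : PolyTime f) (hg : PolyTime g) :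
    PolyTime (fun a => (f a, g a)) := by
  obtain ⟨c, K, p, hK, hf⟩ := hf
  obtain ⟨d, L, q, hL, hg⟩ := hg
  -- Variables from `M` on are left alone by both programs: `M` keeps the input and `M + 1` the
  -- first result.
  set M := max K L with hM
  refine ⟨.seq (.assign M (.var 0)) (.seq c (.seq (.assign (M + 1) (.var 0))
    (.seq (.assign 0 (.var M)) (.seq d (.assign 0 (.cons (.var (M + 1)) (.var 0))))))),
    M + 2, p + q + 10, by omega, fun a => ?_⟩
  refine ⟨by have := (hf a).1; have := (hg a).1; simp; omega, fun s hs => ?_⟩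
  obtain ⟨s1, t1, e1, r1, k1, b1⟩ := (hf a).2 (Function.update s M ((Expr.var 0).eval s))
    (by rw [Function.update_of_ne (by omega), hs])
  set s2 := Function.update s1 (M + 1) ((Expr.var 0).eval s1) with hs2
  set s3 := Function.update s2 0 ((Expr.var M).eval s2) with hs3
  obtain ⟨s4, t4, e4, r4, k4, b4⟩ := (hg a).2 s3 (by
    simp only [hs3, Expr.eval, Function.update_self, hs2]
    rw [Function.update_of_ne (by omega), k1 M (by omega), Function.update_self, Expr.eval, hs])
  refine ⟨_, _, .seq (.assign _ _ _) (.seq e1 (.seq (.assign _ _ _) (.seq (.assign _ _ _)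
    (.seq e4 (.assign _ _ _))))), ?_, fun x hx => ?_, ?_⟩
  · simp only [Function.update_self, Expr.eval, r4, enc_pair]
    rw [k4 (M + 1) (by omega), hs3, Function.update_of_ne (by omega), hs2, Function.update_self,
      Expr.eval, r1]
  · rw [Function.update_of_ne (by omega), k4 x (by omega), hs3, Function.update_of_ne (by omega),
      hs2, Function.update_of_ne (by omega), k1 x (by omega), Function.update_of_ne (by omega)]
  · simp [Expr.cost]; omega

@[fun_prop]
theorem PolyTime.fst {f : α → β × γ} (hf : PolyTime f) : PolyTime (fun a => (f a).1) :=
  .comp (g := Prod.fst) (.of_expr (.hd (.var 0)) X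
    (fun a s h => by obtain ⟨a, b⟩ := a; simp [Expr.eval, h, enc_pair, Data.hd])
    (fun a => by obtain ⟨a, b⟩ := a; simp; omega)) hf

@[fun_prop]
theorem PolyTime.snd {f : α → β × γ} (hf : PolyTime f) : PolyTime (fun a => (f a).2) :=
  .comp (g := Prod.snd) (.of_expr (.tl (.var 0)) X
    (fun a s h => by obtain ⟨a, b⟩ := a; simp [Expr.eval, h, enc_pair, Data.tl])
    (fun a => by obtain ⟨a, b⟩ := a; simp; omega)) hf

@[fun_prop]
theorem PolyTime.cons {f : α → β} {g : α → List β} (hf : PolyTime f) (hg : PolyTime g) :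
    PolyTime (fun a => f a :: g a) :=
  .comp (g := fun p : β × List β => p.1 :: p.2) (.of_expr (.var 0) X
    (fun a s h => by obtain ⟨a, b⟩ := a; simp [Expr.eval, h, enc_pair, enc_cons])
    (fun a => by obtain ⟨a, b⟩ := a; simp)) (.mk hf hg)

/-- The test of a branch: `b` is given by an expression that is evaluated on a saved copy of the
input. -/
theorem PolyTime.branch {b : α → β} {f g h : α → γ} (hb : PolyTime b) (hf : PolyTime f)
    (hg : PolyTime g) (h1 : ∀ a, enc (b a) ≠ Data.nil → h a = f a)
    (h2 : ∀ a, enc (b a) = Data.nil → h a = g a) : PolyTime h := by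
  obtain ⟨c, K, p, hK, hf⟩ := hf
  obtain ⟨d, L, q, hL, hg⟩ := hg
  obtain ⟨e, N, r, hN, hb⟩ := hb
  set M := max (max K L) N with hM
  refine ⟨.seq (.assign M (.var 0)) (.seq e (.ite (.var 0)
    (.seq (.assign 0 (.var M)) c) (.seq (.assign 0 (.var M)) d))),
    M + 1, p + q + r + 10, by omega, fun a => ?_⟩
  have hs1 := (hf a).1
  have hs2 := (hg a).1
  refine ⟨?_, fun s hs => ?_⟩
  · by_cases hn : enc (b a) = Data.nil
    · rw [h2 a hn]; simp; omega
    · rw [h1 a hn]; simp; omega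
  obtain ⟨s1, t1, e1, r1, k1, b1⟩ := (hb a).2 (Function.update s M ((Expr.var 0).eval s))
    (by rw [Function.update_of_ne (by omega), hs])
  have h0 : Function.update s1 0 ((Expr.var M).eval s1) 0 = enc a := by
    rw [Function.update_self, Expr.eval, k1 M (by omega), Function.update_self, Expr.eval, hs]
  have hfr : ∀ x, M + 1 ≤ x → Function.update s1 0 ((Expr.var M).eval s1) x = s x := fun x hx => by
    rw [Function.update_of_ne (by omega), k1 x (by omega), Function.update_of_ne (by omega)]
  by_cases hn : enc (b a) = Data.nil
  · obtain ⟨s2, t2, e2, r2, k2, b2⟩ := (hg a).2 _ h0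
    refine ⟨s2, _, .seq (.assign _ _ _) (.seq e1 (.iteFalse (r1.trans hn)
      (.seq (.assign _ _ _) e2))), by rw [r2, h2 a hn], fun x hx => ?_, by simp [Expr.cost]; omega⟩
    rw [k2 x (by omega), hfr x hx]
  · obtain ⟨s2, t2, e2, r2, k2, b2⟩ := (hf a).2 _ h0
    refine ⟨s2, _, .seq (.assign _ _ _) (.seq e1 (.iteTrue (by rwa [Expr.eval, r1])
      (.seq (.assign _ _ _) e2))), by rw [r2, h1 a hn], fun x hx => ?_, by simp [Expr.cost]; omega⟩
    rw [k2 x (by omega), hfr x hx]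

@[fun_prop]
theorem PolyTime.ite {c : α → Bool} {f g : α → β} (hc : PolyTime c) (hf : PolyTime f)
    (hg : PolyTime g) : PolyTime (fun a => if c a then f a else g a) := by
  refine .branch hc hf hg (fun a h => ?_) (fun a h => ?_) <;> cases hca : c a <;>
    simp_all [enc]

theorem PolyTime.tail_aux : PolyTime (fun l : List α => l.tail) :=
  .of_expr (.tl (.var 0)) X (fun a s h => by cases a <;> simp [Expr.eval, h, enc_cons, enc_nil, Data.tl])
    (fun a => by cases a <;> simp; omega)

@[fun_prop]
theorem PolyTime.tail {l : α → List β} (hl : PolyTime l) : PolyTime (fun a => (l a).tail) :=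
  .comp (g := List.tail) .tail_aux hl

@[fun_prop]
theorem PolyTime.headD {l : α → List β} {b : α → β} (hl : PolyTime l) (hb : PolyTime b) :
    PolyTime (fun a => (l a).headD (b a)) := by
  refine .comp (g := fun p : List β × β => p.1.headD p.2) (f := fun a => (l a, b a)) ?_ (hl.mk hb)
  obtain ⟨c, K, p, hK, h⟩ := PolyTime.snd (PolyTime.id (α := List β × β))
  -- A list is encoded by `nil` exactly if it is empty, so the first component of the input is
  -- itself the test.
  refine ⟨.ite (.hd (.var 0)) (.assign 0 (.hd (.hd (.var 0)))) c, K, p + X + 10, hK, ?_⟩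
  rintro ⟨l, b⟩
  obtain ⟨h1, h2⟩ := h (l, b)
  refine ⟨?_, fun s hs => ?_⟩
  · cases l <;> simp at * <;> omega
  cases l with
  | nil =>
    obtain ⟨s', t, e, r, k, bd⟩ := h2 s hs
    exact ⟨s', _, .iteFalse (by simp [Expr.eval, hs, enc_pair, enc_nil, Data.hd]) e, by simpa using r, k,
      by simp [Expr.cost] at *; omega⟩
  | cons a l =>
    exact ⟨_, _, .iteTrue (by simp [Expr.eval, hs, enc_pair, enc_cons, Data.hd]) (.assign _ _ _),
      by simp [Expr.eval, hs, enc_pair, enc_cons, Data.hd],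
      fun x hx => by rw [Function.update_of_ne (by omega)], by simp [Expr.cost]⟩

/-- Case distinction on whether a list is empty. -/
theorem PolyTime.nil_branch {l : α → List δ} {f g h : α → β} (hl : PolyTime l) (hf : PolyTime f)
    (hg : PolyTime g) (h1 : ∀ a, l a ≠ [] → h a = f a) (h2 : ∀ a, l a = [] → h a = g a) :
    PolyTime h := by
  refine .branch hl hf hg (fun a h => h1 a ?_) (fun a h => h2 a ?_) <;> cases hla : l a <;>
    simp_all [enc_nil, enc_cons]

@[fun_prop]
theorem PolyTime.isEmpty {l : α → List β} (hl : PolyTime l) : PolyTime (fun a => (l a).isEmpty) :=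
  .nil_branch hl (.const false) (.const true) (fun a h => by simp [h]) (fun a h => by simp [h])

/-- Running the loop of a fold. -/
theorem exec_fold {step : (α × β) × γ → β} {c : Cmd} {M Q B : ℕ} {a : α} (l : List γ) (b : β)
    (hM : 0 < M)
    (hc : ∀ b x s, sz b ≤ Q → x ∈ l → s 0 = enc ((a, b), x) → ∃ (s' : Store) (t : ℕ), Exec c s s' t ∧
      s' 0 = enc (step ((a, b), x)) ∧ (∀ x, M ≤ x → s' x = s x) ∧ t ≤ B)
    (hQ : ∀ l', l' <+: l → sz (l'.foldl (fun b x => step ((a, b), x)) b) ≤ Q)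
    (s : Store) (h1 : s M = enc a) (h2 : s (M + 1) = enc l) (h3 : s (M + 2) = enc b) :
    ∃ (s' : Store) (t : ℕ), Exec (.loop (.var (M + 1)) (.seq (.assign 0
      (.cons (.cons (.var M) (.var (M + 2))) (.hd (.var (M + 1))))) (.seq c
      (.seq (.assign (M + 2) (.var 0)) (.assign (M + 1) (.tl (.var (M + 1)))))))) s s' t ∧
      s' (M + 2) = enc (l.foldl (fun b x => step ((a, b), x)) b) ∧
      (∀ x, M + 3 ≤ x → s' x = s x) ∧ t ≤ l.length * (B + 30) + 2 := by
  induction l generalizing b s with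
  | nil =>
    exact ⟨s, _, .loopFalse (by simp [Expr.eval, h2, enc_nil]), h3, fun _ _ => rfl,
      by simp [Expr.cost]⟩
  | cons x l ih =>
    -- Variable `M` holds the context, `M + 1` the rest of the list and `M + 2` the accumulator.
    set s1 := Function.update s 0
      ((Expr.cons (.cons (.var M) (.var (M + 2))) (.hd (.var (M + 1)))).eval s) with hs1
    have hs10 : s1 0 = enc ((a, b), x) := by
      simp [hs1, Expr.eval, h1, h2, h3, enc_pair, enc_cons, Data.hd]
    obtain ⟨s2, t2, e2, r2, k2, b2⟩ := hc b x s1 (hQ [] (by simp)) (by simp) hs10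
    have hs1' : ∀ y, 0 < y → s1 y = s y := fun y hy => by
      rw [hs1, Function.update_of_ne (by omega)]
    set s3 := Function.update s2 (M + 2) ((Expr.var 0).eval s2) with hs3
    set s4 := Function.update s3 (M + 1) ((Expr.tl (.var (M + 1))).eval s3) with hs4
    obtain ⟨s', t, e, r, k, bd⟩ := ih (step ((a, b), x))
      (fun b y s hb hy => hc b y s hb (by simp [hy]))
      (fun l' hl' => hQ (x :: l') (List.cons_prefix_cons.2 ⟨rfl, hl'⟩)) s4
      (by rw [hs4, Function.update_of_ne (by omega), hs3, Function.update_of_ne (by omega),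
            k2 M le_rfl, hs1' M hM, h1])
      (by rw [hs4, Function.update_self, Expr.eval, Expr.eval, hs3,
            Function.update_of_ne (by omega), k2 _ (by omega), hs1' _ (by omega), h2]; rfl)
      (by rw [hs4, Function.update_of_ne (by omega), hs3, Function.update_self, Expr.eval, r2])
    refine ⟨s', _, .loopTrue (by simp [Expr.eval, h2, enc_cons]) (.seq (.assign _ _ _)
      (.seq e2 (.seq (.assign _ _ _) (.assign _ _ _)))) e, r, fun y hy => ?_, ?_⟩
    · rw [k y hy, hs4, Function.update_of_ne (by omega), hs3, Function.update_of_ne (by omega),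
        k2 y (by omega), hs1' y (by omega)]
    · simp only [Expr.cost, List.length_cons, Nat.add_mul]; omega

/-- Folds over lists, provided that the accumulator stays polynomially bounded. -/
theorem PolyTime.foldl_of_bound {l : α → List γ} {i : α → β} {step : α → β → γ → β}
    (hl : PolyTime l) (hi : PolyTime i)
    (hstep : PolyTime (fun p : (α × β) × γ => step p.1.1 p.1.2 p.2)) (Q : ℕ[X])
    (hQ : ∀ a l', l' <+: l a → sz (l'.foldl (step a) (i a)) ≤ Q.eval (sz a)) :
    PolyTime (fun a => (l a).foldl (step a) (i a)) := by
  obtain ⟨c, K, p, hK, hl⟩ := hl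
  obtain ⟨d, L, q, hL, hi⟩ := hi
  obtain ⟨e, N, r, hN, hs⟩ := hstep
  set M := max (max K L) N with hM
  refine ⟨.seq (.assign M (.var 0)) (.seq c (.seq (.assign (M + 1) (.var 0))
    (.seq (.assign 0 (.var M)) (.seq d (.seq (.assign (M + 2) (.var 0)) (.seq
    (.loop (.var (M + 1)) (.seq (.assign 0
      (.cons (.cons (.var M) (.var (M + 2))) (.hd (.var (M + 1))))) (.seq e
      (.seq (.assign (M + 2) (.var 0)) (.assign (M + 1) (.tl (.var (M + 1))))))))
    (.assign 0 (.var (M + 2))))))))), M + 3,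
    -- The input `((a, b), x)` of a step has size at most `X + Q + p + 2`, the 2 counting the two
    -- pairing nodes; there are at most `p` steps.
    p + q + Q + p * (r.comp (X + Q + p + 2) + 30) + 30, by omega, fun a => ⟨?_, fun s hs0 => ?_⟩⟩
  · have := hQ a (l a) List.prefix_rfl
    simp; omega
  set s1 := Function.update s M ((Expr.var 0).eval s) with hs1
  obtain ⟨s2, t2, e2, r2, k2, b2⟩ := (hl a).2 s1
    (by rw [hs1, Function.update_of_ne (by omega), hs0])
  set s3 := Function.update s2 (M + 1) ((Expr.var 0).eval s2) with hs3
  set s4 := Function.update s3 0 ((Expr.var M).eval s3) with hs4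
  have hs4M : s4 M = enc a := by
    rw [hs4, Function.update_of_ne (by omega), hs3, Function.update_of_ne (by omega),
      k2 M (by omega), hs1, Function.update_self, Expr.eval, hs0]
  obtain ⟨s5, t5, e5, r5, k5, b5⟩ := (hi a).2 s4 (by
    rw [hs4, Function.update_self, Expr.eval, hs3, Function.update_of_ne (by omega),
      k2 M (by omega), hs1, Function.update_self, Expr.eval, hs0])
  set s6 := Function.update s5 (M + 2) ((Expr.var 0).eval s5) with hs6
  obtain ⟨s7, t7, e7, r7, k7, b7⟩ := exec_fold (step := fun p => step p.1.1 p.1.2 p.2) (c := e)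
    (M := M) (Q := Q.eval (sz a)) (B := r.eval (sz a + Q.eval (sz a) + p.eval (sz a) + 2)) (a := a)
    (l a) (i a) (by omega) (fun b x s hb hx hs0 => by
      obtain ⟨s', t, e, r1, k, bd⟩ := (hs ((a, b), x)).2 s hs0
      refine ⟨s', t, e, r1, fun x hx => k x (by omega), bd.trans (eval_mono r ?_)⟩
      have := sz_le_of_mem hx
      have := (hl a).1
      simp only [sz_pair]; omega) (hQ a) s6
    (by rw [hs6, Function.update_of_ne (by omega), k5 M (by omega), hs4M])
    (by rw [hs6, Function.update_of_ne (by omega), k5 _ (by omega), hs4,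
          Function.update_of_ne (by omega), hs3, Function.update_self, Expr.eval, r2])
    (by rw [hs6, Function.update_self, Expr.eval, r5])
  refine ⟨_, _, .seq (.assign _ _ _) (.seq e2 (.seq (.assign _ _ _) (.seq (.assign _ _ _)
    (.seq e5 (.seq (.assign _ _ _) (.seq e7 (.assign _ _ _))))))), ?_, fun x hx => ?_, ?_⟩
  · rw [Function.update_self, Expr.eval, r7]
  · rw [Function.update_of_ne (by omega), k7 x hx, hs6, Function.update_of_ne (by omega),
      k5 x (by omega), hs4, Function.update_of_ne (by omega), hs3, Function.update_of_ne (by omega),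
      k2 x (by omega), hs1, Function.update_of_ne (by omega)]
  · have h1 : (l a).length ≤ p.eval (sz a) := (length_lt_sz _).le.trans (hl a).1
    have h2 := Nat.mul_le_mul_right
      (r.eval (sz a + Q.eval (sz a) + p.eval (sz a) + 2) + 30) h1
    simp only [Expr.cost, eval_add, eval_mul, eval_comp, eval_X, eval_ofNat] at *
    omega

/-- Folds over lists whose accumulator grows additively. -/
theorem PolyTime.foldl {l : α → List γ} {i : α → β} {step : α → β → γ → β}
    (hl : PolyTime l) (hi : PolyTime i)
    (hstep : PolyTime (fun p : (α × β) × γ => step p.1.1 p.1.2 p.2)) (r : ℕ[X])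
    (hr : ∀ a b x, sz (step a b x) ≤ sz b + r.eval (sz a + sz x)) :
    PolyTime (fun a => (l a).foldl (step a) (i a)) := by
  have ⟨_, _, p, _, hl'⟩ := hl
  have ⟨_, _, q, _, hi'⟩ := hi
  refine .foldl_of_bound hl hi hstep (q + p * r.comp (X + p)) fun a l' hl1 => ?_
  have key : ∀ m : List γ, (∀ x ∈ m, sz x ≤ p.eval (sz a)) → ∀ b,
      sz (m.foldl (step a) b) ≤ sz b + m.length * r.eval (sz a + p.eval (sz a)) := by
    intro m
    induction m with
    | nil => simp
    | cons x m ih =>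
      intro hm b
      have h1 := ih (fun y hy => hm y (by simp [hy])) (step a b x)
      have h2 := hr a b x
      have h3 := eval_mono r (Nat.add_le_add_left (hm x (by simp)) (sz a))
      simp only [List.foldl_cons, List.length_cons, Nat.add_mul] at *
      omega
  have h1 := key l' (fun x hx => (sz_le_of_mem (hl1.subset hx)).trans (hl' a).1) (i a)
  have h2 : l'.length ≤ p.eval (sz a) :=
    hl1.length_le.trans ((length_lt_sz _).le.trans (hl' a).1)
  have h3 := Nat.mul_le_mul_right (r.eval (sz a + p.eval (sz a))) h2
  have h4 := (hi' a).1
  simp only [eval_add, eval_mul, eval_comp, eval_X]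
  omega
end
end DelayBetter

namespace DelayBetter
open Polynomial
open Enc (enc)
section
variable {α β γ δ : Type} [Enc α] [Enc β] [Enc γ] [Enc δ]

/-! ### Boolean and list operations in polynomial time -/

theorem PolyTime.of_eq {f g : α → β} (hf : PolyTime f) (h : ∀ a, f a = g a) : PolyTime g :=
  (funext h : f = g) ▸ hf

theorem PolyTime.of_enc_eq {f : α → β} (h : ∀ a, enc (f a) = enc a) : PolyTime f :=
  .of_expr (.var 0) X (fun a s hs => by rw [Expr.eval, hs, h]) (fun a => by simp [sz, h])

@[fun_prop]
theorem PolyTime.and {b c : α → Bool} (hb : PolyTime b) (hc : PolyTime c) :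
    PolyTime (fun a => b a && c a) :=
  (hb.ite hc (.const false)).of_eq fun a => by cases b a <;> simp

@[fun_prop]
theorem PolyTime.or {b c : α → Bool} (hb : PolyTime b) (hc : PolyTime c) :
    PolyTime (fun a => b a || c a) :=
  (hb.ite (.const true) hc).of_eq fun a => by cases b a <;> simp

@[fun_prop]
theorem PolyTime.not {b : α → Bool} (hb : PolyTime b) : PolyTime (fun a => !b a) :=
  (hb.ite (.const false) (.const true)).of_eq fun a => by cases b a <;> simp

omit [Enc β] in
theorem foldl_cons_eq (l m : List β) : l.foldl (fun acc x => x :: acc) m = l.reverse ++ m := by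
  induction l generalizing m with
  | nil => rfl
  | cons x l ih => simp [ih]

theorem PolyTime.reverse_append {l m : α → List β} (hl : PolyTime l) (hm : PolyTime m) :
    PolyTime (fun a => (l a).reverse ++ m a) :=
  (PolyTime.foldl (step := fun _ acc x => x :: acc) hl hm (by fun_prop) (X + 1)
    (fun a b x => by simp; omega)).of_eq fun a => foldl_cons_eq _ _

@[fun_prop]
theorem PolyTime.reverse {l : α → List β} (hl : PolyTime l) : PolyTime (fun a => (l a).reverse) :=
  (hl.reverse_append (.const [])).of_eq fun a => by simp

@[fun_prop]
theorem PolyTime.append {l m : α → List β} (hl : PolyTime l) (hm : PolyTime m) :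
    PolyTime (fun a => l a ++ m a) :=
  (hl.reverse.reverse_append hm).of_eq fun a => by simp

@[fun_prop]
theorem PolyTime.flatMap {l : α → List β} {f : α → β → List γ} (hl : PolyTime l)
    (hf : PolyTime (fun p : α × β => f p.1 p.2)) : PolyTime (fun a => (l a).flatMap (f a)) := by
  have ⟨_, _, r, _, hr⟩ := hf
  -- Pushing reversed images onto the front and reversing once at the end lets the accumulator grow
  -- additively.
  have h : PolyTime fun a => ((l a).foldl (fun acc x => (f a x).reverse ++ acc) []).reverse := by
    refine (PolyTime.foldl (step := fun a acc x => (f a x).reverse ++ acc) hl (.const [])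
      ?_ (r.comp (X + 1)) fun a b x => ?_).reverse
    · have : PolyTime fun p : (α × List γ) × β => f p.1.1 p.2 :=
        hf.comp (f := fun p : (α × List γ) × β => (p.1.1, p.2)) (by fun_prop)
      exact this.reverse.append (by fun_prop)
    · have h1 := (hr (a, x)).1
      have h2 := sz_append (f a x).reverse b
      simp only [sz_pair, sz_reverse, eval_comp, eval_add, eval_X, eval_one] at *
      omega
  refine h.of_eq fun a => ?_
  suffices ∀ m : List β, ∀ acc, m.foldl (fun acc x => (f a x).reverse ++ acc) acc =
      (m.flatMap (f a)).reverse ++ acc by simp [this]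
  intro m
  induction m with
  | nil => simp
  | cons x m ih => intro acc; simp [ih]

@[fun_prop]
theorem PolyTime.map {l : α → List β} {f : α → β → γ} (hl : PolyTime l)
    (hf : PolyTime (fun p : α × β => f p.1 p.2)) : PolyTime (fun a => (l a).map (f a)) :=
  (PolyTime.flatMap (f := fun a x => [f a x]) hl (by fun_prop)).of_eq fun a => by
    induction l a with
    | nil => rfl
    | cons x m ih => rw [List.flatMap_cons, ih]; rfl

@[fun_prop]
theorem PolyTime.filter {l : α → List β} {f : α → β → Bool} (hl : PolyTime l)
    (hf : PolyTime (fun p : α × β => f p.1 p.2)) : PolyTime (fun a => (l a).filter (f a)) :=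
  (PolyTime.flatMap (f := fun a x => if f a x then [x] else []) hl (by fun_prop)).of_eq fun a => by
    induction l a with
    | nil => rfl
    | cons x m ih => rw [List.flatMap_cons, ih, List.filter_cons]; split <;> simp

@[fun_prop]
theorem PolyTime.any {l : α → List β} {f : α → β → Bool} (hl : PolyTime l)
    (hf : PolyTime (fun p : α × β => f p.1 p.2)) : PolyTime (fun a => (l a).any (f a)) :=
  (hl.filter hf).isEmpty.not.of_eq fun a => by
    induction l a with
    | nil => rfl
    | cons x m ih => rw [List.filter_cons, List.any_cons, ← ih]; cases f a x <;> simp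

@[fun_prop]
theorem PolyTime.all {l : α → List β} {f : α → β → Bool} (hl : PolyTime l)
    (hf : PolyTime (fun p : α × β => f p.1 p.2)) : PolyTime (fun a => (l a).all (f a)) :=
  (hl.any (f := fun a x => !f a x) hf.not).not.of_eq fun a => by simp [List.all_eq_not_any_not]

@[fun_prop]
theorem PolyTime.zip [Inhabited γ] {l : α → List β} {m : α → List γ} (hl : PolyTime l)
    (hm : PolyTime m) : PolyTime (fun a => (l a).zip (m a)) := by
  have h := ((PolyTime.foldl (l := l) (i := fun a => (m a, ([] : List (β × γ))))
    -- The state is the unread part of the second list and the reversed output; the default values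
    -- are never reached.
    (step := fun _ s x => if s.1.isEmpty then s else (s.1.tail, (x, s.1.headD default) :: s.2))
    hl (by fun_prop) (by fun_prop) (X + 1) fun a s x => by
      rcases s with ⟨_ | ⟨y, m⟩, acc⟩ <;> (simp; try omega))).snd.reverse
  refine h.of_eq fun a => ?_
  suffices ∀ (l : List β) (m : List γ) acc, (l.foldl (fun s x => if s.1.isEmpty then s else
      (s.1.tail, (x, s.1.headD default) :: s.2)) (m, acc)).2 = (l.zip m).reverse ++ acc by rw [this]; simp
  intro l
  induction l with
  | nil => simp
  | cons x l ih => 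
    intro m acc
    cases m with
    | nil => simpa using ih [] acc
    | cons y m => simpa using ih m ((x, y) :: acc)

-- A position is given in unary, as the length of a list; this avoids counters in binary and is how
-- `insertAt` reads a `Choice`.
@[fun_prop]
theorem PolyTime.take_length [Inhabited γ] {l : α → List β} {m : α → List γ} (hl : PolyTime l)
    (hm : PolyTime m) : PolyTime (fun a => (l a).take (m a).length) :=
  ((hl.zip hm).map (f := fun _ p => p.1) (by fun_prop)).of_eq fun a => by
    generalize l a = l; generalize m a = m
    induction l generalizing m with
    | nil => simp
    | cons x l ih => cases m <;> simp [ih]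

@[fun_prop]
theorem PolyTime.drop_length {l : α → List β} {m : α → List γ} (hl : PolyTime l)
    (hm : PolyTime m) : PolyTime (fun a => (l a).drop (m a).length) :=
  (PolyTime.foldl (step := fun _ l _ => l.tail) hm hl (by fun_prop) 0
    (fun a b x => by simpa using sz_sublist (List.tail_sublist b))).of_eq fun a => by
    generalize l a = l; generalize m a = m
    induction m generalizing l with
    | nil => simp
    | cons x m ih => cases l <;> simp [ih]

-- A step copies the head of the accumulator, so its growth is not bounded by the context and the
-- new element, and `PolyTime.foldl` does not apply. Instead, the accumulator is recognised as the
-- list of tails of the reversed processed prefix, whose size is quadratic.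
@[fun_prop]
theorem PolyTime.tails {l : α → List β} (hl : PolyTime l) : PolyTime (fun a => (l a).tails) := by
  have ⟨_, _, p, _, hp⟩ := hl
  have key : ∀ l : List β, l.foldl (fun acc x => (x :: acc.headD []) :: acc) [[]] =
      l.reverse.tails := by
    intro l
    induction l using List.reverseRecOn with
    | nil => rfl
    | append_singleton l x ih => rw [List.foldl_append, ih]; cases h : l.reverse <;> simp [h]
  refine (PolyTime.foldl_of_bound (l := fun a => (l a).reverse) (i := fun _ => [[]])
    (step := fun _ acc x => (x :: acc.headD []) :: acc) (by fun_prop) (by fun_prop) (by fun_prop)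
    ((p + 1) * (p + 1) + 1) fun a l' hl' => ?_).of_eq fun a => by rw [key, List.reverse_reverse]
  rw [key]
  have h1 := (hp a).1
  have h2 : sz l'.reverse ≤ sz (l a) := by
    rw [sz_reverse, ← sz_reverse (l a)]; exact sz_sublist hl'.sublist
  have h3 := length_lt_sz l'.reverse
  refine (sz_le_mul (m := p.eval (sz a)) fun t ht => ?_).trans ?_
  · exact (sz_sublist ((List.mem_tails _ _).1 ht).sublist).trans (h2.trans h1)
  · rw [List.length_tails]; simp
    exact Nat.le_of_lt_succ (by simp at h3; omega)

/-! ### Equality tests -/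

/-- Equality as a Boolean. -/
def eqb [DecidableEq α] (a b : α) : Bool := decide (a = b)

omit [Enc α] in
@[simp] theorem eqb_iff [DecidableEq α] (a b : α) : eqb a b = true ↔ a = b := by simp [eqb]

/-- Types with a polynomial time equality test. -/
class PolyEq (α : Type) [Enc α] [DecidableEq α] : Prop where
  polyTime : PolyTime (fun p : α × α => eqb p.1 p.2)

@[fun_prop]
theorem PolyTime.eqb [DecidableEq β] [PolyEq β] {f g : α → β} (hf : PolyTime f) (hg : PolyTime g) :
    PolyTime (fun a => eqb (f a) (g a)) :=
  PolyEq.polyTime.comp (hf.mk hg)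

instance : PolyEq Bool where
  polyTime := (show PolyTime fun p : Bool × Bool => if p.1 then p.2 else !p.2 by fun_prop).of_eq fun p => by
    obtain ⟨a, b⟩ := p; cases a <;> cases b <;> rfl

instance [DecidableEq α] [DecidableEq β] [PolyEq α] [PolyEq β] : PolyEq (α × β) where
  polyTime := (show PolyTime fun p : (α × β) × (α × β) =>
    DelayBetter.eqb p.1.1 p.2.1 && DelayBetter.eqb p.1.2 p.2.2 by fun_prop).of_eq fun p => by
      rw [Bool.eq_iff_iff]; simp [Prod.ext_iff]

instance [DecidableEq α] [PolyEq α] : PolyEq (List α) where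
  polyTime := by
    -- The state is the unread part of the second list and a flag. At the end that part must be
    -- empty and the flag true.
    have h := PolyTime.foldl (l := fun p : List α × List α => p.1) (i := fun p => (p.2, true))
      (step := fun _ s x => (s.1.tail, s.2 && (!s.1.isEmpty && DelayBetter.eqb x (s.1.headD x))))
      (by fun_prop) (by fun_prop) (by fun_prop) 3 (fun a s x => by
        have h1 := sz_sublist (List.tail_sublist s.1)
        have h2 : ∀ b : Bool, sz b ≤ 3 := by intro b; cases b <;> simp [sz, Enc.enc, Data.size]
        have h3 := h2 (s.2 && (!s.1.isEmpty && DelayBetter.eqb x (s.1.headD x)))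
        obtain ⟨s1, s2⟩ := s
        simp at *; omega)
    refine (show PolyTime _ from (h.fst.isEmpty).and h.snd).of_eq fun p => ?_
    obtain ⟨l, m⟩ := p
    suffices ∀ (l m : List α) (b : Bool),
        let r := l.foldl (fun s x => (s.1.tail, s.2 && (!s.1.isEmpty &&
          DelayBetter.eqb x (s.1.headD x)))) (m, b)
        (r.1.isEmpty && r.2) = (b && DelayBetter.eqb l m) by simpa using this l m true
    intro l
    induction l with
    | nil => intro m b; cases m <;> simp [DelayBetter.eqb]
    | cons x l ih =>
      intro m b
      cases m with
      | nil => have := ih [] false; simp_all [DelayBetter.eqb]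
      | cons y m =>
        have := ih m (b && DelayBetter.eqb x y)
        simp only [List.foldl_cons] at *
        simp only [List.isEmpty_cons, Bool.not_false, Bool.true_and, List.headD_cons, List.tail_cons]
        rw [this]; simp [DelayBetter.eqb, Bool.and_assoc]

/-! ### Binary arithmetic -/

/-- The number with the given binary digits, least significant digit first. -/
def bitsVal : List Bool → ℕ
  | [] => 0
  | b :: l => 2 * bitsVal l + b.toNat

theorem bitsVal_bits (n : ℕ) : bitsVal n.bits = n := by
  induction n using Nat.binaryRec' with
  | zero => rfl
  | bit b n h ih => rw [Nat.bits_append_bit _ _ h, bitsVal, ih]; cases b <;> simp [Nat.bit]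

/-- Programs see only encodings, so values of different types with equal encodings, such as a number
and its list of bits, are interchangeable. -/
theorem PolyTime.of_enc {f : α → β} {g : α → γ} (hf : PolyTime f) (h : ∀ a, enc (g a) = enc (f a)) :
    PolyTime g := by
  obtain ⟨c, K, p, hK, hf⟩ := hf
  exact ⟨c, K, p, hK, fun a => by simpa only [sz, h] using hf a⟩

theorem PolyTime.bits_aux : PolyTime Nat.bits :=
  .of_enc_eq fun _ => rfl

@[fun_prop]
theorem PolyTime.bits {f : α → ℕ} (hf : PolyTime f) : PolyTime (fun a => (f a).bits) :=
  .comp .bits_aux hf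

instance : PolyEq ℕ where
  polyTime := (show PolyTime fun p : ℕ × ℕ => DelayBetter.eqb p.1.bits p.2.bits by fun_prop).of_eq
    fun p => by
      rw [Bool.eq_iff_iff, eqb_iff, eqb_iff]
      exact ⟨fun h => by rw [← bitsVal_bits p.1, h, bitsVal_bits], fun h => by rw [h]⟩

theorem sz_bool (b : Bool) : sz b ≤ 3 := by
  cases b <;> simp [sz, Enc.enc, Data.size]

/-- Binary increment. -/
def succBits : List Bool → List Bool
  | [] => [true]
  | false :: l => true :: l
  | true :: l => false :: succBits l

theorem bits_succ (n : ℕ) : (n + 1).bits = succBits n.bits := by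
  induction n using Nat.binaryRec' with
  | zero => simp [succBits]
  | bit b n h ih =>
    rw [Nat.bits_append_bit _ _ h]
    cases b
    · simp [Nat.bit, succBits]
    · have := Nat.bit0_bits (n + 1) (by omega)
      simpa [Nat.bit, succBits, ← ih, Nat.mul_add] using this

theorem PolyTime.succBits : PolyTime succBits := by
  -- The state is the carry and the reversed output; a carry left at the end becomes a new leading
  -- digit.
  have h := PolyTime.foldl (l := fun l : List Bool => l) (i := fun _ => (true, ([] : List Bool)))
    (step := fun _ s x => (s.1 && x, (if s.1 then !x else x) :: s.2))
    (by fun_prop) (by fun_prop) (by fun_prop) 10 (fun a s x => by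
      obtain ⟨c, o⟩ := s
      have h1 := sz_bool (c && x)
      have h2 := sz_bool (if c then !x else x)
      simp at *; omega)
  refine (show PolyTime _ from h.snd.reverse.append
    (h.fst.ite (.const [true]) (.const []))).of_eq fun l => ?_
  suffices ∀ (l : List Bool) (c : Bool) (o : List Bool),
      let r := l.foldl (fun s x => (s.1 && x, (if s.1 then !x else x) :: s.2)) (c, o)
      r.2.reverse ++ (if r.1 then [true] else []) =
        o.reverse ++ if c then DelayBetter.succBits l else l by
    simpa using this l true []
  intro l
  induction l with
  | nil => intro c o; cases c <;> simp [DelayBetter.succBits]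
  | cons x l ih =>
    intro c o
    have := ih (c && x) ((if c then !x else x) :: o)
    refine Eq.trans this ?_
    cases c <;> cases x <;> simp [DelayBetter.succBits]

@[fun_prop]
theorem PolyTime.succ {f : α → ℕ} (hf : PolyTime f) : PolyTime (fun a => (f a).succ) :=
  (PolyTime.succBits.comp hf.bits).of_enc fun a => by rw [← bits_succ]; rfl

/-- The worst case is a new leading digit, of size 3 together with its list node. The bound has to
be additive because relaxation iterates the successor. -/
theorem sz_succ_le (n : ℕ) : sz n.succ ≤ sz n + 4 := by
  have h : ∀ n : ℕ, sz n = sz n.bits := fun _ => rfl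
  have key : ∀ l : List Bool, sz (succBits l) ≤ sz l + 4 := by
    intro l
    induction l with
    | nil => simp [succBits, sz, Enc.enc, encList, Data.size]
    | cons b l ih =>
      cases b <;> simp [succBits] <;>
      simp [sz, Enc.enc, Data.size] at * <;> omega
  rw [h, h, Nat.succ_eq_add_one, bits_succ]
  exact key _

/-- Comparison of numbers as a Boolean. -/
def leb (a b : ℕ) : Bool := decide (a ≤ b)

@[simp] theorem leb_iff (a b : ℕ) : leb a b = true ↔ a ≤ b := by simp [leb]

@[fun_prop]
theorem PolyTime.leb {f g : α → ℕ} (hf : PolyTime f) (hg : PolyTime g) :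
    PolyTime (fun a => leb (f a) (g a)) := by
  -- Digits are read from the least significant one. The flag records whether the part read of the
  -- first number is at most that of the second, and a differing digit overrides it. A digit 1 left
  -- over in the second number decides at the end.
  have h := PolyTime.foldl (l := fun p : List Bool × List Bool => p.1) (i := fun p => (p.2, true))
    (step := fun _ s x => (s.1.tail, if DelayBetter.eqb x (s.1.headD false) then s.2 else !x))
    (by fun_prop) (by fun_prop) (by fun_prop) 3 (fun a s x => by
      have h1 := sz_sublist (List.tail_sublist s.1)
      have h3 := sz_bool (if DelayBetter.eqb x (s.1.headD false) then s.2 else !x)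
      obtain ⟨s1, s2⟩ := s
      simp at *; omega)
  have h' := (h.fst.any (f := fun _ x => x) (by fun_prop)).or h.snd
  refine (h'.comp (hf.bits.mk hg.bits)).of_eq fun a => ?_
  suffices ∀ (l m : List Bool) (b : Bool),
      let r := l.foldl (fun s x => (s.1.tail, if DelayBetter.eqb x (s.1.headD false) then s.2
        else !x)) (m, b)
      ((r.1.any (fun x => x) || r.2) = true ↔
        bitsVal l < bitsVal m ∨ bitsVal l = bitsVal m ∧ b = true) by
    rw [Bool.eq_iff_iff, leb_iff]
    refine (this (f a).bits (g a).bits true).trans ?_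
    rw [bitsVal_bits, bitsVal_bits]; simp; omega
  intro l
  induction l with
  | nil =>
    intro m b
    have : m.any (fun x => x) = true ↔ 0 < bitsVal m := by
      induction m with
      | nil => simp [bitsVal]
      | cons x m ih => cases x <;> simp_all [bitsVal]
    cases b <;> simp_all [bitsVal]
    omega
  | cons x l ih =>
    intro m b
    refine (ih _ _).trans ?_
    rcases m with _ | ⟨y, m⟩
    · cases x <;> cases b <;> simp [bitsVal, DelayBetter.eqb]
    · cases x <;> cases y <;> cases b <;> simp [bitsVal, DelayBetter.eqb] <;> omega
end
end DelayBetter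

namespace DelayBetter
open Polynomial
open Enc (enc)

/-! ### Exhaustive search -/

section
variable {α δ ι : Type} [Enc α] [Enc δ] [Enc ι]

/-- Running a loop whose body computes `step` on a state that is kept in variable `M`. -/
theorem exec_while {step : List α × δ → List α × δ} {c : Cmd} {M Q B : ℕ}
    (hc : ∀ x s, sz x ≤ Q → s 0 = enc x → ∃ (s' : Store) (t : ℕ), Exec c s s' t ∧
      s' 0 = enc (step x) ∧ (∀ x, M ≤ x → s' x = s x) ∧ t ≤ B)
    (hfix : ∀ x, x.1 = [] → step x = x) (N : ℕ) (x : List α × δ) (s : Store)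
    (hs : s M = enc x) (hQ : ∀ i ≤ N, sz (step^[i] x) ≤ Q) (hN : (step^[N] x).1 = []) :
    ∃ (s' : Store) (t : ℕ), Exec (.loop (.hd (.var M)) (.seq (.assign 0 (.var M))
      (.seq c (.assign M (.var 0))))) s s' t ∧ s' M = enc (step^[N] x) ∧ t ≤ N * (B + 10) + 3 := by
  induction N generalizing x s with
  | zero =>
    obtain ⟨l, y⟩ := x
    simp only [Function.iterate_zero, id_eq] at hN
    subst hN
    exact ⟨s, _, .loopFalse (by simp [Expr.eval, hs, enc_pair, enc_nil, Data.hd]), hs,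
      by simp [Expr.cost]⟩
  | succ N ih =>
    by_cases hx : x.1 = []
    · have hit : step^[N + 1] x = x := Function.iterate_fixed (hfix x hx) _
      obtain ⟨l, y⟩ := x
      simp only at hx
      subst hx
      exact ⟨s, _, .loopFalse (by simp [Expr.eval, hs, enc_pair, enc_nil, Data.hd]),
        by rw [hit, hs], by simp [Expr.cost]⟩
    · obtain ⟨s2, t2, e2, r2, k2, b2⟩ := hc x (Function.update s 0 ((Expr.var M).eval s))
        (hQ 0 (by omega)) (by simp [Expr.eval, hs])
      obtain ⟨s3, t3, e3, r3, b3⟩ := ih (step x) (Function.update s2 M ((Expr.var 0).eval s2))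
        (by simp [Expr.eval, r2]) (fun i hi => hQ (i + 1) (by omega)) hN
      refine ⟨s3, _, .loopTrue ?_ (.seq (.assign _ _ _) (.seq e2 (.assign _ _ _))) e3, r3, ?_⟩
      · obtain ⟨_ | ⟨z, l⟩, y⟩ := x
        · simp at hx
        · simp [Expr.eval, hs, enc_pair, enc_cons, Data.hd]
      · simp only [Expr.cost, Nat.add_mul]; omega

/-- One step of a depth first search through all choices of one element from each list: the stack
holds partial choices (latest first) together with the lists that are still to be chosen from. -/
def searchStep [Inhabited α] (check : δ → List α → Bool)
    (x : List (List α × List (List α)) × (Bool × δ)) :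
    List (List α × List (List α)) × (Bool × δ) :=
  if x.1.isEmpty then x else
    if (x.1.headD ([], [])).2.isEmpty then
      if check x.2.2 (x.1.headD ([], [])).1 then ([], (true, x.2.2)) else (x.1.tail, x.2)
    else if ((x.1.headD ([], [])).2.headD []).isEmpty then (x.1.tail, x.2)
    else (((((x.1.headD ([], [])).2.headD []).headD default :: (x.1.headD ([], [])).1,
        (x.1.headD ([], [])).2.tail)) :: ((x.1.headD ([], [])).1,
          ((x.1.headD ([], [])).2.headD []).tail :: (x.1.headD ([], [])).2.tail) :: x.1.tail, x.2)

theorem PolyTime.searchStep [Inhabited α] {check : δ → List α → Bool}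
    (hc : PolyTime fun p : δ × List α => check p.1 p.2) : PolyTime (searchStep check) := by
  have : PolyTime fun x : List (List α × List (List α)) × (Bool × δ) =>
      check x.2.2 (x.1.headD ([], [])).1 :=
    hc.comp (f := fun x : List (List α × List (List α)) × (Bool × δ) =>
      (x.2.2, (x.1.headD ([], [])).1)) (by fun_prop)
  unfold DelayBetter.searchStep
  fun_prop

variable [Inhabited α] (check : δ → List α → Bool)

omit [Enc α] [Enc δ] in
theorem searchStep_leaf (g : List α) (S : List (List α × List (List α))) (y : Bool × δ) :
    searchStep check ((g, []) :: S, y) = if check y.2 g then ([], (true, y.2)) else (S, y) := rfl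

omit [Enc α] [Enc δ] in
theorem searchStep_pop (g : List α) (cs : List (List α)) (S : List (List α × List (List α)))
    (y : Bool × δ) : searchStep check ((g, [] :: cs) :: S, y) = (S, y) := rfl

omit [Enc α] [Enc δ] in
theorem searchStep_push (g : List α) (a : α) (c : List α) (cs : List (List α))
    (S : List (List α × List (List α))) (y : Bool × δ) :
    searchStep check ((g, (a :: c) :: cs) :: S, y) = ((a :: g, cs) :: (g, c :: cs) :: S, y) := rfl

/-- Number of steps of the search. -/
def searchLength {α : Type} : List (List α) → ℕ
  | [] => 1
  | c :: cs => c.length * (searchLength cs + 1) + 1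

/-- Nonempty lists keep every factor positive, so the extra steps on each level are absorbed by the
product; an empty list would make the right-hand side vanish. -/
theorem searchLength_le {α : Type} (cs : List (List α)) (h : ∀ c ∈ cs, c ≠ []) :
    searchLength cs ≤ (2 * cs.length + 1) * (cs.map List.length).prod ∧
      0 < (cs.map List.length).prod := by
  induction cs with
  | nil => simp [searchLength]
  | cons c cs ih =>
    obtain ⟨h1, h2⟩ := ih fun d hd => h d (by simp [hd])
    have h3 : 0 < c.length := List.length_pos_iff.2 (h c (by simp))
    have h4 : 0 < c.length * (cs.map List.length).prod := Nat.mul_pos h3 h2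
    refine ⟨?_, by simpa using h4⟩
    simp only [searchLength, List.length_cons, List.map_cons, List.prod_cons]
    have h5 := Nat.mul_le_mul_left c.length h1
    have h6 := Nat.mul_le_mul_left c.length h2
    nlinarith

omit [Enc α] [Enc δ] in
theorem searchStep_iterate (x : δ) (r : Bool) (cs : List (List α)) :
    ∀ (g : List α) (S : List (List α × List (List α))), ∃ k ≤ searchLength cs,
      ((∃ h, List.Forall₂ (· ∈ ·) h cs ∧ check x (h.reverse ++ g) = true) ∧
        (searchStep check)^[k] ((g, cs) :: S, (r, x)) = ([], (true, x))) ∨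
      ((¬ ∃ h, List.Forall₂ (· ∈ ·) h cs ∧ check x (h.reverse ++ g) = true) ∧
        (searchStep check)^[k] ((g, cs) :: S, (r, x)) = (S, (r, x))) := by
  induction cs with
  | nil =>
    intro g S
    refine ⟨1, le_rfl, ?_⟩
    simp only [Function.iterate_one, searchStep_leaf, List.forall₂_nil_right_iff, exists_eq_left,
      List.reverse_nil, List.nil_append]
    cases check x g <;> simp
  | cons c cs ih =>
    induction c with
    | nil =>
      intro g S
      refine ⟨1, by simp [searchLength], .inr ⟨?_, by simp [searchStep_pop]⟩⟩
      rintro ⟨h, hh, -⟩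
      cases hh
      simp_all
    | cons a c ihc =>
      intro g S
      obtain ⟨k, hk, h⟩ := ih (a :: g) ((g, c :: cs) :: S)
      rcases h with ⟨⟨h, h1, h2⟩, h3⟩ | ⟨h1, h3⟩
      · refine ⟨k + 1, ?_, .inl ⟨⟨a :: h, .cons (by simp) h1, by simpa using h2⟩, ?_⟩⟩
        · simp only [searchLength, List.length_cons, Nat.add_mul]; omega
        · rw [Function.iterate_succ_apply, searchStep_push, h3]
      · obtain ⟨k', hk', h'⟩ := ihc g S
        refine ⟨k' + (k + 1), ?_, ?_⟩
        · simp only [searchLength, List.length_cons, Nat.add_mul] at *; omega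
        have h4 : (searchStep check)^[k' + (k + 1)] ((g, (a :: c) :: cs) :: S, (r, x)) =
            (searchStep check)^[k'] ((g, c :: cs) :: S, (r, x)) := by
          rw [Function.iterate_add_apply, Function.iterate_succ_apply, searchStep_push, h3]
        rw [h4]
        have h5 : (∃ h, List.Forall₂ (· ∈ ·) h ((a :: c) :: cs) ∧ check x (h.reverse ++ g) = true) ↔
            ∃ h, List.Forall₂ (· ∈ ·) h (c :: cs) ∧ check x (h.reverse ++ g) = true := by
          constructor
          · rintro ⟨h, hh, hc⟩
            rcases hh with _ | ⟨hb, hh⟩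
            rename_i b h
            rcases List.mem_cons.1 hb with rfl | hb
            · exact absurd ⟨h, hh, by simpa using hc⟩ h1
            · exact ⟨b :: h, .cons hb hh, hc⟩
          · rintro ⟨h, hh, hc⟩
            rcases hh with _ | ⟨hb, hh⟩
            exact ⟨_, .cons (List.mem_cons_of_mem _ hb) hh, hc⟩
        rw [h5]
        exact h'

/-- What bounds the size of the states of the search. -/
structure SearchInv (L B : ℕ) (x : δ) (y : List (List α × List (List α)) × (Bool × δ)) : Prop where
  length_le : ∀ i ∈ y.1, i.1.length + i.2.length ≤ L
  sz_left : ∀ i ∈ y.1, ∀ a ∈ i.1, sz a ≤ B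
  sz_right : ∀ i ∈ y.1, ∀ c ∈ i.2, sz c ≤ B
  lt : (y.1.map fun i => i.2.length).Pairwise (· < ·)
  ctx : y.2.2 = x

omit [Enc δ] in
theorem SearchInv.step {L B : ℕ} {x : δ} {y : List (List α × List (List α)) × (Bool × δ)}
    (h : SearchInv L B x y) : SearchInv L B x (searchStep check y) := by
  obtain ⟨S, y⟩ := y
  obtain ⟨h1, h2, h3, h4, h5⟩ := h
  have hS : ∀ i S', S = i :: S' → SearchInv L B x (S', y) := by
    rintro i S' rfl
    simp only [List.map_cons, List.pairwise_cons, List.forall_mem_cons] at *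
    exact ⟨h1.2, h2.2, h3.2, h4.2, h5⟩
  rcases S with _ | ⟨⟨g, _ | ⟨_ | ⟨a, c⟩, cs⟩⟩, S⟩
  · exact ⟨h1, h2, h3, h4, h5⟩
  · rw [searchStep_leaf]
    split
    · exact ⟨by simp, by simp, by simp, by simp, h5⟩
    · exact hS _ _ rfl
  · rw [searchStep_pop]; exact hS _ _ rfl
  · rw [searchStep_push]
    simp only [List.map_cons, List.pairwise_cons, List.forall_mem_cons, List.length_cons,
      List.forall_mem_map, sz_cons] at *
    refine ⟨?_, ?_, ?_, ?_, h5⟩ <;>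
      simp only [List.map_cons, List.pairwise_cons, List.forall_mem_cons, List.length_cons,
        List.forall_mem_map]
    · exact ⟨by omega, by omega, h1.2⟩
    · exact ⟨⟨by have := h3.1.1; omega, h2.1⟩, h2.1, h2.2⟩
    · exact ⟨h3.1.2, ⟨by have := h3.1.1; omega, h3.1.2⟩, h3.2⟩
    · exact ⟨⟨by omega, fun i hi => by have := h4.1 i hi; omega⟩, h4.1, h4.2⟩

-- The numbers of lists still to be chosen from strictly increase down the stack and are at most
-- `L`, so the stack has at most `L + 1` items. Each item consists of two lists of at most `L`
-- entries of size at most `B`.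
omit [Inhabited α] in
theorem SearchInv.sz_le {L B : ℕ} {x : δ} {y : List (List α × List (List α)) × (Bool × δ)}
    (h : SearchInv L B x y) :
    sz y ≤ (L + 1) * (2 * (L * (B + 1)) + 4) + sz x + 6 := by
  have h1 : y.1.length ≤ L + 1 := by
    have h2 : (y.1.map fun i => i.2.length) ⊆ List.range (L + 1) := fun n hn => by
      obtain ⟨i, hi, rfl⟩ := List.mem_map.1 hn
      have := h.length_le i hi
      simp; omega
    have h3 : (y.1.map fun i => i.2.length).Nodup := h.lt.imp fun hab => Nat.ne_of_lt hab
    simpa using (List.subperm_of_subset h3 h2).length_le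
  have h2 : sz y.1 ≤ y.1.length * (2 * (L * (B + 1)) + 4) + 1 := sz_le_mul (m := 2 * (L * (B + 1)) + 3) fun i hi => by
    have h3 := sz_le_mul (h.sz_left i hi)
    have h4 := sz_le_mul (h.sz_right i hi)
    have h5 := h.length_le i hi
    have h6 : i.1.length * (B + 1) ≤ L * (B + 1) := Nat.mul_le_mul_right _ (by omega)
    have h7 : i.2.length * (B + 1) ≤ L * (B + 1) := Nat.mul_le_mul_right _ (by omega)
    obtain ⟨i1, i2⟩ := i
    simp only [sz_pair] at *; omega
  have h3 := Nat.mul_le_mul_right (2 * (L * (B + 1)) + 4) h1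
  have h4 := sz_bool y.2.1
  have h5 := h.ctx
  obtain ⟨S, b, z⟩ := y
  simp only [sz_pair, Nat.add_assoc] at *
  subst h5
  omega

/-- Searching through all choices of one element from each of the lists `options i` takes time
polynomial in `i`, times the number of choices. -/
theorem exists_search {options : ι → List (List α)} {ctx : ι → δ} (ho : PolyTime options)
    (hx : PolyTime ctx) (hc : PolyTime fun p : δ × List α => check p.1 p.2) :
    ∃ (c : Cmd) (p : ℕ[X]), ∀ i : ι, (∀ o ∈ options i, o ≠ []) →
      ∃ (s : Store) (t : ℕ), Exec c (inputStore (enc i)) s t ∧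
        t ≤ ((options i).map List.length).prod * p.eval (sz i) ∧
        (s 0 ≠ Data.nil ↔
          ∃ g, List.Forall₂ (· ∈ ·) g (options i) ∧ check (ctx i) g.reverse = true) := by
  have hi : PolyTime fun i => ([(([] : List α), options i)], (false, ctx i)) := by fun_prop
  obtain ⟨c, K, p, hK, hi⟩ := hi
  obtain ⟨d, L, q, hL, hs⟩ := PolyTime.searchStep hc
  set M := max K L
  -- The bound of `SearchInv.sz_le` with `L` and `B` both equal to the bound `p` on the initial
  -- state.
  let Q : ℕ[X] := (p + 1) * (2 * (p * (p + 1)) + 4) + p + 6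
  refine ⟨.seq c (.seq (.assign M (.var 0)) (.seq (.loop (.hd (.var M)) (.seq (.assign 0 (.var M))
      (.seq d (.assign M (.var 0))))) (.assign 0 (.hd (.tl (.var M)))))),
    p + (2 * p + 1) * (q.comp Q + 10) + 30, fun i hne => ?_⟩
  obtain ⟨s1, t1, e1, r1, k1, b1⟩ := (hi i).2 (inputStore (enc i)) rfl
  have hp := (hi i).1
  set x0 := ([(([] : List α), options i)], (false, ctx i)) with hx0
  set N := searchLength (options i)
  simp only [sz_pair, sz_cons, sz_nil] at hp
  have hinv : ∀ k, SearchInv (p.eval (sz i)) (p.eval (sz i)) (ctx i)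
      ((searchStep check)^[k] x0) := by
    intro k
    induction k with
    | zero =>
      have h1 := length_lt_sz (options i)
      refine ⟨?_, ?_, ?_, ?_, rfl⟩ <;> simp [hx0]
      · omega
      · intro c hc; have := sz_le_of_mem hc; omega
    | succ k ih => rw [Function.iterate_succ_apply']; exact ih.step check
  have hfix : ∀ x, x.1 = [] → searchStep check x = x := by
    rintro ⟨l, y⟩ h; simp only at h; subst h; rfl
  obtain ⟨k, hk, hres⟩ := searchStep_iterate check (ctx i) false (options i) [] []
  have hN : (searchStep check)^[N] x0 = (searchStep check)^[k] x0 ∧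
      ((searchStep check)^[k] x0).1 = [] := by
    have h1 : ((searchStep check)^[k] x0).1 = [] := by
      rcases hres with ⟨-, h⟩ | ⟨-, h⟩ <;> rw [h]
    refine ⟨?_, h1⟩
    rw [show N = N - k + k from (Nat.sub_add_cancel hk).symm, Function.iterate_add_apply]
    exact Function.iterate_fixed (hfix _ h1) _
  obtain ⟨s3, t3, e3, r3, b3⟩ := exec_while (c := d) (M := M) (Q := Q.eval (sz i))
    (B := (q.comp Q).eval (sz i))
    (fun x s hx h0 => by
      obtain ⟨s', t, e, r, k, b⟩ := (hs x).2 s h0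
      exact ⟨s', t, e, r, fun x hx => k x (by omega), by
        rw [eval_comp]; exact b.trans (eval_mono q hx)⟩)
    hfix N x0 (Function.update s1 M ((Expr.var 0).eval s1)) (by simp [Expr.eval, r1, hx0])
    (fun k _ => by
      refine (hinv k).sz_le.trans ?_
      simp only [Q, eval_add, eval_mul, eval_ofNat, eval_one]
      omega) (by rw [hN.1]; exact hN.2)
  refine ⟨_, _, .seq e1 (.seq (.assign _ _ _) (.seq e3 (.assign _ _ _))), ?_, ?_⟩
  · obtain ⟨h1, h2⟩ := searchLength_le (options i) hne
    have h3 := length_lt_sz (options i)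
    set P := ((options i).map List.length).prod
    set B := (q.comp Q).eval (sz i)
    have h4 : N ≤ P * (2 * p.eval (sz i) + 1) := by
      rw [Nat.mul_comm]; exact h1.trans (Nat.mul_le_mul_right _ (by omega))
    have h5 := Nat.mul_le_mul_right (B + 10) h4
    -- The number of choices is positive, so the set-up cost may be multiplied by it too.
    have h6 := Nat.mul_le_mul_right (p.eval (sz i) + 30) h2
    simp only [Expr.cost, eval_add, eval_mul, eval_ofNat, eval_one]
    calc _ ≤ p.eval (sz i) + 30 + N * (B + 10) := by omega
      _ ≤ P * (p.eval (sz i) + 30) + P * (2 * p.eval (sz i) + 1) * (B + 10) := by omega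
      _ = _ := by ring
  · simp only [Function.update_self, Expr.eval, r3, hN.1]
    simp only [List.append_nil] at hres
    rcases hres with ⟨h1, h2⟩ | ⟨h1, h2⟩ <;> rw [hx0, h2] <;>
      simp [h1, enc, Data.hd, Data.tl]
end
end DelayBetter

namespace DelayBetter
open Polynomial
open Enc (enc)

/-! ### The algorithm

Edges are triples (endpoint, endpoint, time label). A move is a way to traverse an edge: a triple
(vertex it leaves, vertex it enters, edge). -/

abbrev Edge : Type := ℕ × ℕ × ℕ

abbrev Demand : Type := ℕ × ℕ × ℕ

abbrev Move : Type := ℕ × ℕ × Edge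

/-- The possible moves; in the undirected case, edges can be traversed in both directions. -/
def moves (und : Bool) (E : List Edge) : List Move :=
  E.flatMap fun e => (e.1, e.2.1, e) :: if und then [(e.2.1, e.1, e)] else []

/-- The (reversed) walk that a table stores for a vertex. -/
def lookupWalk (tab : List (ℕ × List Move)) (v : ℕ) : List Move :=
  ((tab.filter fun p => eqb p.1 v).map fun p => p.2).headD []

/-- Extend a table of reversed walks by a move to a new vertex. -/
def searchMove (tab : List (ℕ × List Move)) (m : Move) : List (ℕ × List Move) :=
  if tab.any (fun p => eqb p.1 m.2.1) || !tab.any (fun p => eqb p.1 m.1) then tab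
  else (m.2.1, m :: lookupWalk tab m.1) :: tab

/-- Reversed walks from `x` to all vertices that can be reached from it. -/
def walkTable (M : List Move) (x : ℕ) : List (ℕ × List Move) :=
  (M.flatMap fun _ => M).foldl searchMove [(x, [])]

/-- A walk from `x` to `y`; the empty list if there is none. -/
def findPath (M : List Move) (x y : ℕ) : List Move :=
  (lookupWalk (walkTable M x) y).reverse

/-- Whether `E` contains an arc from the end of `e` to its start. -/
def hasReverse (E : List Edge) (e : Edge) : Bool :=
  E.any fun f => eqb f.1 e.2.1 && eqb f.2.1 e.1

/-- One step of the construction of a maximal forest. -/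
def addEdge (T : List Edge) (e : Edge) : List Edge :=
  if hasReverse T e || (findPath (moves true T) e.1 e.2.1).isEmpty then e :: T else T

/-- A spanning forest that contains as many pairs of antiparallel arcs as possible. -/
def forest (E : List Edge) : List Edge :=
  (E.filter (fun e => hasReverse E e) ++ E.filter fun e => !hasReverse E e).foldl addEdge []

/-- The edges outside of the forest. -/
def feedback (E : List Edge) : List Edge :=
  E.filter fun e => !(forest E).any fun f => eqb e f

/-- A choice made in the search: a list whose length is a position in an ordering, and a list of at
most one move that is used for a demand. -/
abbrev Choice : Type := List Edge × List (Demand × Move)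

/-- The possible positions for the successive insertion of the elements of `F` into an ordering. -/
def positionOptions (F : List Edge) : List (List Choice) :=
  F.tails.flatMap fun s => if s.isEmpty then [] else [s.tail.tails.map fun t => (t, [])]

/-- For each demand and each element of `F`, the ways to use this edge on the path that meets the
demand, or not. -/
def moveOptions (und : Bool) (F : List Edge) (D : List Demand) : List (List Choice) :=
  D.flatMap fun d => F.map fun f =>
    ([], []) :: (moves und [f]).map fun m => ([], [(d, m)])

/-- All choices. -/
def options (und : Bool) (F : List Edge) (D : List Demand) : List (List Choice) :=
  positionOptions F ++ moveOptions und F D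

/-- Insert an element at the position given by the length of a list. -/
def insertAt (l : List Edge) (p : Edge × Choice) : List Edge :=
  l.take p.2.1.length ++ p.1 :: l.drop p.2.1.length

/-- The ordering of `F` that is described by the choices. -/
def ordering (F : List Edge) (g : List Choice) : List Edge :=
  (F.zip g).reverse.foldl insertAt []

/-- The chosen moves for the demand `d` in the order `π`. -/
def chosenMoves (π : List Edge) (g : List Choice) (d : Demand) : List Move :=
  π.flatMap fun f => ((g.flatMap fun c => c.2).filter fun c => eqb c.1 d && eqb c.2.2.2 f).map
    fun c => c.2

/-- The walk from `u` to `v` through the moves `ms`, connected by walks along the moves `M`. -/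
def connect (M : List Move) (u : ℕ) (ms : List Move) (v : ℕ) : List Move :=
  ((u :: ms.map fun m => m.2.1).zip ((ms.map fun m => (m.1, [m])) ++ [(v, [])])).flatMap fun p =>
    findPath M p.1 p.2.1 ++ p.2.2

/-- The walks for all demands that are described by the choices. -/
def demandWalks (und : Bool) (T F : List Edge) (D : List Demand) (g : List Choice) :
    List (Demand × List Move) :=
  D.map fun d => (d, connect (moves und T) d.1 (chosenMoves (ordering F g) g d) d.2.1)

/-- Pairs of consecutive edges. -/
def consecutive (W : List Move) : List (Edge × Edge) :=
  (W.map fun m => m.2.2).zip (W.map fun m => m.2.2).tail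

/-- The maximum of a list and a number. -/
def maxWith (x : ℕ) (l : List ℕ) : ℕ :=
  l.foldl (fun a b => if leb a b then b else a) x

/-- Simultaneously delay the edges to later than the first edges of pairs in which they are
second. -/
def relax (C : List (Edge × Edge)) (tab : List (Edge × ℕ)) : List (Edge × ℕ) :=
  tab.map fun p => (p.1, maxWith p.2 (C.flatMap fun c => if eqb c.2 p.1 then
    (tab.filter fun q => eqb q.1 c.1).map fun q => q.2.succ else []))

/-- The result of relaxing as often as there are edges. -/
def relaxedTimes (E : List Edge) (C : List (Edge × Edge)) : List (Edge × ℕ) :=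
  E.foldl (fun tab _ => relax C tab) (E.map fun e => (e, e.2.2))

/-- The walks meet the demands, and are temporal walks for the given times. -/
def validWalks (M : List Move) (C : List (Edge × Edge)) (ws : List (Demand × List Move))
    (tab : List (Edge × ℕ)) : Bool :=
  (ws.all fun w => eqb (w.1.1 :: w.2.map fun m => m.2.1) ((w.2.map fun m => m.1) ++ [w.1.2.1]) &&
    w.2.all fun m => M.any (fun m' => eqb m m') &&
      tab.all fun p => !eqb p.1 m.2.2 || leb p.2 w.1.2.2) &&
  C.all fun c => tab.all fun p => tab.all fun q =>
    !(eqb p.1 c.1 && eqb q.1 c.2) || leb p.2.succ q.2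

/-- Whether the choices `g` lead to a solution. -/
def verify (und : Bool) (E T F : List Edge) (D : List Demand) (g : List Choice) : Bool :=
  validWalks (moves und E) ((demandWalks und T F D g).flatMap fun w => consecutive w.2)
    (demandWalks und T F D g)
    (relaxedTimes E ((demandWalks und T F D g).flatMap fun w => consecutive w.2))

/-! ### Polynomial running time of the parts of the algorithm -/

section
variable {α : Type} [Enc α]

@[fun_prop]
theorem PolyTime.moves (und : Bool) {E : α → List Edge} (hE : PolyTime E) :
    PolyTime fun a => moves und (E a) := by
  unfold DelayBetter.moves; fun_prop

@[fun_prop]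
theorem PolyTime.lookupWalk {tab : α → List (ℕ × List Move)} {v : α → ℕ} (ht : PolyTime tab)
    (hv : PolyTime v) : PolyTime fun a => lookupWalk (tab a) (v a) := by
  unfold DelayBetter.lookupWalk; fun_prop

@[fun_prop]
theorem PolyTime.searchMove {tab : α → List (ℕ × List Move)} {m : α → Move} (ht : PolyTime tab)
    (hm : PolyTime m) : PolyTime fun a => searchMove (tab a) (m a) := by
  unfold DelayBetter.searchMove; fun_prop

theorem lookupWalk_mem (tab : List (ℕ × List Move)) (v : ℕ) :
    lookupWalk tab v = [] ∨ (v, lookupWalk tab v) ∈ tab := by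
  unfold lookupWalk
  rcases h : tab.filter (fun p => eqb p.1 v) with _ | ⟨⟨w, W⟩, l⟩
  · rw [h]; exact .inl rfl
  · rw [h]
    right
    have : (w, W) ∈ tab.filter (fun p => eqb p.1 v) := by rw [h]; simp
    rw [List.mem_filter, eqb_iff] at this
    simp only [List.map_cons, List.headD_cons]
    rw [← this.2]; exact this.1

/-- A new entry copies an old walk, so growth is not additive in the move alone. The table is
bounded instead through its shape: few entries, each a short list of moves from `M`. -/
theorem sz_foldl_searchMove (M : List Move) (x : ℕ) (l : List Move) (hl : l ⊆ M) :
    (l.foldl searchMove [(x, [])]).length ≤ l.length + 1 ∧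
      ∀ p ∈ l.foldl searchMove [(x, [])], sz p.1 ≤ sz x + sz M ∧ p.2.length ≤ l.length ∧
        p.2 ⊆ M := by
  induction l using List.reverseRecOn with
  | nil => simp
  | append_singleton l m ih =>
    obtain ⟨h1, h2⟩ := ih fun x hx => hl (by simp [hx])
    have hm : m ∈ M := hl (by simp)
    rw [List.foldl_append]
    set tab := l.foldl searchMove [(x, [])]
    simp only [List.foldl_cons, List.foldl_nil, searchMove, List.length_append, List.length_cons,
      List.length_nil]
    split
    · exact ⟨by omega, fun p hp => ⟨(h2 p hp).1, by have := (h2 p hp).2.1; omega, (h2 p hp).2.2⟩⟩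
    · simp only [List.length_cons, List.forall_mem_cons]
      refine ⟨by omega, ⟨?_, ?_, ?_⟩, fun p hp => ⟨(h2 p hp).1, by have := (h2 p hp).2.1; omega,
        (h2 p hp).2.2⟩⟩
      · have := sz_le_of_mem hm
        obtain ⟨a, b, e⟩ := m
        simp only [sz_pair] at *; omega
      · rcases lookupWalk_mem tab m.1 with h | h
        · simp [h]
        · have := (h2 _ h).2.1; simpa using this
      · rcases lookupWalk_mem tab m.1 with h | h
        · simpa [h] using hm
        · have := (h2 _ h).2.2; simpa [hm] using this

@[fun_prop]
theorem PolyTime.walkTable {M : α → List Move} {x : α → ℕ} (hM : PolyTime M) (hx : PolyTime x) :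
    PolyTime fun a => walkTable (M a) (x a) := by
  have ⟨_, _, p, _, hp⟩ := hM
  have ⟨_, _, q, _, hq⟩ := hx
  have hl : PolyTime fun a => (M a).flatMap fun _ => M a := by fun_prop
  have ⟨_, _, r, _, hr⟩ := hl
  refine PolyTime.foldl_of_bound (step := fun _ tab m => DelayBetter.searchMove tab m) hl
    (by fun_prop) (by fun_prop) ((r + 1) * (q + p + r * (p + 1) + 5) + 1) fun a l' hl' => ?_
  obtain ⟨h1, h2⟩ := sz_foldl_searchMove (M a) (x a) l' fun m hm => by
    have := hl'.subset hm; simp at this; exact this.2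
  have h3 : l'.length ≤ r.eval (sz a) :=
    hl'.length_le.trans ((length_lt_sz _).le.trans (hr a).1)
  have h4 := (hp a).1
  have h5 := (hq a).1
  refine (sz_le_mul (m := q.eval (sz a) + p.eval (sz a) + r.eval (sz a) * (p.eval (sz a) + 1) + 4)
    fun y hy => ?_).trans ?_
  · obtain ⟨h6, h7, h8⟩ := h2 y hy
    have h9 : sz y.2 ≤ y.2.length * (p.eval (sz a) + 1) + 1 :=
      sz_le_mul fun m hm => (sz_le_of_mem (h8 hm)).trans h4
    have h10 := Nat.mul_le_mul_right (p.eval (sz a) + 1) (h7.trans h3)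
    obtain ⟨y1, y2⟩ := y
    simp only [sz_pair] at *; omega
  · simp only [eval_add, eval_mul, eval_ofNat, eval_one]
    exact Nat.add_le_add_right (Nat.mul_le_mul_right _ (h1.trans (by omega))) _

@[fun_prop]
theorem PolyTime.findPath {M : α → List Move} {x y : α → ℕ} (hM : PolyTime M) (hx : PolyTime x)
    (hy : PolyTime y) : PolyTime fun a => findPath (M a) (x a) (y a) := by
  unfold DelayBetter.findPath; fun_prop

@[fun_prop]
theorem PolyTime.hasReverse {E : α → List Edge} {e : α → Edge} (hE : PolyTime E)
    (he : PolyTime e) : PolyTime fun a => hasReverse (E a) (e a) := by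
  unfold DelayBetter.hasReverse; fun_prop

@[fun_prop]
theorem PolyTime.addEdge {T : α → List Edge} {e : α → Edge} (hT : PolyTime T)
    (he : PolyTime e) : PolyTime fun a => addEdge (T a) (e a) := by
  unfold DelayBetter.addEdge; fun_prop

@[fun_prop]
theorem PolyTime.forest {E : α → List Edge} (hE : PolyTime E) :
    PolyTime fun a => forest (E a) :=
  PolyTime.foldl (step := fun _ T e => DelayBetter.addEdge T e) (by fun_prop) (by fun_prop)
    (by fun_prop) (X + 1) fun a T e => by
      simp only [DelayBetter.addEdge]
      split <;> simp
      omega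

@[fun_prop]
theorem PolyTime.feedback {E : α → List Edge} (hE : PolyTime E) :
    PolyTime fun a => feedback (E a) := by
  unfold DelayBetter.feedback; fun_prop

@[fun_prop]
theorem PolyTime.options (und : Bool) {F : α → List Edge} {D : α → List Demand} (hF : PolyTime F)
    (hD : PolyTime D) : PolyTime fun a => options und (F a) (D a) := by
  unfold DelayBetter.options positionOptions moveOptions; fun_prop

theorem sz_insertAt (l : List Edge) (p : Edge × Choice) : sz (insertAt l p) ≤ sz l + sz p := by
  have h1 := sz_append (l.take p.2.1.length) (p.1 :: l.drop p.2.1.length)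
  have h2 := sz_append (l.take p.2.1.length) (l.drop p.2.1.length)
  have h3 := sz_pos p.2
  rw [List.take_append_drop] at h2
  obtain ⟨p1, p2⟩ := p
  simp only [insertAt, sz_cons, sz_pair] at *
  omega

@[fun_prop]
theorem PolyTime.ordering {F : α → List Edge} {g : α → List Choice} (hF : PolyTime F)
    (hg : PolyTime g) : PolyTime fun a => ordering (F a) (g a) :=
  PolyTime.foldl (step := fun _ l p => insertAt l p) (by fun_prop) (by fun_prop)
    (by unfold insertAt; fun_prop) X fun a l p => (sz_insertAt l p).trans (by simp)

@[fun_prop]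
theorem PolyTime.chosenMoves {π : α → List Edge} {g : α → List Choice} {d : α → Demand}
    (hπ : PolyTime π) (hg : PolyTime g) (hd : PolyTime d) :
    PolyTime fun a => chosenMoves (π a) (g a) (d a) := by
  unfold DelayBetter.chosenMoves; fun_prop

@[fun_prop]
theorem PolyTime.connect {M : α → List Move} {u v : α → ℕ} {ms : α → List Move}
    (hM : PolyTime M) (hu : PolyTime u) (hm : PolyTime ms) (hv : PolyTime v) :
    PolyTime fun a => connect (M a) (u a) (ms a) (v a) := by
  unfold DelayBetter.connect; fun_prop

@[fun_prop]
theorem PolyTime.demandWalks (und : Bool) {T F : α → List Edge} {D : α → List Demand}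
    {g : α → List Choice} (hT : PolyTime T) (hF : PolyTime F) (hD : PolyTime D) (hg : PolyTime g) :
    PolyTime fun a => demandWalks und (T a) (F a) (D a) (g a) := by
  unfold DelayBetter.demandWalks; fun_prop

@[fun_prop]
theorem PolyTime.consecutive {W : α → List Move} (hW : PolyTime W) :
    PolyTime fun a => consecutive (W a) := by
  unfold DelayBetter.consecutive; fun_prop

@[fun_prop]
theorem PolyTime.maxWith {x : α → ℕ} {l : α → List ℕ} (hx : PolyTime x) (hl : PolyTime l) :
    PolyTime fun a => maxWith (x a) (l a) :=
  PolyTime.foldl (step := fun _ a b => if DelayBetter.leb a b then b else a) hl hx (by fun_prop) X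
    fun a b x => by split <;> simp; omega

@[fun_prop]
theorem PolyTime.relax {C : α → List (Edge × Edge)} {tab : α → List (Edge × ℕ)}
    (hC : PolyTime C) (ht : PolyTime tab) : PolyTime fun a => relax (C a) (tab a) := by
  unfold DelayBetter.relax; fun_prop

theorem maxWith_mem (x : ℕ) (l : List ℕ) : maxWith x l = x ∨ maxWith x l ∈ l := by
  induction l generalizing x with
  | nil => simp [maxWith]
  | cons y l ih =>
    rcases ih (if leb x y then y else x) with h | h
    · simp only [maxWith, List.foldl_cons] at *
      rw [h]; split <;> simp
    · simp only [maxWith, List.foldl_cons, List.mem_cons] at *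
      exact .inr (.inr h)

/-- After one round a time is an old time or the successor of one, so by `sz_succ_le` the binary
size of the largest time grows by at most 4 per round. -/
theorem sz_foldl_relax (E : List Edge) (C : List (Edge × Edge)) (l : List Edge) :
    (l.foldl (fun tab _ => relax C tab) (E.map fun e => (e, e.2.2))).length = E.length ∧
      ∀ p ∈ l.foldl (fun tab _ => relax C tab) (E.map fun e => (e, e.2.2)),
        p.1 ∈ E ∧ sz p.2 ≤ sz E + 4 * l.length := by
  induction l using List.reverseRecOn with
  | nil =>
    simp only [List.foldl_nil, List.length_map, List.forall_mem_map, true_and]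
    intro e he
    refine ⟨he, ?_⟩
    have := sz_le_of_mem he
    obtain ⟨a, b, c⟩ := e
    simp only [sz_pair] at *; omega
  | append_singleton l m ih =>
    obtain ⟨h1, h2⟩ := ih
    rw [List.foldl_append]
    set tab := l.foldl (fun tab _ => relax C tab) (E.map fun e => (e, e.2.2))
    simp only [List.foldl_cons, List.foldl_nil, relax, List.length_append, List.length_cons,
      List.length_nil, List.length_map, List.forall_mem_map]
    refine ⟨h1, fun p hp => ⟨(h2 p hp).1, ?_⟩⟩
    rcases maxWith_mem p.2 (C.flatMap fun c => if eqb c.2 p.1 then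
      (tab.filter fun q => eqb q.1 c.1).map fun q => q.2.succ else []) with h | h
    · rw [h]; have := (h2 p hp).2; omega
    · obtain ⟨c, -, h⟩ := List.mem_flatMap.1 h
      split at h
      · obtain ⟨q, hq, h⟩ := List.mem_map.1 h
        have h3 := (h2 q (List.mem_filter.1 hq).1).2
        have h4 := sz_succ_le q.2
        rw [← h]; omega
      · simp at h

@[fun_prop]
theorem PolyTime.relaxedTimes {E : α → List Edge} {C : α → List (Edge × Edge)}
    (hE : PolyTime E) (hC : PolyTime C) : PolyTime fun a => relaxedTimes (E a) (C a) := by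
  have ⟨_, _, p, _, hp⟩ := hE
  refine PolyTime.foldl_of_bound (step := fun a tab _ => DelayBetter.relax (C a) tab) hE
    (by fun_prop) ?_ (p * (6 * p + 2) + 1) fun a l' hl' => ?_
  · have : PolyTime fun q : (α × List (Edge × ℕ)) × Edge => C q.1.1 :=
      hC.comp (f := fun q : (α × List (Edge × ℕ)) × Edge => q.1.1) (by fun_prop)
    fun_prop
  obtain ⟨h1, h2⟩ := sz_foldl_relax (E a) (C a) l'
  have h3 := length_lt_sz (E a)
  have h4 := hl'.length_le
  have h5 := (hp a).1
  refine (sz_le_mul (m := 6 * p.eval (sz a) + 1) fun y hy => ?_).trans ?_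
  · obtain ⟨h6, h7⟩ := h2 y hy
    have := sz_le_of_mem h6
    obtain ⟨y1, y2⟩ := y
    simp only [sz_pair] at *; omega
  · rw [h1]
    simp only [eval_add, eval_mul, eval_ofNat, eval_one]
    exact Nat.add_le_add_right (Nat.mul_le_mul_right _ (by omega)) _

@[fun_prop]
theorem PolyTime.validWalks {M : α → List Move} {C : α → List (Edge × Edge)}
    {ws : α → List (Demand × List Move)} {tab : α → List (Edge × ℕ)} (hM : PolyTime M)
    (hC : PolyTime C) (hw : PolyTime ws) (ht : PolyTime tab) :
    PolyTime fun a => validWalks (M a) (C a) (ws a) (tab a) := by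
  unfold DelayBetter.validWalks; fun_prop

@[fun_prop]
theorem PolyTime.verify (und : Bool) {E T F : α → List Edge} {D : α → List Demand}
    {g : α → List Choice} (hE : PolyTime E) (hT : PolyTime T) (hF : PolyTime F) (hD : PolyTime D)
    (hg : PolyTime g) : PolyTime fun a => verify und (E a) (T a) (F a) (D a) (g a) := by
  unfold DelayBetter.verify; fun_prop

end

/-- The search solves the problem in time `∏ |o|`, over the lists `o` of options, times a
polynomial. -/
theorem exists_program (und : Bool) : ∃ (c : Cmd) (p : ℕ[X]), ∀ (V : List ℕ) (E : List Edge)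
    (D : List Demand), ∃ (s : Store) (t : ℕ), Exec c (inputStore (enc (V, E, D))) s t ∧
      t ≤ ((options und (feedback E) D).map List.length).prod * p.eval (sz (V, E, D)) ∧
      (s 0 ≠ Data.nil ↔ ∃ g, List.Forall₂ (· ∈ ·) g (options und (feedback E) D) ∧
        verify und E (forest E) (feedback E) D g = true) := by
  obtain ⟨c, p, h⟩ := exists_search (ι := List ℕ × List Edge × List Demand)
    (options := fun i => options und (feedback i.2.1) i.2.2)
    (ctx := fun i => (i.2.1, forest i.2.1, feedback i.2.1, i.2.2))
    -- The search keeps its choices latest first, whereas `verify` expects the order of the options.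
    (fun x g => verify und x.1 x.2.1 x.2.2.1 x.2.2.2 g.reverse) (by fun_prop) (by fun_prop)
    (by fun_prop)
  refine ⟨c, p, fun V E D => ?_⟩
  obtain ⟨s, t, h1, h2, h3⟩ := h (V, E, D) fun o ho => by
    simp only [options, positionOptions, moveOptions, List.mem_append, List.mem_flatMap,
      List.mem_map] at ho
    rcases ho with ⟨s, -, ho⟩ | ⟨d, -, f, -, rfl⟩
    · split at ho
      · simp at ho
      · rw [List.mem_singleton] at ho; subst ho
        rw [← List.length_pos_iff]; simp
    · simp
  exact ⟨s, t, h1, h2, by simpa using h3⟩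
end DelayBetter

namespace DelayBetter

/-! ### Walks -/

/-- `S` is a walk from `u` to `v`. -/
def IsWalk (u : ℕ) (S : List Move) (v : ℕ) : Prop :=
  (u :: S.map fun m => m.2.1) = (S.map fun m => m.1) ++ [v]

/-- The vertices of a walk that starts at `u`. -/
def verts (u : ℕ) (S : List Move) : List ℕ := u :: S.map fun m => m.2.1

@[simp] theorem isWalk_nil {u v : ℕ} : IsWalk u [] v ↔ u = v := by simp [IsWalk]

@[simp] theorem isWalk_cons {u v : ℕ} {m : Move} {S : List Move} :
    IsWalk u (m :: S) v ↔ u = m.1 ∧ IsWalk m.2.1 S v := by simp [IsWalk]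

@[simp] theorem verts_nil (u : ℕ) : verts u [] = [u] := rfl

@[simp] theorem verts_cons (u : ℕ) (m : Move) (S : List Move) :
    verts u (m :: S) = u :: verts m.2.1 S := rfl

theorem isWalk_append {u v : ℕ} {S S' : List Move} :
    IsWalk u (S ++ S') v ↔ ∃ w, IsWalk u S w ∧ IsWalk w S' v := by
  induction S generalizing u with
  | nil => simp
  | cons m S ih => simp [ih, and_assoc]

theorem mem_moves {und : Bool} {E : List Edge} {m : Move} : m ∈ moves und E ↔ m.2.2 ∈ E ∧
    (m.1 = m.2.2.1 ∧ m.2.1 = m.2.2.2.1 ∨ und = true ∧ m.1 = m.2.2.2.1 ∧ m.2.1 = m.2.2.1) := by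
  obtain ⟨a, b, e⟩ := m
  simp only [moves, List.mem_flatMap, List.mem_cons, Prod.mk.injEq]
  constructor
  · rintro ⟨f, hf, ⟨rfl, rfl, rfl⟩ | h⟩
    · exact ⟨hf, .inl ⟨rfl, rfl⟩⟩
    · cases und
      · simp at h
      · simp at h
        obtain ⟨rfl, rfl, rfl⟩ := h
        exact ⟨hf, .inr ⟨rfl, rfl, rfl⟩⟩
  · rintro ⟨he, ⟨rfl, rfl⟩ | ⟨rfl, rfl, rfl⟩⟩
    · exact ⟨e, he, .inl ⟨rfl, rfl, rfl⟩⟩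
    · exact ⟨e, he, .inr (by simp)⟩

theorem moves_subset_true (und : Bool) (E : List Edge) : moves und E ⊆ moves true E := by
  intro m hm
  rw [mem_moves] at *
  exact ⟨hm.1, hm.2.imp_right fun h => ⟨rfl, h.2⟩⟩

/-- What a list of edges of a (directed or undirected) footprint satisfies. -/
structure WellFormed (und : Bool) (E : List Edge) : Prop where
  nodup : E.Nodup
  loopless : ∀ e ∈ E, e.1 ≠ e.2.1
  unique : ∀ e ∈ E, ∀ f ∈ E, e.1 = f.1 → e.2.1 = f.2.1 → e = f
  no_reverse : und = true → ∀ e ∈ E, ∀ f ∈ E, e.1 = f.2.1 → e.2.1 ≠ f.1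

theorem WellFormed.moves_unique {und : Bool} {E : List Edge} (h : WellFormed und E) {m m' : Move}
    (hm : m ∈ moves und E) (hm' : m' ∈ moves und E) (h1 : m.1 = m'.1) (h2 : m.2.1 = m'.2.1) :
    m = m' := by
  suffices m.2.2 = m'.2.2 from Prod.ext h1 (Prod.ext h2 this)
  rw [mem_moves] at hm hm'
  obtain ⟨hm, ⟨h3, h4⟩ | ⟨hu, h3, h4⟩⟩ := hm <;> obtain ⟨hm', ⟨h5, h6⟩ | ⟨hu', h5, h6⟩⟩ := hm'
  · exact h.unique _ hm _ hm' (by omega) (by omega)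
  · exact absurd (by omega) (h.no_reverse hu' _ hm _ hm' (by omega))
  · exact absurd (by omega) (h.no_reverse hu _ hm _ hm' (by omega))
  · exact h.unique _ hm _ hm' (by omega) (by omega)

/-! ### The footprint as a simple graph -/

/-- The underlying simple graph. -/
def graph (T : List Edge) : SimpleGraph ℕ where
  Adj a b := a ≠ b ∧ ∃ e ∈ T, e.1 = a ∧ e.2.1 = b ∨ e.1 = b ∧ e.2.1 = a
  symm := ⟨by rintro a b ⟨h, e, he, h1⟩; exact ⟨h.symm, e, he, h1.symm⟩⟩
  loopless := ⟨fun a h => h.1 rfl⟩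

theorem graph_adj_of_mem {T : List Edge} {e : Edge} (he : e ∈ T) (h : e.1 ≠ e.2.1) :
    (graph T).Adj e.1 e.2.1 := ⟨h, e, he, .inl ⟨rfl, rfl⟩⟩

theorem graph_mono {T T' : List Edge} (h : T ⊆ T') : graph T ≤ graph T' := by
  rintro a b ⟨h1, e, he, h2⟩
  exact ⟨h1, e, h he, h2⟩

theorem IsWalk.exists_walk {T : List Edge} (hT : ∀ e ∈ T, e.1 ≠ e.2.1) {u v : ℕ} {S : List Move}
    (hS : S ⊆ moves true T) (h : IsWalk u S v) :
    ∃ p : (graph T).Walk u v, p.support = verts u S := by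
  induction S generalizing u with
  | nil => rw [isWalk_nil] at h; subst h; exact ⟨.nil, rfl⟩
  | cons m S ih =>
    obtain ⟨rfl, h'⟩ := isWalk_cons.1 h
    obtain ⟨p, hp⟩ := ih (fun x hx => hS (by simp [hx])) h'
    obtain ⟨he, hm⟩ := mem_moves.1 (hS (List.mem_cons_self))
    have hl := hT _ he
    have : (graph T).Adj m.1 m.2.1 := by
      refine ⟨by omega, _, he, ?_⟩
      omega
    exact ⟨.cons this p, by simp [hp]⟩

theorem exists_isWalk {T : List Edge} {u v : ℕ} (p : (graph T).Walk u v) :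
    ∃ S, S ⊆ moves true T ∧ IsWalk u S v ∧ verts u S = p.support := by
  induction p with
  | nil => exact ⟨[], by simp⟩
  | cons h p ih =>
    rename_i a b c
    obtain ⟨S, h1, h2, h3⟩ := ih
    obtain ⟨e, he, h4⟩ : ∃ e ∈ T, e.1 = a ∧ e.2.1 = b ∨ e.1 = b ∧ e.2.1 = a := h.2
    refine ⟨(a, b, e) :: S, ?_, by simp [h2], by simp [h3]⟩
    rw [List.cons_subset, mem_moves]
    exact ⟨⟨he, by simp only [true_and]; omega⟩, h1⟩

theorem IsWalk.eq_of_verts_eq {M : List Move} (hM : ∀ m ∈ M, ∀ m' ∈ M, m.1 = m'.1 → m.2.1 = m'.2.1 →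
    m = m') {u v : ℕ} {S S' : List Move} (hS : S ⊆ M) (hS' : S' ⊆ M) (h : IsWalk u S v)
    (h' : IsWalk u S' v) (hv : verts u S = verts u S') : S = S' := by
  induction S generalizing u S' with
  | nil => cases S' with
    | nil => rfl
    | cons m' S' => simp [verts] at hv
  | cons m S ih => cases S' with
    | nil => simp [verts] at hv
    | cons m' S' =>
      rw [isWalk_cons] at h h'
      have hv' : verts m.2.1 S = verts m'.2.1 S' := by simpa using hv
      have h1 : m.2.1 = m'.2.1 := by simp [verts] at hv'; exact hv'.1
      have h2 := hM m (hS (by simp)) m' (hS' (by simp)) (h.1.symm.trans h'.1) h1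
      subst h2
      rw [ih (fun x hx => hS (by simp [hx])) (fun x hx => hS' (by simp [hx])) h.2 h'.2 hv']

/-- In a forest, simple walks are unique. -/
theorem IsWalk.unique {und : Bool} {T : List Edge} (hT : WellFormed und T)
    (ha : (graph T).IsAcyclic) {u v : ℕ} {S S' : List Move} (hS : S ⊆ moves und T)
    (hS' : S' ⊆ moves und T) (h : IsWalk u S v) (h' : IsWalk u S' v) (hn : (verts u S).Nodup)
    (hn' : (verts u S').Nodup) : S = S' := by
  obtain ⟨p, hp⟩ := h.exists_walk hT.loopless (List.Subset.trans hS (moves_subset_true _ _))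
  obtain ⟨p', hp'⟩ := h'.exists_walk hT.loopless (List.Subset.trans hS' (moves_subset_true _ _))
  have := (ha.subsingleton_path u v).elim ⟨p, SimpleGraph.Walk.isPath_def p |>.2 (hp ▸ hn)⟩
    ⟨p', SimpleGraph.Walk.isPath_def p' |>.2 (hp' ▸ hn')⟩
  have h1 : p = p' := congrArg Subtype.val this
  exact IsWalk.eq_of_verts_eq (fun m hm m' hm' => hT.moves_unique hm hm') hS hS' h h'
    (by rw [← hp, ← hp', h1])

/-! ### Path finding -/

theorem lookupWalk_mem_of_mem {tab : List (ℕ × List Move)} {v : ℕ} {W : List Move}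
    (h : (v, W) ∈ tab) : (v, lookupWalk tab v) ∈ tab := by
  have h1 : (v, W) ∈ tab.filter fun p => eqb p.1 v := by
    rw [List.mem_filter, eqb_iff]; exact ⟨h, rfl⟩
  unfold lookupWalk
  rcases h2 : tab.filter (fun p => eqb p.1 v) with _ | ⟨⟨k, W'⟩, l⟩
  · rw [h2] at h1; simp at h1
  · have h3 : (k, W') ∈ tab.filter fun p => eqb p.1 v := by rw [h2]; simp
    rw [List.mem_filter, eqb_iff] at h3
    rw [h2, List.map_cons, List.headD_cons, ← h3.2]
    exact h3.1

theorem subset_searchMove (tab : List (ℕ × List Move)) (m : Move) :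
    tab ⊆ searchMove tab m := by
  unfold searchMove; split
  · exact fun _ h => h
  · exact List.subset_cons_self _ _

theorem subset_foldl_searchMove (l : List Move) (tab : List (ℕ × List Move)) :
    tab ⊆ l.foldl searchMove tab := by
  induction l generalizing tab with
  | nil => exact fun _ h => h
  | cons m l ih => exact List.Subset.trans (subset_searchMove tab m) (ih _)

theorem exists_mem_searchMove {tab : List (ℕ × List Move)} {m : Move}
    (h : ∃ W, (m.1, W) ∈ tab) : ∃ W, (m.2.1, W) ∈ searchMove tab m := by
  unfold searchMove
  split
  · rename_i hc
    simp only [Bool.or_eq_true, List.any_eq_true, eqb_iff, Bool.not_eq_true',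
      List.any_eq_false] at hc
    rcases hc with ⟨⟨k, W⟩, h1, rfl⟩ | hc
    · exact ⟨W, h1⟩
    · obtain ⟨W, hW⟩ := h
      exact absurd rfl (hc _ hW)
  · exact ⟨_, List.mem_cons_self⟩

theorem exists_mem_foldl_searchMove {l : List Move} {tab : List (ℕ × List Move)} {m : Move}
    (hm : m ∈ l) (h : ∃ W, (m.1, W) ∈ tab) : ∃ W, (m.2.1, W) ∈ l.foldl searchMove tab := by
  induction l generalizing tab with
  | nil => simp at hm
  | cons m' l ih =>
    rcases List.mem_cons.1 hm with rfl | hm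
    · obtain ⟨W, hW⟩ := exists_mem_searchMove h
      exact ⟨W, subset_foldl_searchMove l _ hW⟩
    · obtain ⟨W, hW⟩ := h
      exact ih hm ⟨W, subset_searchMove _ _ hW⟩

/-- Each round through `M` advances at least one move along `S`; the list `L` only counts rounds. -/
theorem exists_mem_rounds {M : List Move} {S : List Move} (hS : S ⊆ M) {y : ℕ} (L : List Move)
    (x : ℕ) (tab : List (ℕ × List Move)) (hL : S.length ≤ L.length) (hw : IsWalk x S y)
    (h : ∃ W, (x, W) ∈ tab) :
    ∃ W, (y, W) ∈ (L.flatMap fun _ => M).foldl searchMove tab := by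
  induction S generalizing L x tab with
  | nil =>
    obtain ⟨W, hW⟩ := h
    rw [isWalk_nil] at hw
    exact ⟨W, subset_foldl_searchMove _ _ (hw ▸ hW)⟩
  | cons m S ih =>
    obtain ⟨rfl, hw'⟩ := isWalk_cons.1 hw
    cases L with
    | nil => simp at hL
    | cons a L =>
      rw [List.flatMap_cons, List.foldl_append]
      exact ih (fun z hz => hS (by simp [hz])) L _ _ (by simpa using hL) hw'
        (exists_mem_foldl_searchMove (hS (by simp)) h)

/-- The last clause makes the induction work: all vertices of a stored walk are in the table, so
extending the walk to a vertex outside the table keeps it simple. -/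
theorem foldl_searchMove_sound {M : List Move} {x : ℕ} (l : List Move) (hl : l ⊆ M) :
    ∀ p ∈ l.foldl searchMove [(x, [])], p.2 ⊆ M ∧ IsWalk x p.2.reverse p.1 ∧
      (verts x p.2.reverse).Nodup ∧
      ∀ v ∈ verts x p.2.reverse, ∃ W, (v, W) ∈ l.foldl searchMove [(x, [])] := by
  induction l using List.reverseRecOn with
  | nil => simp
  | append_singleton l m ih =>
    have ih := ih fun z hz => hl (by simp [hz])
    have hm : m ∈ M := hl (by simp)
    rw [List.foldl_append]
    set tab := l.foldl searchMove [(x, [])]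
    simp only [List.foldl_cons, List.foldl_nil]
    unfold searchMove
    split
    · exact ih
    · rename_i hc
      simp only [Bool.or_eq_true, List.any_eq_true, eqb_iff, Bool.not_eq_true',
        List.any_eq_false, not_or, not_exists, not_and, not_forall, not_not] at hc
      obtain ⟨hc1, ⟨k, W⟩, hkW, hk⟩ := hc
      have hmem : (m.1, lookupWalk tab m.1) ∈ tab := by
        subst hk; exact lookupWalk_mem_of_mem hkW
      obtain ⟨h1, h2, h3, h4⟩ := ih _ hmem
      have hv : ∀ S : List Move, verts x (S ++ [m]) = verts x S ++ [m.2.1] := by simp [verts]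
      simp only [List.forall_mem_cons]
      refine ⟨⟨by simp [hm, h1], ?_, ?_, ?_⟩, fun p hp => ?_⟩
      · rw [List.reverse_cons, isWalk_append]
        exact ⟨_, h2, by simp⟩
      · rw [List.reverse_cons, hv, List.nodup_append]
        refine ⟨h3, by simp, fun a ha b hb => ?_⟩
        rw [List.mem_singleton] at hb
        rintro rfl
        obtain ⟨W, hW⟩ := h4 a ha
        exact hc1 _ hW hb
      · rw [List.reverse_cons, hv]
        intro v hv
        rcases List.mem_append.1 hv with hv | hv
        · obtain ⟨W, hW⟩ := h4 v hv
          exact ⟨W, by simp [hW]⟩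
        · rw [List.mem_singleton] at hv; subst hv
          exact ⟨_, List.mem_cons_self⟩
      · obtain ⟨h1, h2, h3, h4⟩ := ih p hp
        refine ⟨h1, h2, h3, fun v hv => ?_⟩
        obtain ⟨W, hW⟩ := h4 v hv
        exact ⟨W, by simp [hW]⟩

theorem walkTable_sound {M : List Move} {x : ℕ} : ∀ p ∈ walkTable M x, p.2 ⊆ M ∧
    IsWalk x p.2.reverse p.1 ∧ (verts x p.2.reverse).Nodup := fun p hp => by
  obtain ⟨h1, h2, h3, -⟩ := foldl_searchMove_sound (M := M) (x := x) (M.flatMap fun _ => M)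
    (fun m hm => by simp at hm; exact hm.2) p hp
  exact ⟨h1, h2, h3⟩

theorem findPath_sound {M : List Move} {x y : ℕ} : findPath M x y = [] ∨ (findPath M x y ⊆ M ∧
    IsWalk x (findPath M x y) y ∧ (verts x (findPath M x y)).Nodup) := by
  unfold findPath
  rcases lookupWalk_mem (walkTable M x) y with h | h
  · simp [h]
  · obtain ⟨h1, h2, h3⟩ := walkTable_sound _ h
    exact .inr ⟨by simpa using h1, h2, h3⟩

theorem findPath_complete {M : List Move} {x y : ℕ} {S : List Move} (hS : S ⊆ M)
    (hw : IsWalk x S y) (hn : (verts x S).Nodup) : findPath M x y ⊆ M ∧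
    IsWalk x (findPath M x y) y ∧ (verts x (findPath M x y)).Nodup := by
  -- A simple walk repeats no move, so it is no longer than `M` and the rounds of `walkTable`
  -- suffice.
  have hn' : S.Nodup := List.Nodup.of_map _ (List.nodup_cons.1 hn).2
  obtain ⟨W, hW⟩ := exists_mem_rounds hS M x [(x, [])] (List.subperm_of_subset hn' hS).length_le hw
    ⟨[], by simp⟩
  have hmem : (y, lookupWalk (walkTable M x) y) ∈ walkTable M x := by
    exact lookupWalk_mem_of_mem hW
  obtain ⟨h1, h2, h3⟩ := walkTable_sound _ hmem
  exact ⟨by simpa [findPath] using h1, h2, h3⟩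

theorem findPath_eq {und : Bool} {T : List Edge} (hT : WellFormed und T)
    (ha : (graph T).IsAcyclic) {u v : ℕ} {S : List Move} (hS : S ⊆ moves und T)
    (h : IsWalk u S v) (hn : (verts u S).Nodup) : findPath (moves und T) u v = S := by
  obtain ⟨h1, h2, h3⟩ := findPath_complete hS h hn
  exact IsWalk.unique hT ha h1 hS h2 h h3 hn

/-- The empty list stands for failure but is also the walk from a vertex to itself, hence the
assumption `u ≠ v`. -/
theorem findPath_isEmpty_iff {T : List Edge} (hT : ∀ e ∈ T, e.1 ≠ e.2.1) {u v : ℕ} (huv : u ≠ v) :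
    (findPath (moves true T) u v).isEmpty = true ↔ ¬ (graph T).Reachable u v := by
  rw [List.isEmpty_iff]
  constructor
  · rintro h ⟨p⟩
    obtain ⟨S, h1, h2, h3⟩ := exists_isWalk (p.toPath : (graph T).Walk u v)
    obtain ⟨-, h4, -⟩ := findPath_complete h1 h2 (h3 ▸ p.toPath.2.support_nodup)
    rw [h, isWalk_nil] at h4
    exact huv h4
  · intro h
    rcases findPath_sound (M := moves true T) (x := u) (y := v) with h1 | ⟨h1, h2, -⟩
    · exact h1
    · obtain ⟨p, -⟩ := h2.exists_walk hT h1
      exact absurd ⟨p⟩ h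
end DelayBetter

namespace DelayBetter

/-! ### The spanning forest -/

theorem hasReverse_iff {E : List Edge} {e : Edge} :
    hasReverse E e = true ↔ ∃ f ∈ E, f.1 = e.2.1 ∧ f.2.1 = e.1 := by
  simp [hasReverse]

theorem WellFormed.of_subset {und : Bool} {E T : List Edge} (h : WellFormed und E) (hT : T ⊆ E)
    (hn : T.Nodup) : WellFormed und T :=
  ⟨hn, fun e he => h.loopless e (hT he), fun e he f hf => h.unique e (hT he) f (hT hf),
    fun hu e he f hf => h.no_reverse hu e (hT he) f (hT hf)⟩

/-- What holds for the forest built from the list `l` of edges. -/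
structure ForestInv (l T : List Edge) : Prop where
  subset : T ⊆ l
  nodup : T.Nodup
  acyclic : (graph T).IsAcyclic
  reachable : ∀ e ∈ l, (graph T).Reachable e.1 e.2.1

theorem graph_cons (T : List Edge) (e : Edge) :
    graph (e :: T) = graph T ⊔ SimpleGraph.edge e.1 e.2.1 := by
  ext a b
  simp only [SimpleGraph.sup_adj, SimpleGraph.edge_adj, graph, List.mem_cons, exists_eq_or_imp]
  constructor
  · rintro ⟨h, h1 | h1⟩
    · right; omega
    · exact .inl ⟨h, h1⟩
  · rintro (⟨h, h1⟩ | ⟨h1, h2⟩)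
    · exact ⟨h, .inr h1⟩
    · exact ⟨h2, by left; omega⟩

theorem addEdge_iff {T : List Edge} (hT : ∀ e ∈ T, e.1 ≠ e.2.1) {e : Edge} (he : e.1 ≠ e.2.1) :
    (hasReverse T e || (findPath (moves true T) e.1 e.2.1).isEmpty) = true ↔
      hasReverse T e = true ∨ ¬ (graph T).Reachable e.1 e.2.1 := by
  rw [Bool.or_eq_true, findPath_isEmpty_iff hT he]

theorem subset_addEdge (T : List Edge) (e : Edge) : T ⊆ addEdge T e := by
  unfold addEdge; split <;> simp

/-- An arc whose reverse is present does not change the underlying graph; any other accepted edge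
joins two components and so closes no cycle. A rejected edge has connected ends. -/
theorem ForestInv.step {l T : List Edge} (h : ForestInv l T) {e : Edge} (hl : e ∉ l)
    (hne : ∀ f ∈ e :: l, f.1 ≠ f.2.1) : ForestInv (l ++ [e]) (addEdge T e) := by
  have he := hne e (by simp)
  have hT : ∀ f ∈ T, f.1 ≠ f.2.1 := fun f hf => hne f (by simp [h.subset hf])
  have hmono := graph_mono (subset_addEdge T e)
  refine ⟨?_, ?_, ?_, fun f hf => ?_⟩
  · unfold addEdge
    split
    · exact List.cons_subset.2 ⟨by simp, fun f hf => List.mem_append_left _ (h.subset hf)⟩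
    · exact fun f hf => List.mem_append_left _ (h.subset hf)
  · unfold addEdge
    split
    · exact List.nodup_cons.2 ⟨fun hm => hl (h.subset hm), h.nodup⟩
    · exact h.nodup
  · unfold addEdge
    split
    · rename_i hc
      rw [addEdge_iff hT he] at hc
      rw [graph_cons]
      rcases hc with hc | hc
      · obtain ⟨f, hf, h1, h2⟩ := hasReverse_iff.1 hc
        have : SimpleGraph.edge e.1 e.2.1 ≤ graph T := by
          intro a b hab
          rw [SimpleGraph.edge_adj] at hab
          exact ⟨hab.2, f, hf, by omega⟩
        rw [sup_eq_left.2 this]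
        exact h.acyclic
      · exact (SimpleGraph.isAcyclic_add_edge_iff_of_not_reachable _ _ hc).2 h.acyclic
    · exact h.acyclic
  · rcases List.mem_append.1 hf with hf | hf
    · exact (h.reachable f hf).mono hmono
    · rw [List.mem_singleton] at hf; subst hf
      by_cases hr : (graph T).Reachable f.1 f.2.1
      · exact hr.mono hmono
      · have : addEdge T f = f :: T := by
          unfold addEdge; rw [if_pos ((addEdge_iff hT he).2 (.inr hr))]
        rw [this]
        exact (graph_adj_of_mem (List.mem_cons_self) he).reachable

theorem forestInv_foldl {l : List Edge} (hn : l.Nodup) (hne : ∀ f ∈ l, f.1 ≠ f.2.1) :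
    ForestInv l (l.foldl addEdge []) := by
  induction l using List.reverseRecOn with
  | nil =>
    refine ⟨by simp, by simp, ?_, by simp⟩
    have : graph [] = ⊥ := by ext a b; simp [graph]
    rw [List.foldl_nil, this]
    exact SimpleGraph.isAcyclic_bot
  | append_singleton l e ih =>
    rw [List.foldl_append]
    rw [List.nodup_append] at hn
    exact (ih hn.1 fun f hf => hne f (by simp [hf])).step
      (fun h => hn.2.2 e h e (by simp) rfl)
      fun f hf => hne f (by simp at *; tauto)

/-- Consider an accepted arc `e` and its reverse `f`. If `f` comes later, it is accepted because of
`e`. If `f` came earlier, its ends were already connected when `e` arrived, so `e` was accepted only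
because its reverse was present, and by uniqueness that is `f`. -/
theorem reverse_mem_foldl_addEdge {l : List Edge} (hn : l.Nodup) (hne : ∀ f ∈ l, f.1 ≠ f.2.1)
    (hu : ∀ e ∈ l, ∀ f ∈ l, e.1 = f.1 → e.2.1 = f.2.1 → e = f) :
    ∀ e ∈ l.foldl addEdge [], ∀ f ∈ l, e.1 = f.2.1 → e.2.1 = f.1 → f ∈ l.foldl addEdge [] := by
  induction l using List.reverseRecOn with
  | nil => simp
  | append_singleton l e ih =>
    have hn' := (List.nodup_append.1 hn).1
    have hne' : ∀ f ∈ l, f.1 ≠ f.2.1 := fun f hf => hne f (by simp [hf])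
    have ih := ih hn' hne' fun e he f hf => hu e (by simp [he]) f (by simp [hf])
    have hI := forestInv_foldl hn' hne'
    have he := hne e (by simp)
    rw [List.foldl_append]
    set T := l.foldl addEdge []
    simp only [List.foldl_cons, List.foldl_nil]
    have hT : ∀ f ∈ T, f.1 ≠ f.2.1 := fun f hf => hne' f (hI.subset hf)
    intro a ha f hf h1 h2
    rcases List.mem_append.1 hf with hfl | hf
    · apply subset_addEdge
      by_cases haT : a ∈ T
      · exact ih a haT f hfl h1 h2
      unfold addEdge at ha
      split at ha
      · rename_i hc
        obtain rfl : a = e := by simpa [haT] using ha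
        rcases (addEdge_iff hT he).1 hc with hc | hc
        · obtain ⟨g, hg, h3, h4⟩ := hasReverse_iff.1 hc
          rwa [hu f (by simp [hf]) g (by simp [hI.subset hg]) (by omega) (by omega)]
        · have := (hI.reachable f hfl).symm
          rw [← h1, ← h2] at this
          exact absurd this hc
      · exact absurd ha haT
    · rw [List.mem_singleton] at hf; subst hf
      by_cases haf : a = f
      · subst haf; exact absurd h1 he
      have haT : a ∈ T := by
        unfold addEdge at ha
        split at ha
        · simpa [haf] using ha
        · exact ha
      unfold addEdge
      rw [if_pos ((addEdge_iff hT he).2 (.inl (hasReverse_iff.2 ⟨a, haT, h1, h2⟩)))]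
      simp

theorem foldl_addEdge_subset (l T : List Edge) : T ⊆ l.foldl addEdge T ∧
    l.foldl addEdge T ⊆ T ++ l := by
  induction l generalizing T with
  | nil => simp
  | cons e l ih =>
    obtain ⟨h1, h2⟩ := ih (addEdge T e)
    refine ⟨List.Subset.trans (subset_addEdge T e) h1, List.Subset.trans h2 ?_⟩
    intro f hf
    rcases List.mem_append.1 hf with hf | hf
    · unfold addEdge at hf
      split at hf
      · simp at *; tauto
      · simp [hf]
    · simp [hf]

variable {und : Bool} {E : List Edge}

theorem WellFormed.forestInv (h : WellFormed und E) : ForestInv E (forest E) := by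
  have hp : (E.filter (fun e => hasReverse E e) ++ E.filter fun e => !hasReverse E e).Perm E := by
    have := List.filter_append_perm (fun e => hasReverse E e) E
    simpa using this
  have := forestInv_foldl (hp.nodup_iff.2 h.nodup) fun f hf => h.loopless f (hp.mem_iff.1 hf)
  exact ⟨fun f hf => hp.mem_iff.1 (this.subset hf), this.nodup, this.acyclic,
    fun e he => this.reachable e (hp.mem_iff.2 he)⟩

/-- The forest contains a set of pairs of antiparallel arcs that spans all such pairs. -/
theorem WellFormed.exists_forest_core (h : WellFormed und E) : ∃ T₁ ⊆ forest E,
    (∀ e ∈ T₁, ∃ f ∈ T₁, f.1 = e.2.1 ∧ f.2.1 = e.1) ∧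
    ∀ e ∈ E, hasReverse E e = true → (graph T₁).Reachable e.1 e.2.1 := by
  set l := E.filter fun e => hasReverse E e with hl
  have hlE : ∀ e ∈ l, e ∈ E := fun e he => (List.mem_filter.1 he).1
  have hn : l.Nodup := h.nodup.filter _
  have hne : ∀ f ∈ l, f.1 ≠ f.2.1 := fun f hf => h.loopless f (hlE f hf)
  have hI := forestInv_foldl hn hne
  refine ⟨l.foldl addEdge [], ?_, fun e he => ?_, fun e he hr => ?_⟩
  · unfold forest; rw [List.foldl_append]; exact (foldl_addEdge_subset _ _).1
  · obtain ⟨heE, hr⟩ := List.mem_filter.1 (hI.subset he)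
    obtain ⟨f, hf, h1, h2⟩ := hasReverse_iff.1 hr
    have hfl : f ∈ l := List.mem_filter.2 ⟨hf, hasReverse_iff.2 ⟨e, heE, h2.symm, h1.symm⟩⟩
    exact ⟨f, reverse_mem_foldl_addEdge hn hne (fun e he f hf => h.unique e (hlE e he) f (hlE f hf))
      e he f hfl h2.symm h1.symm, h1, h2⟩
  · exact hI.reachable e (List.mem_filter.2 ⟨he, hr⟩)

/-! ### Minimality of the feedback edge set -/

/-- The vector of an edge in the space spanned by the vertices. -/
noncomputable def edgeVector (e : Edge) : ℕ →₀ ℚ :=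
  Finsupp.single e.1 1 - Finsupp.single e.2.1 1

/-- Add the edges one at a time. The ends of a new edge `e` lie in different components of the
forest so far. The sum of the coordinates over the component of `e.1` is a linear functional `c`
that vanishes on all earlier edge vectors and equals 1 on that of `e`. -/
theorem edgeVector_linearIndepOn {A : List Edge} (hn : A.Nodup) (hl : ∀ e ∈ A, e.1 ≠ e.2.1)
    (hp : ∀ e ∈ A, ∀ f ∈ A, (e.1 = f.1 ∧ e.2.1 = f.2.1) ∨ (e.1 = f.2.1 ∧ e.2.1 = f.1) → e = f)
    (ha : (graph A).IsAcyclic) : LinearIndepOn ℚ edgeVector {e | e ∈ A} := by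
  classical
  induction A with
  | nil => simp
  | cons e A ih =>
    have hA : A ⊆ e :: A := List.subset_cons_self _ _
    have hins : {f | f ∈ e :: A} = insert e {f | f ∈ A} := by ext; simp
    have hne := hl e (by simp)
    have heA := (List.nodup_cons.1 hn).1
    have hreach : ¬ (graph A).Reachable e.1 e.2.1 := by
      rw [graph_cons, SimpleGraph.isAcyclic_sup_fromEdgeSet_iff] at ha
      intro hr
      rcases ha.2 hr with h | ⟨-, f, hf, h⟩
      · exact hne h
      · exact heA (hp e (by simp) f (by simp [hf]) (by omega) ▸ hf)
    rw [hins, linearIndepOn_insert (show e ∉ {f | f ∈ A} from heA)]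
    refine ⟨ih (List.nodup_cons.1 hn).2 (fun f hf => hl f (hA hf))
      (fun f hf g hg => hp f (hA hf) g (hA hg)) (ha.anti (graph_mono hA)), fun hmem => ?_⟩
    let c : (ℕ →₀ ℚ) →ₗ[ℚ] ℚ :=
      Finsupp.linearCombination ℚ fun v => if (graph A).Reachable e.1 v then (1 : ℚ) else 0
    have hc : ∀ f : Edge, c (edgeVector f) = (if (graph A).Reachable e.1 f.1 then (1 : ℚ) else 0) -
        if (graph A).Reachable e.1 f.2.1 then (1 : ℚ) else 0 := fun f => by
      simp [c, edgeVector]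
    have hle : Submodule.span ℚ (edgeVector '' {f | f ∈ A}) ≤ LinearMap.ker c := by
      rw [Submodule.span_le]
      rintro _ ⟨f, hf, rfl⟩
      have hadj := (graph_adj_of_mem hf (hl f (hA hf))).reachable
      have : (graph A).Reachable e.1 f.1 ↔ (graph A).Reachable e.1 f.2.1 :=
        ⟨fun h => h.trans hadj, fun h => h.trans hadj.symm⟩
      simp [hc, this]
    have := hle hmem
    rw [LinearMap.mem_ker, hc, if_pos (SimpleGraph.Reachable.refl _), if_neg hreach] at this
    norm_num at this

theorem edgeVector_mem_span {B : List Edge} {u v : ℕ} (h : (graph B).Reachable u v) :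
    Finsupp.single u (1 : ℚ) - Finsupp.single v 1 ∈
      Submodule.span ℚ (edgeVector '' {e | e ∈ B}) := by
  obtain ⟨p⟩ := h
  induction p with
  | nil => simp
  | cons h p ih =>
    obtain ⟨hne, e, he, h1⟩ := h
    have hmem := Submodule.subset_span (R := ℚ) (Set.mem_image_of_mem edgeVector
      (show e ∈ {e | e ∈ B} from he))
    rcases h1 with ⟨rfl, rfl⟩ | ⟨rfl, rfl⟩
    · simpa [edgeVector] using Submodule.add_mem _ hmem ih
    · have := Submodule.sub_mem _ ih hmem
      simp only [edgeVector] at this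
      convert this using 1
      abel

/-- A forest does not have more edges than a graph that connects its edges. -/
theorem length_le_of_reachable {A B : List Edge} (hn : A.Nodup) (hl : ∀ e ∈ A, e.1 ≠ e.2.1)
    (hp : ∀ e ∈ A, ∀ f ∈ A, (e.1 = f.1 ∧ e.2.1 = f.2.1) ∨ (e.1 = f.2.1 ∧ e.2.1 = f.1) → e = f)
    (ha : (graph A).IsAcyclic) (hr : ∀ e ∈ A, (graph B).Reachable e.1 e.2.1) :
    A.length ≤ B.length := by
  classical
  have h1 := edgeVector_linearIndepOn hn hl hp ha
  set W := Submodule.span ℚ (edgeVector '' {e | e ∈ B}) with hW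
  have hfin : (edgeVector '' {e | e ∈ B}).Finite := (List.finite_toSet B).image _
  have : Module.Finite ℚ W := Module.Finite.span_of_finite ℚ hfin
  have h2 : LinearIndependent ℚ fun e : {e | e ∈ A} =>
      (⟨edgeVector e, edgeVector_mem_span (hr e e.2)⟩ : W) :=
    LinearIndependent.of_comp W.subtype h1
  have : Fintype {e | e ∈ A} := (List.finite_toSet A).fintype
  have h3 := h2.fintype_card_le_finrank
  have h4 : Fintype.card {e | e ∈ A} = A.length := by
    rw [← List.toFinset_card_of_nodup hn, ← Set.toFinset_card]; congr 1; ext; simp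
  have h5 : Module.finrank ℚ W ≤ B.length := by
    have := finrank_span_finset_le_card (R := ℚ) (B.toFinset.image edgeVector)
    have h6 : ((B.toFinset.image edgeVector : Finset (ℕ →₀ ℚ)) : Set (ℕ →₀ ℚ)) =
        edgeVector '' {e | e ∈ B} := by ext; simp
    unfold Set.finrank at this
    rw [h6] at this
    exact this.trans (Finset.card_image_le.trans (List.toFinset_card_le B))
  omega

theorem length_filter_add (l : List Edge) (p : Edge → Bool) :
    (l.filter p).length + (l.filter fun e => !p e).length = l.length := by
  have := (List.filter_append_perm p l).length_eq
  simpa using this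

/-- No acyclic part of the footprint has more edges than the forest. -/
theorem WellFormed.length_le_forest (h : WellFormed und E) {T' : List Edge} (hT : T' ⊆ E)
    (hn : T'.Nodup) (ha : (graph T').IsAcyclic) : T'.length ≤ (forest E).length := by
  have hI := h.forestInv
  obtain ⟨T₁, h1, h2, h3⟩ := h.exists_forest_core
  have hT' := h.of_subset hT hn
  have hF := h.of_subset hI.subset hI.nodup
  -- `p T` selects from each antiparallel pair of `T` the arc towards the smaller vertex. The arcs
  -- not selected contain one representative of each edge of the underlying graph. Both classes are
  -- compared separately.
  let p : List Edge → Edge → Bool := fun T e => hasReverse T e && decide (e.2.1 < e.1)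
  have hp : ∀ T e, p T e = true ↔ hasReverse T e = true ∧ e.2.1 < e.1 := by simp [p]
  have hdbl : ∀ e ∈ T', ∀ f ∈ T', e.1 = f.2.1 ∧ e.2.1 = f.1 →
      hasReverse T' e = true ∧ hasReverse T' f = true := fun e he f hf hef =>
    ⟨hasReverse_iff.2 ⟨f, hf, hef.2.symm, hef.1.symm⟩, hasReverse_iff.2 ⟨e, he, hef.1, hef.2⟩⟩
  -- The selected arcs of `T'` form a forest whose edges come from antiparallel pairs of `E`. The
  -- core `T₁` connects their ends, and it consists of pairs, so the selected arcs of the forest do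
  -- as well.
  have l1 : (T'.filter (p T')).length ≤ ((forest E).filter (p (forest E))).length := by
    refine length_le_of_reachable (hn.filter _)
      (fun e he => hT'.loopless e (List.mem_filter.1 he).1) (fun e he f hf hef => ?_)
      (ha.anti (graph_mono fun x hx => (List.mem_filter.1 hx).1)) fun e he => ?_
    · rw [List.mem_filter, hp] at he hf
      rcases hef with hef | hef
      · exact hT'.unique e he.1 f hf.1 hef.1 hef.2
      · omega
    · rw [List.mem_filter, hp] at he
      obtain ⟨f, hf, h4⟩ := hasReverse_iff.1 he.2.1
      refine (h3 e (hT he.1) (hasReverse_iff.2 ⟨f, hT hf, h4⟩)).mono ?_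
      rintro a b ⟨hne, g, hg, hab⟩
      obtain ⟨g', hg', h5, h6⟩ := h2 g hg
      refine ⟨hne, ?_⟩
      rcases lt_or_gt_of_ne (h.loopless g (hI.subset (h1 hg))) with hlt | hlt
      · exact ⟨g', List.mem_filter.2 ⟨h1 hg', (hp _ _).2
          ⟨hasReverse_iff.2 ⟨g, h1 hg, h6.symm, h5.symm⟩, by omega⟩⟩, by omega⟩
      · exact ⟨g, List.mem_filter.2 ⟨h1 hg, (hp _ _).2
          ⟨hasReverse_iff.2 ⟨g', h1 hg', h5, h6⟩, by omega⟩⟩, by omega⟩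
  -- The other arcs of `T'` form a forest without antiparallel arcs. Dropping one arc of each pair
  -- does not change the underlying graph of `forest E`, which connects the ends of all edges.
  have l2 : (T'.filter fun e => !p T' e).length ≤
      ((forest E).filter fun e => !p (forest E) e).length := by
    refine length_le_of_reachable (hn.filter _)
      (fun e he => hT'.loopless e (List.mem_filter.1 he).1) (fun e he f hf hef => ?_)
      (ha.anti (graph_mono fun x hx => (List.mem_filter.1 hx).1)) fun e he => ?_
    · rw [List.mem_filter, Bool.not_eq_true', ← Bool.not_eq_true, hp] at he hf
      rcases hef with hef | hef
      · exact hT'.unique e he.1 f hf.1 hef.1 hef.2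
      · obtain ⟨h4, h5⟩ := hdbl e he.1 f hf.1 hef
        have := hT'.loopless e he.1
        have h6 : ¬ e.2.1 < e.1 := fun hh => he.2 ⟨h4, hh⟩
        have h7 : ¬ f.2.1 < f.1 := fun hh => hf.2 ⟨h5, hh⟩
        omega
    · refine (hI.reachable e (hT (List.mem_filter.1 he).1)).mono ?_
      rintro a b ⟨hne, g, hg, hab⟩
      refine ⟨hne, ?_⟩
      by_cases hpg : p (forest E) g = true
      · obtain ⟨h4, h5⟩ := (hp _ _).1 hpg
        obtain ⟨f, hf, h6, h7⟩ := hasReverse_iff.1 h4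
        refine ⟨f, List.mem_filter.2 ⟨hf, ?_⟩, by omega⟩
        rw [Bool.not_eq_true', ← Bool.not_eq_true, hp]
        omega
      · exact ⟨g, List.mem_filter.2 ⟨hg, by simpa using hpg⟩, hab⟩
  have e1 := length_filter_add T' (p T')
  have e2 := length_filter_add (forest E) (p (forest E))
  omega

theorem mem_feedback {e : Edge} : e ∈ feedback E ↔ e ∈ E ∧ e ∉ forest E := by
  simp [feedback]
  intro _
  constructor
  · intro h he; exact h _ _ _ he rfl
  · rintro h a b c he rfl; exact h he

/-- Applied to the complement `T'` of a minimum feedback edge set, this bounds the number of edges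
outside the forest by `ρ`. -/
theorem WellFormed.length_feedback_le (h : WellFormed und E) {T' : List Edge} (hT : T' ⊆ E)
    (hn : T'.Nodup) (ha : (graph T').IsAcyclic) :
    (feedback E).length + T'.length ≤ E.length := by
  have hI := h.forestInv
  have h1 := h.length_le_forest hT hn ha
  have h2 := length_filter_add E fun e => (forest E).any fun f => eqb e f
  have h3 : (forest E).length ≤ (E.filter fun e => (forest E).any fun f => eqb e f).length :=
    (List.subperm_of_subset hI.nodup fun e he =>
      List.mem_filter.2 ⟨hI.subset he, List.any_eq_true.2 ⟨e, he, by simp⟩⟩).length_le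
  have h4 : (E.filter fun e => !(forest E).any fun f => eqb e f) = feedback E := rfl
  rw [h4] at h2
  omega
end DelayBetter

namespace DelayBetter

/-! ### Correctness of the verification -/

/-- The edges in `E` can be delayed such that walks that meet all demands become temporal. -/
def HasSolution (und : Bool) (E : List Edge) (D : List Demand) : Prop :=
  ∃ ν : Edge → ℕ, (∀ e ∈ E, e.2.2 ≤ ν e) ∧ ∀ d ∈ D, ∃ S, S ⊆ moves und E ∧
    IsWalk d.1 S d.2.1 ∧ (verts d.1 S).Nodup ∧ (S.map fun m => ν m.2.2).Pairwise (· < ·) ∧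
    ∀ m ∈ S, ν m.2.2 ≤ d.2.2

/-- A walk can be shortened to start at any of its vertices. -/
theorem IsWalk.exists_suffix {u v w : ℕ} {S : List Move} (h : IsWalk u S v)
    (hn : (verts u S).Nodup) (hw : w ∈ verts u S) :
    ∃ S', S'.Sublist S ∧ IsWalk w S' v ∧ (verts w S').Nodup := by
  induction S generalizing u with
  | nil =>
    simp only [verts_nil, List.mem_singleton] at hw
    subst hw; exact ⟨[], List.Sublist.refl _, h, hn⟩
  | cons m S ih =>
    rw [verts_cons] at hw hn
    rcases List.mem_cons.1 hw with rfl | hw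
    · exact ⟨m :: S, List.Sublist.refl _, h, hn⟩
    · obtain ⟨S', h1, h2⟩ := ih (isWalk_cons.1 h).2 (List.nodup_cons.1 hn).2 hw
      exact ⟨S', h1.cons m, h2⟩

/-- Every walk contains a simple walk. -/
theorem IsWalk.exists_nodup {u v : ℕ} {S : List Move} (h : IsWalk u S v) :
    ∃ S', S'.Sublist S ∧ IsWalk u S' v ∧ (verts u S').Nodup := by
  induction S generalizing u with
  | nil => exact ⟨[], List.Sublist.refl _, h, by simp⟩
  | cons m S ih =>
    obtain ⟨rfl, h'⟩ := isWalk_cons.1 h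
    obtain ⟨S', h1, h2, h3⟩ := ih h'
    by_cases hm : m.1 ∈ verts m.2.1 S'
    · obtain ⟨S'', h4, h5⟩ := h2.exists_suffix h3 hm
      exact ⟨S'', (h4.trans h1).cons m, h5⟩
    · exact ⟨m :: S', h1.cons_cons m, by simp [h2], by rw [verts_cons, List.nodup_cons]; exact ⟨hm, h3⟩⟩

/-- Passing to a simple walk takes a sublist of the moves, which keeps times increasing and
deadlines met; so simplicity need not be verified. -/
theorem HasSolution.of_walks {und : Bool} {E : List Edge} {D : List Demand} {ν : Edge → ℕ}
    (h1 : ∀ e ∈ E, e.2.2 ≤ ν e) (h2 : ∀ d ∈ D, ∃ S, S ⊆ moves und E ∧ IsWalk d.1 S d.2.1 ∧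
      (S.map fun m => ν m.2.2).Pairwise (· < ·) ∧ ∀ m ∈ S, ν m.2.2 ≤ d.2.2) :
    HasSolution und E D := by
  refine ⟨ν, h1, fun d hd => ?_⟩
  obtain ⟨S, h3, h4, h5, h6⟩ := h2 d hd
  obtain ⟨S', h7, h8, h9⟩ := h4.exists_nodup
  exact ⟨S', List.Subset.trans h7.subset h3, h8, h9, h5.sublist (h7.map _),
    fun m hm => h6 m (h7.subset hm)⟩

/-! #### Relaxation -/

/-- Relaxation as an operation on functions. -/
def relaxFun (E : List Edge) (C : List (Edge × Edge)) (v : Edge → ℕ) (e : Edge) : ℕ :=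
  maxWith (v e) (C.flatMap fun c => if eqb c.2 e then
    (E.filter fun x => eqb x c.1).map fun x => (v x).succ else [])

theorem relax_map (E : List Edge) (C : List (Edge × Edge)) (v : Edge → ℕ) :
    relax C (E.map fun e => (e, v e)) = E.map fun e => (e, relaxFun E C v e) := by
  simp [relax, relaxFun, List.filter_map, Function.comp_def]

theorem relaxedTimes_eq (E : List Edge) (C : List (Edge × Edge)) :
    relaxedTimes E C = E.map fun e => (e, (relaxFun E C)^[E.length] (fun e => e.2.2) e) := by
  suffices ∀ (l : List Edge) (v : Edge → ℕ), l.foldl (fun tab _ => relax C tab)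
      (E.map fun e => (e, v e)) = E.map fun e => (e, (relaxFun E C)^[l.length] v e) from this E _
  intro l
  induction l with
  | nil => intro v; rfl
  | cons a l ih => intro v; rw [List.foldl_cons, relax_map, ih]; rfl

theorem le_maxWith (x : ℕ) (l : List ℕ) : x ≤ maxWith x l ∧ ∀ y ∈ l, y ≤ maxWith x l := by
  induction l generalizing x with
  | nil => simp [maxWith]
  | cons z l ih =>
    have h := ih (if leb x z then z else x)
    have h1 : maxWith x (z :: l) = maxWith (if leb x z then z else x) l := rfl
    rw [h1]
    have h2 : x ≤ (if leb x z then z else x) ∧ z ≤ (if leb x z then z else x) := by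
      by_cases hxz : x ≤ z
      · simp [leb, hxz]
      · simp [leb, hxz]; omega
    exact ⟨h2.1.trans h.1, List.forall_mem_cons.2 ⟨h2.2.trans h.1, h.2⟩⟩

variable {E : List Edge} {C : List (Edge × Edge)}

theorem le_relaxFun (v : Edge → ℕ) (e : Edge) : v e ≤ relaxFun E C v e := (le_maxWith _ _).1

theorem lt_relaxFun (v : Edge → ℕ) {c : Edge × Edge} (hc : c ∈ C) (h : c.1 ∈ E) :
    v c.1 < relaxFun E C v c.2 := by
  refine Nat.lt_of_succ_le ((le_maxWith _ _).2 _ (List.mem_flatMap.2 ⟨c, hc, ?_⟩))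
  rw [if_pos ((eqb_iff _ _).2 rfl)]
  exact List.mem_map.2 ⟨c.1, List.mem_filter.2 ⟨h, (eqb_iff _ _).2 rfl⟩, rfl⟩

theorem relaxFun_eq (v : Edge → ℕ) (e : Edge) : relaxFun E C v e = v e ∨
    ∃ c ∈ C, c.2 = e ∧ c.1 ∈ E ∧ relaxFun E C v e = v c.1 + 1 := by
  refine (maxWith_mem _ _).imp_right fun h => ?_
  obtain ⟨c, hc, h⟩ := List.mem_flatMap.1 h
  split at h
  · rename_i hce
    obtain ⟨x, hx, h⟩ := List.mem_map.1 h
    rw [List.mem_filter, eqb_iff] at hx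
    obtain ⟨hx, rfl⟩ := hx
    exact ⟨c, hc, (eqb_iff _ _).1 hce, hx, h.symm⟩
  · simp at h

theorem le_iterate_relaxFun (v : Edge → ℕ) (k : ℕ) (e : Edge) : v e ≤ (relaxFun E C)^[k] v e := by
  induction k with
  | zero => exact le_rfl
  | succ k ih => rw [Function.iterate_succ_apply']; exact ih.trans (le_relaxFun _ _)

/-- Relaxation only enforces what every solution satisfies, so the relaxed times are below each of
them; deadlines met by `μ` are met by them. -/
theorem iterate_relaxFun_le {μ v : Edge → ℕ} (hv : ∀ e ∈ E, v e ≤ μ e)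
    (hμ : ∀ c ∈ C, μ c.1 < μ c.2) (k : ℕ) : ∀ e ∈ E, (relaxFun E C)^[k] v e ≤ μ e := by
  induction k with
  | zero => exact hv
  | succ k ih =>
    intro e he
    rw [Function.iterate_succ_apply']
    rcases relaxFun_eq (E := E) (C := C) ((relaxFun E C)^[k] v) e with h | ⟨c, hc, rfl, h1, h⟩
    · rw [h]; exact ih e he
    · rw [h]; have := ih _ h1; have := hμ c hc; omega

/-- A change at an edge in one round stems from a change in the round before at an edge with smaller
`μ`. A late change thus forces many edges below it. -/
theorem le_card_of_iterate_ne {μ : Edge → ℕ} (v : Edge → ℕ) (hμ : ∀ c ∈ C, μ c.1 < μ c.2) (k : ℕ)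
    (e : Edge) (h : (relaxFun E C)^[k + 1] v e ≠ (relaxFun E C)^[k] v e) :
    k ≤ (E.toFinset.filter fun x => μ x < μ e).card := by
  induction k generalizing e with
  | zero => simp
  | succ k ih =>
    rw [Function.iterate_succ_apply'] at h
    rcases relaxFun_eq (E := E) (C := C) ((relaxFun E C)^[k + 1] v) e with h0 | ⟨c, hc, rfl, h1, h2⟩
    · exact absurd h0 h
    have h3 := le_relaxFun (E := E) (C := C) ((relaxFun E C)^[k + 1] v) c.2
    have h4 : (relaxFun E C)^[k] v c.1 < (relaxFun E C)^[k + 1] v c.2 := by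
      rw [Function.iterate_succ_apply']; exact lt_relaxFun _ hc h1
    have h5 := ih c.1 (by omega)
    refine Nat.succ_le_of_lt (h5.trans_lt (Finset.card_lt_card ?_))
    rw [Finset.ssubset_iff_of_subset]
    · exact ⟨c.1, by simpa [h1] using hμ c hc, by simp⟩
    · intro x hx
      simp only [Finset.mem_filter] at hx ⊢
      exact ⟨hx.1, hx.2.trans (hμ c hc)⟩

/-- If there is any solution, then relaxation becomes stable. -/
theorem relaxFun_stable {μ : Edge → ℕ} (v : Edge → ℕ) (hμ : ∀ c ∈ C, μ c.1 < μ c.2) {e : Edge}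
    (he : e ∈ E) : relaxFun E C ((relaxFun E C)^[E.length] v) e = (relaxFun E C)^[E.length] v e := by
  by_contra h
  rw [← Function.iterate_succ_apply' (f := relaxFun E C)] at h
  have h1 := le_card_of_iterate_ne v hμ _ e h
  have h2 : (E.toFinset.filter fun x => μ x < μ e).card < E.toFinset.card := by
    refine Finset.card_lt_card ((Finset.filter_ssubset).2 ⟨e, by simpa using he, by simp⟩)
  have := E.toFinset_card_le
  omega

theorem forall_zip_tail_iff {α : Type} {R : α → α → Prop} (l : List α) :
    (∀ c ∈ l.zip l.tail, R c.1 c.2) ↔ l.IsChain R := by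
  induction l with
  | nil => simp
  | cons a l ih => cases l with
    | nil => simp
    | cons b l => rw [List.isChain_cons_cons, ← ih]; simp

theorem consecutive_iff {ν : Edge → ℕ} {W : List Move} :
    (∀ c ∈ consecutive W, ν c.1 < ν c.2) ↔ (W.map fun m => ν m.2.2).Pairwise (· < ·) := by
  rw [← List.isChain_iff_pairwise, consecutive,
    forall_zip_tail_iff (R := fun a b : Edge => ν a < ν b), List.isChain_map, List.isChain_map]

theorem validWalks_iff {M : List Move} {ws : List (Demand × List Move)} {ν : Edge → ℕ} :
    validWalks M C ws (E.map fun e => (e, ν e)) = true ↔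
      (∀ w ∈ ws, IsWalk w.1.1 w.2 w.1.2.1 ∧ ∀ m ∈ w.2, m ∈ M ∧ (m.2.2 ∈ E → ν m.2.2 ≤ w.1.2.2)) ∧
      ∀ c ∈ C, c.1 ∈ E → c.2 ∈ E → ν c.1 < ν c.2 := by
  unfold validWalks
  simp only [Bool.and_eq_true, List.all_eq_true, eqb_iff, List.any_eq_true, Bool.or_eq_true,
    Bool.not_eq_true', ← Bool.not_eq_true, leb_iff, List.forall_mem_map, not_and]
  refine and_congr (forall₂_congr fun w _ => and_congr Iff.rfl (forall₂_congr fun m _ =>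
    and_congr ⟨?_, fun h => ⟨m, h, rfl⟩⟩ ⟨fun h he => ?_, fun h e he => ?_⟩))
    (forall₂_congr fun c _ => ⟨fun h h1 h2 => ?_, fun h e he f hf => ?_⟩)
  · rintro ⟨m', h, rfl⟩; exact h
  · exact (h _ he).resolve_left (by simp)
  · by_cases hem : e = m.2.2
    · subst hem; exact .inr (h he)
    · exact .inl hem
  · exact (h _ h1 _ h2).resolve_left (by simp)
  · by_cases h1 : e = c.1 ∧ f = c.2
    · obtain ⟨rfl, rfl⟩ := h1; exact .inr (h he hf)
    · exact .inl (by simpa using h1)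

/-- Accepted choices give a solution. -/
theorem verify_sound {und : Bool} {T F : List Edge} {D : List Demand} {g : List Choice}
    (h : verify und E T F D g = true) : HasSolution und E D := by
  unfold verify at h
  rw [relaxedTimes_eq, validWalks_iff] at h
  set C := (demandWalks und T F D g).flatMap fun w => consecutive w.2
  set ν := (relaxFun E C)^[E.length] fun e => e.2.2
  refine HasSolution.of_walks (ν := ν) (fun e _ => le_iterate_relaxFun (fun e => e.2.2) _ e)
    fun d hd => ?_
  set W := connect (moves und T) d.1 (chosenMoves (ordering F g) g d) d.2.1
  have hW : (d, W) ∈ demandWalks und T F D g := List.mem_map.2 ⟨d, hd, rfl⟩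
  obtain ⟨h1, h2⟩ := h.1 _ hW
  -- The table compares only edges of `E`, so its tests say something about the walks only once
  -- their moves are known to use `E`.
  have hE : ∀ m ∈ W, m.2.2 ∈ E := fun m hm => (mem_moves.1 (h2 m hm).1).1
  refine ⟨W, fun m hm => (h2 m hm).1, h1, consecutive_iff.1 fun c hc => ?_,
    fun m hm => (h2 m hm).2 (hE m hm)⟩
  refine h.2 c (List.mem_flatMap.2 ⟨_, hW, hc⟩) ?_ ?_
  · obtain ⟨m, hm, h⟩ := List.mem_map.1 (List.of_mem_zip hc).1
    rw [← h]; exact hE m hm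
  · obtain ⟨m, hm, h⟩ := List.mem_map.1 (List.mem_of_mem_tail (List.of_mem_zip hc).2)
    rw [← h]; exact hE m hm

/-! #### Completeness -/

theorem positionOptions_cons (f : Edge) (F : List Edge) :
    positionOptions (f :: F) = (F.tails.map fun t => (t, [])) :: positionOptions F := by
  simp [positionOptions]

/-- Every ordering is described by a choice of positions. -/
theorem exists_positions {F π : List Edge} (h : π.Perm F) : ∃ g : List Choice,
    List.Forall₂ (· ∈ ·) g (positionOptions F) ∧ (∀ c ∈ g, c.2 = []) ∧ g.length = F.length ∧
      (F.zip g).reverse.foldl insertAt [] = π := by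
  induction F generalizing π with
  | nil =>
    obtain rfl := List.perm_nil.1 h
    exact ⟨[], by simp [positionOptions]⟩
  | cons f F ih =>
    obtain ⟨l₁, l₂, rfl⟩ := List.append_of_mem (h.mem_iff.2 (List.mem_cons_self))
    have h1 : (l₁ ++ l₂).Perm F := (List.perm_middle.symm.trans h).cons_inv
    obtain ⟨g, h2, h3, h4, h5⟩ := ih h1
    have h6 := h1.length_eq
    rw [List.length_append] at h6
    -- `f` is inserted last, behind `l₁`; the witness is the suffix of `F` that has the length of
    -- `l₁`.
    refine ⟨(F.drop (F.length - l₁.length), []) :: g, ?_, by simpa using h3, by simp [h4], ?_⟩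
    · rw [positionOptions_cons]
      exact .cons (List.mem_map.2 ⟨_, (List.mem_tails _ _).2 (List.drop_suffix _ _), rfl⟩) h2
    · have h7 : F.length - (F.length - l₁.length) = l₁.length := by omega
      rw [List.zip_cons_cons, List.reverse_cons, List.foldl_append, h5]
      simp [insertAt, h7]

theorem connect_nil (M : List Move) (u v : ℕ) : connect M u [] v = findPath M u v := by
  simp [connect]

theorem connect_cons (M : List Move) (u v : ℕ) (m : Move) (ms : List Move) :
    connect M u (m :: ms) v = findPath M u m.1 ++ m :: connect M m.2.1 ms v := by
  simp [connect]

/-- Simple walks are determined by their moves outside of a forest. -/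
theorem connect_eq {und : Bool} {T : List Edge} (hT : WellFormed und T)
    (ha : (graph T).IsAcyclic) (p : Move → Bool) {S : List Move}
    (hS : ∀ m ∈ S, p m = false → m ∈ moves und T) {u w v : ℕ} {P : List Move}
    (hP : P ⊆ moves und T) (hw : IsWalk u P w) (hw' : IsWalk w S v)
    (hn : (verts u (P ++ S)).Nodup) : connect (moves und T) u (S.filter p) v = P ++ S := by
  -- `P` collects the forest moves since the last chosen move. When the next chosen move or the end
  -- is reached, uniqueness identifies `P` with the path that `findPath` returns.
  induction S generalizing u w P with
  | nil =>
    rw [isWalk_nil] at hw'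
    subst hw'
    rw [List.append_nil] at hn ⊢
    rw [List.filter_nil, connect_nil, findPath_eq hT ha hP hw hn]
  | cons m S ih =>
    obtain ⟨rfl, hw1⟩ := isWalk_cons.1 hw'
    cases hp : p m
    · rw [List.filter_cons_of_neg (by simp [hp])]
      have h1 : IsWalk u (P ++ [m]) m.2.1 := isWalk_append.2 ⟨_, hw, by simp⟩
      have h2 : P ++ m :: S = (P ++ [m]) ++ S := by simp
      rw [h2] at hn ⊢
      exact ih (fun x hx => hS x (by simp [hx])) (by simpa [hP] using hS m (by simp) hp) h1 hw1 hn
    · rw [List.filter_cons_of_pos hp, connect_cons]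
      have h1 : (verts u P).Nodup := hn.sublist (by simp [verts])
      have h2 : (verts m.2.1 S).Nodup := hn.sublist (by simp [verts])
      rw [findPath_eq hT ha hP hw h1]
      have := ih (P := []) (fun x hx => hS x (by simp [hx])) (by simp) (isWalk_nil.2 rfl) hw1 h2
      rw [List.nil_append] at this
      rw [this]

/-- Since `f` strictly increases along `S`, an element with `f = n` cannot follow one with `n ≤ f`;
so the elements satisfying `p` precede those satisfying `q`. -/
theorem filter_append_filter {α : Type} {p q r : α → Bool} {f : α → ℕ} {n : ℕ} {S : List α}
    (hS : (S.map f).Pairwise (· < ·)) (hp : ∀ a ∈ S, p a = true → f a = n ∧ q a = false)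
    (hq : ∀ a ∈ S, q a = true → n ≤ f a) (hr : ∀ a, r a = (p a || q a)) :
    S.filter p ++ S.filter q = S.filter r := by
  induction S with
  | nil => rfl
  | cons a S ih =>
    rw [List.map_cons, List.pairwise_cons] at hS
    have ih := ih hS.2 (fun x hx => hp x (by simp [hx])) (fun x hx => hq x (by simp [hx]))
    cases hpa : p a
    · cases hqa : q a
      · simpa [hr, hpa, hqa] using by simpa [hr] using ih
      · have h1 := hq a (by simp) hqa
        have h2 : S.filter p = [] := List.filter_eq_nil_iff.2 fun b hb hpb => by
          have h3 := (hp b (by simp [hb]) hpb).1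
          have h4 := hS.1 _ (List.mem_map_of_mem hb)
          omega
        rw [h2] at ih
        simp [hr, hpa, hqa, h2] at ih ⊢
        exact ih
    · have h1 := (hp a (by simp) hpa).2
      simp [hr, hpa, h1] at ih ⊢
      exact ih

/-- Sorting the moves of a walk by their edges. -/
theorem flatMap_filter_eq {μ : Edge → ℕ} {π : List Edge} {S : List Move}
    (hS : (S.map fun m => μ m.2.2).Pairwise (· < ·)) (hπ : π.Pairwise fun a b => μ a ≤ μ b)
    (hn : π.Nodup) : (π.flatMap fun f => S.filter fun m => eqb m.2.2 f) =
      S.filter fun m => decide (m.2.2 ∈ π) := by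
  induction π with
  | nil => simp
  | cons f π ih =>
    rw [List.pairwise_cons] at hπ
    rw [List.nodup_cons] at hn
    rw [List.flatMap_cons, ih hπ.2 hn.2]
    -- Edges with equal times may stand in any order in `π`, since at most one of them occurs in
    -- `S`.
    refine filter_append_filter hS (n := μ f) (fun m _ h => ?_) (fun m _ h => ?_) fun m => ?_
    · rw [eqb_iff] at h
      rw [h]; exact ⟨rfl, by simpa using hn.1⟩
    · exact hπ.1 _ (by simpa using h)
    · simp [eqb]

theorem filter_flatMap_eq {α β : Type} [DecidableEq α] {l : List α} (hn : l.Nodup) {a : α}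
    (ha : a ∈ l) (key : β → α) (X : α → List β) (h : ∀ x ∈ l, ∀ y ∈ X x, key y = x) :
    (l.flatMap X).filter (fun y => eqb (key y) a) = X a := by
  induction l with
  | nil => simp at ha
  | cons b l ih =>
    rw [List.nodup_cons] at hn
    rw [List.flatMap_cons, List.filter_append]
    have h0 : ∀ x ∈ b :: l, x ≠ a → (X x).filter (fun y => eqb (key y) a) = [] := fun x hx hxa =>
      List.filter_eq_nil_iff.2 fun y hy => by simpa [h x hx y hy] using hxa
    rcases List.mem_cons.1 ha with rfl | ha'
    · have h1 : (l.flatMap X).filter (fun y => eqb (key y) a) = [] := by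
        rw [List.filter_eq_nil_iff]
        intro y hy
        obtain ⟨x, hx, hy⟩ := List.mem_flatMap.1 hy
        rw [eqb_iff, h x (by simp [hx]) y hy]
        rintro rfl; exact hn.1 hx
      have h2 : (X a).filter (fun y => eqb (key y) a) = X a :=
        List.filter_eq_self.2 fun y hy => by simpa using h a (by simp) y hy
      rw [h1, h2, List.append_nil]
    · rw [h0 b (by simp) (by rintro rfl; exact hn.1 ha'), List.nil_append]
      exact ih hn.2 ha' fun x hx => h x (by simp [hx])

theorem forall₂_flatMap_map {α β γ δ : Type} {R : γ → δ → Prop} {l : List α} {m : List β}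
    {a : α → β → γ} {b : α → β → δ} (h : ∀ x ∈ l, ∀ y ∈ m, R (a x y) (b x y)) :
    List.Forall₂ R (l.flatMap fun x => m.map (a x)) (l.flatMap fun x => m.map (b x)) := by
  have h2 : ∀ x ∈ l, ∀ m' : List β, m' ⊆ m → List.Forall₂ R (m'.map (a x)) (m'.map (b x)) := by
    intro x hx m'
    induction m' with
    | nil => simp
    | cons y m' ih =>
      intro hm
      exact .cons (h x hx y (hm (by simp))) (ih fun z hz => hm (by simp [hz]))
  induction l with
  | nil => simp
  | cons x l ih =>
    rw [List.flatMap_cons, List.flatMap_cons]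
    exact List.rel_append (h2 x (by simp) m fun _ h => h)
      (ih (fun y hy => h y (by simp [hy])) fun y hy => h2 y (by simp [hy]))

/-- If there is a solution, then some choices are accepted. -/
theorem verify_complete {und : Bool} {D : List Demand} (hE : WellFormed und E) (hD : D.Nodup)
    (h : HasSolution und E D) : ∃ g, List.Forall₂ (· ∈ ·) g (options und (feedback E) D) ∧
      verify und E (forest E) (feedback E) D g = true := by
  obtain ⟨μ, h1, h2⟩ := h
  choose! S hSM hSw hSn hSμ hSd using h2
  have hI := hE.forestInv
  set F := feedback E with hF
  have hFn : F.Nodup := hE.nodup.filter _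
  let r : Edge → Edge → Prop := fun a b => μ a ≤ μ b
  have : Std.Total r := ⟨fun a b => le_total (μ a) (μ b)⟩
  have : IsTrans Edge r := ⟨fun a b c => le_trans⟩
  -- One ordering, by the times of the solution, serves all demands.
  set π := F.insertionSort r
  have hπF : π.Perm F := List.perm_insertionSort r F
  have hπs : π.Pairwise r := List.pairwise_insertionSort r F
  obtain ⟨g₁, hg1, hg2, hg3, hg4⟩ := exists_positions hπF
  let X : Demand → Edge → List (Demand × Move) := fun d f =>
    ((S d).filter fun m => eqb m.2.2 f).map fun m => (d, m)
  let g₂ : List Choice := D.flatMap fun d => F.map fun f => ([], X d f)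
  have hord : ordering F (g₁ ++ g₂) = π := by
    -- Zipping with `F` cuts off the choices of moves.
    have : F.zip (g₁ ++ g₂) = F.zip g₁ := by
      rw [← List.append_nil F, List.zip_append hg3.symm]; simp
    rw [ordering, this, hg4]
  have hflat : (g₁ ++ g₂).flatMap (fun c => c.2) = D.flatMap fun d => F.flatMap (X d) := by
    have h3 : g₁.flatMap (fun c => c.2) = [] := List.flatMap_eq_nil_iff.2 hg2
    rw [List.flatMap_append, h3, List.nil_append]
    simp [g₂, List.flatMap_assoc, List.flatMap_map]
  have hch : ∀ d ∈ D, chosenMoves π (g₁ ++ g₂) d = (S d).filter fun m => decide (m.2.2 ∈ F) := by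
    intro d hd
    have h3 : ∀ f ∈ π, (((g₁ ++ g₂).flatMap fun c => c.2).filter fun c =>
        eqb c.1 d && eqb c.2.2.2 f).map (fun c => c.2) = (S d).filter fun m => eqb m.2.2 f := by
      intro f hf
      have h4 : ∀ L : List (Demand × Move), (L.filter fun c => eqb c.1 d && eqb c.2.2.2 f) =
          (L.filter fun c => eqb c.1 d).filter fun c => eqb c.2.2.2 f := fun L => by
        rw [List.filter_filter]; exact List.filter_congr fun c _ => Bool.and_comm _ _
      have hX : ∀ d' f', ∀ c ∈ X d' f', c.1 = d' ∧ c.2.2.2 = f' := by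
        intro d' f' c hc
        obtain ⟨m, hm, rfl⟩ := List.mem_map.1 hc
        rw [List.mem_filter, eqb_iff] at hm
        exact ⟨rfl, hm.2⟩
      rw [hflat, h4, filter_flatMap_eq hD hd (fun c : Demand × Move => c.1) _ (fun d' _ c hc => by
          obtain ⟨f', -, hc⟩ := List.mem_flatMap.1 hc
          exact (hX d' f' c hc).1),
        filter_flatMap_eq hFn (hπF.mem_iff.1 hf) (fun c : Demand × Move => c.2.2.2) _
          fun f' _ c hc => (hX d f' c hc).2]
      simp [X, Function.comp_def]
    rw [chosenMoves, List.flatMap_congr h3, flatMap_filter_eq (hSμ d hd) hπs (hπF.nodup_iff.2 hFn)]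
    refine List.filter_congr fun m _ => ?_
    rw [decide_eq_decide]; exact hπF.mem_iff
  have hwalk : demandWalks und (forest E) F D (g₁ ++ g₂) = D.map fun d => (d, S d) := by
    refine List.map_congr_left fun d hd => ?_
    rw [hord, hch d hd, connect_eq (hE.of_subset hI.subset hI.nodup) hI.acyclic _ (P := [])
      (fun m hm hmF => ?_) (by simp) (isWalk_nil.2 rfl) (hSw d hd) (hSn d hd), List.nil_append]
    have h3 := mem_moves.1 (hSM d hd hm)
    rw [decide_eq_false_iff_not, hF, mem_feedback, not_and, not_not] at hmF
    exact mem_moves.2 ⟨hmF h3.1, h3.2⟩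
  refine ⟨g₁ ++ g₂, List.rel_append hg1 (forall₂_flatMap_map fun d hd f _ => ?_), ?_⟩
  -- Times strictly increase along `S d`, so an edge is used at most once and `X d f` is one of the
  -- offered options.
  · have h3 : (((S d).filter fun m => eqb m.2.2 f).map fun m => m.2.2).Nodup := by
      have h4 : ((S d).map fun m => m.2.2).Nodup := by
        have : ((S d).map fun m => μ m.2.2).Nodup := (hSμ d hd).imp fun h => Nat.ne_of_lt h
        exact List.Nodup.of_map μ (by simpa [Function.comp_def] using this)
      exact h4.sublist ((List.filter_sublist).map _)
    rcases h5 : (S d).filter (fun m => eqb m.2.2 f) with _ | ⟨m, _ | ⟨m', l⟩⟩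
    · simp [X, h5]
    · have h6 : m ∈ (S d).filter fun m => eqb m.2.2 f := by rw [h5]; simp
      rw [List.mem_filter, eqb_iff] at h6
      have h7 := mem_moves.1 (hSM d hd h6.1)
      simp only [X, h5, List.map_cons, List.map_nil, List.mem_cons, List.mem_map]
      exact .inr ⟨m, mem_moves.2 ⟨by simp [h6.2], h7.2⟩, rfl⟩
    · have h6 : ∀ x ∈ (S d).filter fun m => eqb m.2.2 f, x.2.2 = f := fun x hx => by
        rw [List.mem_filter, eqb_iff] at hx; exact hx.2
      rw [h5] at h3 h6
      simp [h6 m (by simp), h6 m' (by simp)] at h3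
  · unfold verify
    rw [hwalk, relaxedTimes_eq, validWalks_iff]
    set C := (D.map fun d => (d, S d)).flatMap fun w => consecutive w.2
    have hC : ∀ c ∈ C, μ c.1 < μ c.2 := by
      intro c hc
      obtain ⟨w, hw, hc⟩ := List.mem_flatMap.1 hc
      obtain ⟨d, hd, rfl⟩ := List.mem_map.1 hw
      exact consecutive_iff.2 (hSμ d hd) c hc
    refine ⟨fun w hw => ?_, fun c hc hc1 hc2 => ?_⟩
    · obtain ⟨d, hd, rfl⟩ := List.mem_map.1 hw
      refine ⟨hSw d hd, fun m hm => ⟨hSM d hd hm, fun he => ?_⟩⟩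
      exact (iterate_relaxFun_le h1 hC _ _ he).trans (hSd d hd m hm)
    -- One more round would push `c.2` beyond `c.1`; by stability it already is.
    · rw [← relaxFun_stable (fun e => e.2.2) hC hc2]
      exact lt_relaxFun _ hc hc1

/-! #### Number of choices -/

/-- An element is inserted into an ordering of the elements after it in `F`; with `k` of these there
are `k + 1` positions. -/
theorem prod_positionOptions (F : List Edge) :
    ((positionOptions F).map List.length).prod = F.length.factorial := by
  induction F with
  | nil => simp [positionOptions]
  | cons f F ih => simp [positionOptions_cons, ih, Nat.factorial_succ]

theorem prod_moveOptions (und : Bool) (F : List Edge) (D : List Demand) :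
    ((moveOptions und F D).map List.length).prod =
      (if und then 3 else 2) ^ (F.length * D.length) := by
  have h : ((moveOptions und F D).map List.length) =
      List.replicate (F.length * D.length) (if und then 3 else 2) := by
    rw [List.eq_replicate_iff]
    refine ⟨by simp [moveOptions, Nat.mul_comm], fun n hn => ?_⟩
    simp only [moveOptions, List.mem_map, List.mem_flatMap] at hn
    obtain ⟨_, ⟨d, -, f, -, rfl⟩, rfl⟩ := hn
    cases und <;> simp [moves]
  rw [h, List.prod_replicate]

theorem prod_options (und : Bool) (F : List Edge) (D : List Demand) :
    ((options und F D).map List.length).prod =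
      F.length.factorial * (if und then 3 else 2) ^ (F.length * D.length) := by
  rw [options, List.map_append, List.prod_append, prod_positionOptions, prod_moveOptions]
end DelayBetter

namespace DelayBetter
open Enc (enc)

/-! ### From paths of instances to walks -/

section
variable {n : ℕ} {Adj : Fin n → Fin n → Prop} {und : Bool} {E : List Edge}
  {edgeOf : Fin n → Fin n → Edge} {τ : Fin n → Fin n → ℕ} {ν : Edge → ℕ}

theorem forall_getLast?_le_iff {l : List ℕ} (h : l.Pairwise (· < ·)) {t : ℕ} :
    (∀ a ∈ l.getLast?, a ≤ t) ↔ ∀ a ∈ l, a ≤ t := by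
  induction l using List.reverseRecOn with
  | nil => simp
  | append_singleton l b ih =>
    rw [List.pairwise_append] at h
    simp only [List.getLast?_append, List.getLast?_singleton, Option.some_or, Option.mem_def,
      Option.some.injEq, forall_eq', List.mem_append, List.mem_singleton]
    exact ⟨fun hb a ha => ha.elim (fun ha => (h.2.2 a ha b (by simp)).le.trans hb)
      fun ha => ha ▸ hb, fun hb => hb b (.inr rfl)⟩

theorem exists_walk_of_chain (hE : ∀ x y, Adj x y → ((x : ℕ), (y : ℕ), edgeOf x y) ∈ moves und E)
    (hν : ∀ x y, Adj x y → ν (edgeOf x y) = τ x y) (P : List (Fin n)) :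
    ∀ u v, (u :: P).IsChain Adj → (u :: P).getLast? = some v → ∃ S : List Move,
      S ⊆ moves und E ∧ IsWalk u S v ∧ verts u S = (u :: P).map Fin.val ∧
        (S.map fun m => ν m.2.2) = timesAlong τ (u :: P) := by
  induction P with
  | nil =>
    intro u v _ h
    simp only [List.getLast?_singleton, Option.some.injEq] at h
    subst h
    exact ⟨[], by simp [timesAlong]⟩
  | cons w P ih =>
    intro u v hc hl
    rw [List.isChain_cons_cons] at hc
    obtain ⟨S, h1, h2, h3, h4⟩ := ih w v hc.2 (by simpa using hl)
    refine ⟨(u, w, edgeOf u w) :: S, List.cons_subset.2 ⟨hE _ _ hc.1, h1⟩, by simp [h2],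
      by rw [verts_cons, h3]; rfl, ?_⟩
    rw [List.map_cons, h4, hν _ _ hc.1]
    rfl

theorem exists_chain_of_walk (hE : ∀ m ∈ moves und E, ∃ x y : Fin n, Adj x y ∧
      m = ((x : ℕ), (y : ℕ), edgeOf x y))
    (hν : ∀ x y, Adj x y → ν (edgeOf x y) = τ x y) (S : List Move) :
    ∀ u v : Fin n, S ⊆ moves und E → IsWalk u S v → ∃ P : List (Fin n),
      (u :: P).IsChain Adj ∧ (u :: P).getLast? = some v ∧
      verts u S = (u :: P).map Fin.val ∧
        (S.map fun m => ν m.2.2) = timesAlong τ (u :: P) := by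
  induction S with
  | nil =>
    intro u v _ h
    rw [isWalk_nil, Fin.val_inj] at h
    subst h
    exact ⟨[], by simp [timesAlong]⟩
  | cons m S ih =>
    intro u v hS hw
    obtain ⟨x, y, hxy, rfl⟩ := hE m (hS (List.mem_cons_self))
    obtain ⟨h0, hw⟩ := isWalk_cons.1 hw
    rw [Fin.val_inj] at h0
    subst h0
    obtain ⟨P, h1, h2, h3, h4⟩ := ih y v (fun z hz => hS (by simp [hz])) hw
    refine ⟨y :: P, List.isChain_cons_cons.2 ⟨hxy, h1⟩, by simpa using h2,
      by rw [verts_cons, h3]; rfl, ?_⟩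
    rw [List.map_cons, h4, hν _ _ hxy]
    rfl

theorem exists_temporalPath_iff
    (hE : ∀ x y, Adj x y → ((x : ℕ), (y : ℕ), edgeOf x y) ∈ moves und E)
    (hE' : ∀ m ∈ moves und E, ∃ x y : Fin n, Adj x y ∧ m = ((x : ℕ), (y : ℕ), edgeOf x y))
    (hν : ∀ x y, Adj x y → ν (edgeOf x y) = τ x y) (u v : Fin n) (t : ℕ) :
    (∃ P, IsTemporalPath Adj τ u v P ∧ ArrivesBy τ P t) ↔ ∃ S, S ⊆ moves und E ∧
      IsWalk u S v ∧ (verts u S).Nodup ∧ (S.map fun m => ν m.2.2).Pairwise (· < ·) ∧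
      ∀ m ∈ S, ν m.2.2 ≤ t := by
  constructor
  · rintro ⟨P, ⟨h1, h2, h3, h4, h5⟩, h6⟩
    cases P with
    | nil => simp at h1
    | cons u' P =>
      simp only [List.head?_cons, Option.some.injEq] at h1
      subst h1
      obtain ⟨S, hS, hw, hv, ht⟩ := exists_walk_of_chain hE hν P u' v h4 h2
      refine ⟨S, hS, hw, hv ▸ h3.map Fin.val_injective, ht ▸ h5, fun m hm => ?_⟩
      exact (forall_getLast?_le_iff h5).1 h6 _ (ht ▸ List.mem_map_of_mem hm)
  · rintro ⟨S, hS, hw, hn, hp, hd⟩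
    obtain ⟨P, h1, h2, h3, h4⟩ := exists_chain_of_walk hE' hν S u v hS hw
    refine ⟨u :: P, ⟨rfl, h2, List.Nodup.of_map _ (h3 ▸ hn), h1, h4 ▸ hp⟩, ?_⟩
    refine (forall_getLast?_le_iff (h4 ▸ hp)).2 fun a ha => ?_
    rw [← h4] at ha
    obtain ⟨m, hm, rfl⟩ := List.mem_map.1 ha
    exact hd m hm

/-- A demand with vertices as numbers. -/
def natDemand (d : Fin n × Fin n × ℕ) : Demand := (d.1, d.2.1, d.2.2)

theorem natDemand_injective : Function.Injective (natDemand (n := n)) := by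
  rintro ⟨a, b, c⟩ ⟨a', b', c'⟩ h
  simpa [natDemand, Fin.val_inj] using h

theorem meetsDemands_iff
    (hE : ∀ x y, Adj x y → ((x : ℕ), (y : ℕ), edgeOf x y) ∈ moves und E)
    (hE' : ∀ m ∈ moves und E, ∃ x y : Fin n, Adj x y ∧ m = ((x : ℕ), (y : ℕ), edgeOf x y))
    (hν : ∀ x y, Adj x y → ν (edgeOf x y) = τ x y) {D : Finset (Fin n × Fin n × ℕ)}
    {ds : List (Fin n × Fin n × ℕ)} (hD : ∀ d, d ∈ ds ↔ d ∈ D) :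
    MeetsDemands Adj τ D ↔ ∀ d ∈ ds.map natDemand, ∃ S, S ⊆ moves und E ∧ IsWalk d.1 S d.2.1 ∧
      (verts d.1 S).Nodup ∧ (S.map fun m => ν m.2.2).Pairwise (· < ·) ∧
      ∀ m ∈ S, ν m.2.2 ≤ d.2.2 := by
  simp only [List.forall_mem_map, MeetsDemands, ← hD]
  exact forall₂_congr fun d _ => exists_temporalPath_iff hE hE' hν d.1 d.2.1 d.2.2

/-- Each edge is shown to be a bridge: a walk in `graph T` that avoids it lifts, edge by edge, to a
walk in `H` that avoids the corresponding edge. -/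
theorem graph_isAcyclic {H : SimpleGraph (Fin n)} (hH : H.IsAcyclic) {T : List Edge}
    (h : ∀ a b, (graph T).Adj a b → ∃ x y : Fin n, (x : ℕ) = a ∧ (y : ℕ) = b ∧ H.Adj x y) :
    (graph T).IsAcyclic := by
  rw [SimpleGraph.isAcyclic_iff_forall_adj_isBridge]
  intro a b hab
  obtain ⟨x, y, rfl, rfl, hxy⟩ := h a b hab
  rw [SimpleGraph.isBridge_iff]
  rintro ⟨p⟩
  suffices ∀ (a b : ℕ) (_ : ((graph T).deleteEdges {s((x : ℕ), (y : ℕ))}).Walk a b) (x' : Fin n),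
      (x' : ℕ) = a → ∃ z : Fin n, (z : ℕ) = b ∧ (H.deleteEdges {s(x, y)}).Reachable x' z by
    obtain ⟨z, hz, hr⟩ := this _ _ p x rfl
    rw [Fin.val_inj] at hz
    subst hz
    exact SimpleGraph.isBridge_iff.1
      (SimpleGraph.isAcyclic_iff_forall_adj_isBridge.1 hH hxy) hr
  intro a b q
  induction q with
  | nil => rintro x' rfl; exact ⟨x', rfl, .refl _⟩
  | cons hadj q ih =>
    rintro x' rfl
    rw [SimpleGraph.deleteEdges_adj] at hadj
    obtain ⟨x₁, y₁, h1, rfl, h2⟩ := h _ _ hadj.1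
    rw [Fin.val_inj] at h1
    subst h1
    obtain ⟨z, hz, hr⟩ := ih y₁ rfl
    refine ⟨z, hz, SimpleGraph.Reachable.trans (SimpleGraph.Adj.reachable ?_) hr⟩
    rw [SimpleGraph.deleteEdges_adj]
    refine ⟨h2, fun hm => hadj.2 ?_⟩
    simp only [Set.mem_singleton_iff, Sym2.eq_iff] at hm ⊢
    rcases hm with ⟨rfl, rfl⟩ | ⟨rfl, rfl⟩ <;> simp

theorem enc_instance (es ds : List (Fin n × Fin n × ℕ)) : encInstance es ds =
    enc (List.range n, es.map natDemand, ds.map natDemand) := by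
  have h : (List.finRange n).flatMap (fun a : Fin n => [(a : ℕ)]) = List.range n :=
    (List.flatMap_pure_eq_map _ _).trans List.map_coe_finRange_eq_range
  simp [encInstance, enc, encTriple, natDemand, Function.comp_def, h]
end

/-! ### Directed instances -/

namespace DirectedInstance

/-- Since an arc determines its triple, delayings of `label` and functions on the listed triples
correspond to each other. -/
theorem reduction {I : DirectedInstance} {w : Data} (h : I.IsEncoding w) :
    ∃ (V : List ℕ) (E : List Edge) (D : List Demand), w = enc (V, E, D) ∧ WellFormed false E ∧
      D.Nodup ∧ (I.IsYes ↔ HasSolution false E D) ∧ (feedback E).length ≤ I.fes ∧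
      D.length = I.demands.card := by
  classical
  obtain ⟨arcs, ds, hn, harcs, hdn, hds, rfl⟩ := h
  let tri : Fin I.n × Fin I.n → Edge := fun e => (e.1, e.2, I.label e.1 e.2)
  have htri : Function.Injective tri := by
    rintro ⟨a, b⟩ ⟨a', b'⟩ h
    simp only [tri, Prod.mk.injEq, Fin.val_inj] at h
    exact Prod.ext h.1 h.2.1
  have hmap : (arcs.map fun e => (e.1, e.2, I.label e.1 e.2)).map natDemand = arcs.map tri := by
    simp [natDemand, tri, Function.comp_def]
  have hE : ∀ x y, I.footprint.Adj x y → ((x : ℕ), (y : ℕ), tri (x, y)) ∈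
      moves false (arcs.map tri) := fun x y hxy =>
    mem_moves.2 ⟨List.mem_map_of_mem ((harcs _).2 hxy), .inl ⟨rfl, rfl⟩⟩
  have hE' : ∀ m ∈ moves false (arcs.map tri), ∃ x y : Fin I.n, I.footprint.Adj x y ∧
      m = ((x : ℕ), (y : ℕ), tri (x, y)) := by
    rintro ⟨a, b, e⟩ hm
    obtain ⟨he, ⟨h1, h2⟩ | ⟨h1, -⟩⟩ := mem_moves.1 hm
    · obtain ⟨f, hf, rfl⟩ := List.mem_map.1 he
      simp only [tri] at h1 h2
      subst h1 h2
      exact ⟨f.1, f.2, (harcs f).1 hf, rfl⟩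
    · simp at h1
  have hwf : WellFormed false (arcs.map tri) := by
    refine ⟨hn.map htri, ?_, ?_, by simp⟩
    · simp only [List.forall_mem_map]
      intro e he h1
      have h2 := (harcs e).1 he
      simp only [tri, Fin.val_inj] at h1
      rw [h1] at h2
      exact I.loopless _ h2
    · simp only [List.forall_mem_map]
      intro e _ f _ h1 h2
      simp only [tri, Fin.val_inj] at h1 h2
      rw [Prod.ext h1 h2]
  refine ⟨_, _, _, enc_instance _ _, hmap ▸ hwf, hdn.map natDemand_injective, ?_, ?_, ?_⟩
  · rw [hmap]
    constructor
    · rintro ⟨τ, h1, h2⟩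
      let ν : Edge → ℕ := fun e => if h : e.1 < I.n ∧ e.2.1 < I.n then τ ⟨e.1, h.1⟩ ⟨e.2.1, h.2⟩
        else 0
      have hν : ∀ x y, ν (tri (x, y)) = τ x y := fun x y => by simp [ν, tri]
      refine ⟨ν, ?_, (meetsDemands_iff hE hE' (fun x y _ => hν x y) hds).1 h2⟩
      simp only [List.forall_mem_map]
      intro e he
      have := h1 e.1 e.2 ((harcs e).1 he)
      rw [← hν] at this
      exact this
    · rintro ⟨ν, h1, h2⟩
      refine ⟨fun x y => ν (tri (x, y)), fun x y hxy => ?_,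
        (meetsDemands_iff hE hE' (fun x y _ => rfl) hds).2 h2⟩
      exact h1 _ (List.mem_map_of_mem (f := tri) ((harcs (x, y)).2 hxy))
  · rw [hmap]
    -- The infimum of the empty set is 0, so attaining the minimum needs some feedback edge set; the
    -- set of all arcs is one.
    have hne : {k | ∃ F, I.IsFeedbackEdgeSet F ∧ F.card = k}.Nonempty := by
      refine ⟨_, arcs.toFinset, ⟨fun e he => (harcs e).1 (by simpa using he), ?_⟩, rfl⟩
      have : (SimpleGraph.fromRel fun u v => I.footprint.Adj u v ∧ (u, v) ∉ arcs.toFinset) = ⊥ := by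
        ext u v; simp [harcs]
      rw [this]
      exact SimpleGraph.isAcyclic_bot
    obtain ⟨F, ⟨-, hF⟩, hk⟩ := Nat.sInf_mem hne
    have h1 : (arcs.filter fun e => decide (e ∈ F)).length ≤ F.card := by
      rw [← List.toFinset_card_of_nodup (hn.filter _)]
      exact Finset.card_le_card fun e he => by simp at he; exact he.2
    have h2 : (arcs.filter fun e => decide (e ∈ F)).length +
        (arcs.filter fun e => ! decide (e ∈ F)).length = arcs.length := by
      simpa using (List.filter_append_perm (fun e => decide (e ∈ F)) arcs).length_eq
    -- The arcs outside a minimum feedback edge set form an acyclic part of the footprint, so the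
    -- forest has at least as many.
    have h3 := hwf.length_feedback_le (T' := (arcs.filter fun e => ! decide (e ∈ F)).map tri)
      (List.map_subset _ fun e he => (List.mem_filter.1 he).1) ((hn.filter _).map htri)
      (graph_isAcyclic hF fun a b hab => by
        obtain ⟨hne, e, he, hab⟩ := hab
        obtain ⟨f, hf, rfl⟩ := List.mem_map.1 he
        obtain ⟨hf, hfF⟩ := List.mem_filter.1 hf
        have hf := (harcs f).1 hf
        simp only [Bool.not_eq_true', decide_eq_false_iff_not] at hfF
        have hff : f.1 ≠ f.2 := fun h => I.loopless f.2 (by rw [h] at hf; exact hf)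
        rcases hab with ⟨rfl, rfl⟩ | ⟨rfl, rfl⟩
        · exact ⟨f.1, f.2, rfl, rfl, hff, .inl ⟨hf, hfF⟩⟩
        · exact ⟨f.2, f.1, rfl, rfl, hff.symm, .inr ⟨hf, hfF⟩⟩)
    simp only [List.length_map] at h3
    unfold fes
    omega
  · rw [List.length_map, ← List.toFinset_card_of_nodup hdn]
    congr 1; ext d; simp [hds]

end DirectedInstance

/-! ### Undirected instances -/

namespace UndirectedInstance

theorem reduction {I : UndirectedInstance} {w : Data} (h : I.IsEncoding w) :
    ∃ (V : List ℕ) (E : List Edge) (D : List Demand), w = enc (V, E, D) ∧ WellFormed true E ∧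
      D.Nodup ∧ (I.IsYes ↔ HasSolution true E D) ∧ (feedback E).length ≤ I.fes ∧
      D.length = I.demands.card := by
  classical
  obtain ⟨edges, ds, hn, hedges, hdn, hds, rfl⟩ := h
  let tri : Fin I.n × Fin I.n → Edge := fun e => (e.1, e.2, I.label s(e.1, e.2))
  have htri : Function.Injective tri := by
    rintro ⟨a, b⟩ ⟨a', b'⟩ h
    simp only [tri, Prod.mk.injEq, Fin.val_inj] at h
    exact Prod.ext h.1 h.2.1
  have hmap : (edges.map fun e => (e.1, e.2, I.label s(e.1, e.2))).map natDemand =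
      edges.map tri := by
    simp [natDemand, tri, Function.comp_def]
  have hinj : ∀ e ∈ edges, ∀ f ∈ edges, s(e.1, e.2) = s(f.1, f.2) → e = f := fun e he f hf =>
    List.inj_on_of_nodup_map hn he hf
  have hn' : edges.Nodup := List.Nodup.of_map _ hn
  have hadj : ∀ e ∈ edges, I.footprint.Adj e.1 e.2 := fun e he =>
    (hedges _ _).1 (List.mem_map.2 ⟨e, he, rfl⟩)
  -- `rep` will return the listed orientation of an edge; the implication is inside the existential
  -- so that `rep` is defined on all pairs.
  have hex : ∀ q, ∃ e, q ∈ I.footprint.edgeSet → e ∈ edges ∧ s(e.1, e.2) = q := fun q => by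
    induction q with | h x y =>
    by_cases hq : I.footprint.Adj x y
    · obtain ⟨e, he⟩ := List.mem_map.1 ((hedges x y).2 hq)
      exact ⟨e, fun _ => he⟩
    · exact ⟨(x, y), fun h => absurd h hq⟩
  choose rep hrep using hex
  have hrep1 q hq := (hrep q hq).1
  have hrep2 q hq := (hrep q hq).2
  have hE : ∀ x y, I.footprint.Adj x y → ((x : ℕ), (y : ℕ), tri (rep s(x, y))) ∈
      moves true (edges.map tri) := fun x y hxy => by
    refine mem_moves.2 ⟨List.mem_map_of_mem (hrep1 _ hxy), ?_⟩
    rcases Sym2.eq_iff.1 (hrep2 _ hxy) with ⟨h1, h2⟩ | ⟨h1, h2⟩ <;> simp [tri, h1, h2]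
  have hrep3 : ∀ e ∈ edges, rep s(e.1, e.2) = e := fun e he =>
    hinj _ (hrep1 _ (hadj e he)) e he (hrep2 _ (hadj e he))
  have hE' : ∀ m ∈ moves true (edges.map tri), ∃ x y : Fin I.n, I.footprint.Adj x y ∧
      m = ((x : ℕ), (y : ℕ), tri (rep s(x, y))) := by
    rintro ⟨a, b, e⟩ hm
    obtain ⟨he, h⟩ := mem_moves.1 hm
    obtain ⟨f, hf, rfl⟩ := List.mem_map.1 he
    rcases h with ⟨h1, h2⟩ | ⟨-, h1, h2⟩ <;> simp only [tri] at h1 h2 <;> subst h1 h2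
    · exact ⟨f.1, f.2, hadj f hf, by rw [hrep3 f hf]⟩
    · exact ⟨f.2, f.1, (hadj f hf).symm, by rw [Sym2.eq_swap, hrep3 f hf]⟩
  have hwf : WellFormed true (edges.map tri) := by
    refine ⟨hn'.map htri, ?_, ?_, fun _ => ?_⟩ <;> simp only [List.forall_mem_map]
    · intro e he h1
      simp only [tri, Fin.val_inj] at h1
      exact (hadj e he).ne h1
    · intro e _ f _ h1 h2
      simp only [tri, Fin.val_inj] at h1 h2
      rw [Prod.ext h1 h2]
    · intro e he f hf h1 h2
      simp only [tri, Fin.val_inj] at h1 h2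
      have := hinj e he f hf (Sym2.eq_iff.2 (.inr ⟨h1, h2⟩))
      subst this
      exact (hadj e he).ne h1
  refine ⟨_, _, _, enc_instance _ _, hmap ▸ hwf, hdn.map natDemand_injective, ?_, ?_, ?_⟩
  · rw [hmap]
    constructor
    · rintro ⟨τ, h1, h2⟩
      let ν : Edge → ℕ := fun e => if h : e.1 < I.n ∧ e.2.1 < I.n then
        τ s(⟨e.1, h.1⟩, ⟨e.2.1, h.2⟩) else 0
      have hν : ∀ e, ν (tri e) = τ s(e.1, e.2) := fun e => by simp [ν, tri]
      refine ⟨ν, ?_, (meetsDemands_iff hE hE' (fun x y hxy => ?_) hds).1 h2⟩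
      · simp only [List.forall_mem_map]
        intro e he
        rw [hν]
        exact h1 _ (hadj e he)
      · rw [hν, hrep2 _ hxy]
    · rintro ⟨ν, h1, h2⟩
      refine ⟨fun q => ν (tri (rep q)), fun q hq => ?_,
        (meetsDemands_iff hE hE' (fun x y _ => rfl) hds).2 h2⟩
      have := h1 _ (List.mem_map_of_mem (f := tri) (hrep1 q hq))
      rwa [show (tri (rep q)).2.2 = I.label q from congrArg I.label (hrep2 q hq)] at this
  · rw [hmap]
    have hne : {k | ∃ F, I.IsFeedbackEdgeSet F ∧ F.card = k}.Nonempty := by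
      refine ⟨_, I.footprint.edgeFinset, ⟨fun e he => SimpleGraph.mem_edgeFinset.1 he, ?_⟩, rfl⟩
      simp
    obtain ⟨F, ⟨-, hF⟩, hk⟩ := Nat.sInf_mem hne
    have h1 : (edges.filter fun e => decide (s(e.1, e.2) ∈ F)).length ≤ F.card := by
      have h2 : ((edges.filter fun e => decide (s(e.1, e.2) ∈ F)).map fun e => s(e.1, e.2)).Nodup :=
        hn.sublist ((List.filter_sublist).map _)
      rw [← List.length_map (f := fun e : Fin I.n × Fin I.n => s(e.1, e.2)),
        ← List.toFinset_card_of_nodup h2]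
      refine Finset.card_le_card fun q hq => ?_
      rw [List.mem_toFinset, List.mem_map] at hq
      obtain ⟨e, he, rfl⟩ := hq
      simpa using (List.mem_filter.1 he).2
    have h2 : (edges.filter fun e => decide (s(e.1, e.2) ∈ F)).length +
        (edges.filter fun e => ! decide (s(e.1, e.2) ∈ F)).length = edges.length := by
      simpa using (List.filter_append_perm (fun e => decide (s(e.1, e.2) ∈ F)) edges).length_eq
    have h3 := hwf.length_feedback_le
      (T' := (edges.filter fun e => ! decide (s(e.1, e.2) ∈ F)).map tri)
      (List.map_subset _ fun e he => (List.mem_filter.1 he).1) ((hn'.filter _).map htri)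
      (graph_isAcyclic hF fun a b hab => by
        obtain ⟨hne, e, he, hab⟩ := hab
        obtain ⟨f, hf, rfl⟩ := List.mem_map.1 he
        obtain ⟨hf, hfF⟩ := List.mem_filter.1 hf
        simp only [Bool.not_eq_true', decide_eq_false_iff_not] at hfF
        have hff : (I.footprint.deleteEdges (F : Set _)).Adj f.1 f.2 :=
          SimpleGraph.deleteEdges_adj.2 ⟨hadj f hf, by simpa using hfF⟩
        rcases hab with ⟨rfl, rfl⟩ | ⟨rfl, rfl⟩
        · exact ⟨f.1, f.2, rfl, rfl, hff⟩
        · exact ⟨f.2, f.1, rfl, rfl, hff.symm⟩)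
    simp only [List.length_map] at h3
    unfold fes
    omega
  · rw [List.length_map, ← List.toFinset_card_of_nodup hdn]
    congr 1; ext d; simp [hds]

end UndirectedInstance

/-! ### The theorem -/

/-- The program never computes `ρ`: its running time depends on `|F|`, and the bound is monotone in
`|F| ≤ ρ`. -/
theorem solvableInTimePoly_of_reduction {ι : Type} {IsEnc : ι → Data → Prop} {Q : ι → Prop}
    {ρ δ : ι → ℕ} (und : Bool) (h : ∀ I w, IsEnc I w → ∃ (V : List ℕ) (E : List Edge)
      (D : List Demand), w = enc (V, E, D) ∧ WellFormed und E ∧ D.Nodup ∧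
      (Q I ↔ HasSolution und E D) ∧ (feedback E).length ≤ ρ I ∧ D.length = δ I) :
    SolvableInTimePoly IsEnc Q
      fun I => (ρ I).factorial * (if und then 3 else 2) ^ (ρ I * δ I) := by
  obtain ⟨c, p, hc⟩ := exists_program und
  refine ⟨c, p, fun I w hw => ?_⟩
  obtain ⟨V, E, D, rfl, hE, hD, hQ, hρ, hδ⟩ := h I w hw
  obtain ⟨s, t, h1, h2, h3⟩ := hc V E D
  refine ⟨s, t, h1, h2.trans (Nat.mul_le_mul_right _ ?_), h3.trans ⟨?_, fun hI => ?_⟩⟩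
  · rw [prod_options, hδ]
    exact Nat.mul_le_mul (Nat.factorial_le hρ)
      (Nat.pow_le_pow_right (by split <;> simp) (Nat.mul_le_mul_right _ hρ))
  · rintro ⟨g, -, hg⟩
    exact hQ.2 (verify_sound hg)
  · exact verify_complete hE hD (hQ.1 hI)

theorem SolvableInTimePoly.mono {ι : Type} {IsEnc : ι → Data → Prop} {Q : ι → Prop} {B B' : ι → ℕ}
    (h : SolvableInTimePoly IsEnc Q B) (hB : ∀ I, B I ≤ B' I) : SolvableInTimePoly IsEnc Q B' := by
  obtain ⟨c, p, hc⟩ := h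
  refine ⟨c, p, fun I w hw => ?_⟩
  obtain ⟨s, t, h1, h2, h3⟩ := hc I w hw
  exact ⟨s, t, h1, h2.trans (Nat.mul_le_mul_right _ (hB I)), h3⟩

theorem computable_bound : Computable fun k : ℕ => k.factorial * 3 ^ (k * k) := by
  have hf : Primrec Nat.factorial := by
    refine (Primrec.nat_rec₁ (f := fun k r => (k + 1) * r) 1
      (Primrec.nat_mul.comp₂ (Primrec.succ.comp₂ .left) .right)).of_eq fun k => ?_
    induction k with
    | zero => rfl
    | succ k ih => rw [Nat.factorial_succ, ← ih]
  have hp : Primrec fun k : ℕ => 3 ^ k := by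
    refine (Primrec.nat_rec₁ (f := fun _ r => r * 3) 1
      (Primrec.nat_mul.comp₂ .right (.const 3))).of_eq fun k => ?_
    induction k with
    | zero => rfl
    | succ k ih => rw [pow_succ, ← ih]
  exact (Primrec.nat_mul.comp hf (hp.comp (Primrec.nat_mul.comp .id .id))).to_comp

theorem bound_le {c a b : ℕ} (h : c ≤ 3) : a.factorial * c ^ (a * b) ≤
    (a + b).factorial * 3 ^ ((a + b) * (a + b)) :=
  Nat.mul_le_mul (Nat.factorial_le (by omega)) ((Nat.pow_le_pow_left h _).trans
    (Nat.pow_le_pow_right (by omega) (Nat.mul_le_mul (by omega) (by omega))))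

end DelayBetter

theorem mainTheorem2 :
    (DelayBetter.SolvableInTimePoly
        DelayBetter.DirectedInstance.IsEncoding DelayBetter.DirectedInstance.IsYes
        (fun I => I.fes.factorial * 2 ^ (I.fes * I.demands.card)) ∧
      DelayBetter.SolvableInTimePoly
        DelayBetter.UndirectedInstance.IsEncoding DelayBetter.UndirectedInstance.IsYes
        (fun I => I.fes.factorial * 3 ^ (I.fes * I.demands.card))) ∧
    (DelayBetter.FixedParameterTractable
        DelayBetter.DirectedInstance.IsEncoding DelayBetter.DirectedInstance.IsYes
        (fun I => I.fes + I.demands.card) ∧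
      DelayBetter.FixedParameterTractable
        DelayBetter.UndirectedInstance.IsEncoding DelayBetter.UndirectedInstance.IsYes
        (fun I => I.fes + I.demands.card)) := by
  have hd := DelayBetter.solvableInTimePoly_of_reduction false
    fun I w (h : DelayBetter.DirectedInstance.IsEncoding I w) => DelayBetter.DirectedInstance.reduction h
  have hu := DelayBetter.solvableInTimePoly_of_reduction true
    fun I w (h : DelayBetter.UndirectedInstance.IsEncoding I w) =>
      DelayBetter.UndirectedInstance.reduction h
  exact ⟨⟨hd, hu⟩, ⟨_, DelayBetter.computable_bound, hd.mono fun I =>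
      DelayBetter.bound_le (by norm_num)⟩,
    ⟨_, DelayBetter.computable_bound, hu.mono fun I =>
      DelayBetter.bound_le (by norm_num)⟩⟩
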